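/- Let $M$ be a Riemannian manifold of constant sectional curvature (for instance a space form) with Levi-Civita connection $\nabla$, and let $\mathcal F$ be a singular Riemannian foliation of $M$: a decomposition of $M$ into disjoint connected injectively immersed submanifolds (leaves), possibly of different dimensions, such that every geodesic that is perpendicular to one leaf is perpendicular to all the leaves it meets, and such that around each point there are local smooth vector fields spanning the tangent spaces of the leaves. (If all leaves have the same dimension, $\mathcal F$ is a regular Riemannian foliation. Completeness of $M$ or of the leaves is not required.) The regular part $M_{reg}$ is the set of points whose leaf has maximal dimension. Vectors tangent to the leaves are called vertical, vectors normal to the leaves horizontal, and $E^v$ is the vertical part of $E$. On an open set $U\subseteq M_{reg}$, a smooth horizontal vector field $X$ is *basic* if $[X,V]$ is vertical for every locally defined smooth vertical vector field $V$; a smooth function on $U$ is *basic* if it is locally constant along the leaves (in the topology of the leaves). For horizontal vector fields $X,Y$ and vertical vectors $u$ let $S_Xu=-(\nabla_uX)^v$ be the shape operator of the leaves and $A_XY=(\nabla_XY)^v$ the O'Neill tensor. Let $U\subseteq M_{reg}$ be open and let $X$ be a basic vector field on $U$. Then: 1. For all basic vector fields $Y,Z$ on $U$ and all integers $k\ge 0$,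 the function $\langle S_X^kA_XY,A_XZ\rangle$ is basic on $U$. 2. Suppose that at every point of $U$ all eigenvalues of $S_X$ (as an endomorphism of the vertical space) are distinct, and let $V_1,\dots,V_m$ be smooth vertical vector fields on $U$ of unit length which at every point of $U$ are eigenvectors of $S_X$ for its $m$ distinct eigenvalues, $m$ being the dimension of the leaves. Then for every basic vector field $Y$ on $U$ and every $i$, the function $\langle A_XY,V_i\rangle$ is basic on $U$. The same holds along a single leaf $\mathcal L$: if $W\subseteq\mathcal L$ is open in $\mathcal L$, contained in $U$, $S_X$ has distinct eigenvalues at every point of $W$, and $V_1,\dots,V_m$ are continuous unit vertical vector fields along $W$ which are eigenvectors of $S_X$ for these distinct eigenvalues, then $\langle A_XY,V_i\rangle$ is locally constant on $W$ for every basic $Y$ on $U$ and every $i$. -/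

import Mathlib

open Bundle Set Filter VectorField
open scoped Manifold ContDiff Topology

universe u

noncomputable section

namespace RiemFol

/-! ### Riemannian geometry: Levi-Civita connection, geodesics, curvature -/

section Riemannian

variable {n : ℕ} {M : Type u} [TopologicalSpace M] [ChartedSpace (EuclideanSpace ℝ (Fin n)) M]
  [IsManifold (𝓡 n) ∞ M]

/-- `X` is a smooth vector field on the set `U`. -/
def IsSmoothField (U : Set M) (X : (p : M) → TangentSpace (𝓡 n) p) : Prop :=
  ContMDiffOn (𝓡 n) (𝓡 n).tangent ∞ (fun p => (⟨p, X p⟩ : TangentBundle (𝓡 n) M)) U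

variable [RiemannianBundle (fun p : M => TangentSpace (𝓡 n) p)]

instance (p : M) : FiniteDimensional ℝ (TangentSpace (𝓡 n) p) :=
  inferInstanceAs (FiniteDimensional ℝ (EuclideanSpace ℝ (Fin n)))

/-- The derivative `X⟨Y, Z⟩` at `p`. -/
def derivInner (X Y Z : (p : M) → TangentSpace (𝓡 n) p) (p : M) : ℝ :=
  mvfderiv (𝓡 n) (fun q : M => (inner ℝ (Y q) (Z q) : ℝ)) p (X p)

/-- The right hand side of the Koszul formula, which equals `2⟨∇_X Y, Z⟩`. -/
def koszul (X Y Z : (p : M) → TangentSpace (𝓡 n) p) (p : M) : ℝ :=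
  derivInner X Y Z p + derivInner Y X Z p - derivInner Z X Y p
    + inner ℝ (mlieBracket (𝓡 n) X Y p) (Z p)
    - inner ℝ (mlieBracket (𝓡 n) X Z p) (Y p)
    - inner ℝ (mlieBracket (𝓡 n) Y Z p) (X p)

/-- An extension of the tangent vector `v` at `p` to a vector field, smooth near `p`. -/
def extendVec {p : M} (v : TangentSpace (𝓡 n) p) : (q : M) → TangentSpace (𝓡 n) q :=
  FiberBundle.extend (EuclideanSpace ℝ (Fin n)) v

/-- The Levi-Civita connection, given by the Koszul formula: `nabla Y p v = ∇_v Y` for a vector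
field `Y` that is differentiable at `p` and `v ∈ T_p M`. It is the linear map in `v` whose matrix
entries in an orthonormal basis `e` of `T_p M` are `⟨∇_{e i} Y, e j⟩`. -/
def nabla (Y : (p : M) → TangentSpace (𝓡 n) p) (p : M) :
    TangentSpace (𝓡 n) p →ₗ[ℝ] TangentSpace (𝓡 n) p :=
  let e := stdOrthonormalBasis ℝ (TangentSpace (𝓡 n) p)
  e.toBasis.constr ℝ fun i => ∑ j, (koszul (extendVec (e i)) Y (extendVec (e j)) p / 2) • e j

/-- The curvature `R(X, Y) Z = ∇_X ∇_Y Z - ∇_Y ∇_X Z - ∇_[X, Y] Z`. -/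
def curvature (X Y Z : (p : M) → TangentSpace (𝓡 n) p) (p : M) : TangentSpace (𝓡 n) p :=
  nabla (fun q => nabla Z q (Y q)) p (X p) - nabla (fun q => nabla Z q (X q)) p (Y p)
    - nabla Z p (mlieBracket (𝓡 n) X Y p)

variable (n M) in
/-- All sectional curvatures are equal to `c`. -/
def HasConstantCurvature (c : ℝ) : Prop :=
  ∀ X Y : (p : M) → TangentSpace (𝓡 n) p, IsSmoothField univ X → IsSmoothField univ Y → ∀ p,
    inner ℝ (curvature X Y Y p) (X p)
      = c * (inner ℝ (X p) (X p) * inner ℝ (Y p) (Y p) - inner ℝ (X p) (Y p) ^ 2)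

/-- The velocity of a curve. -/
def velocity (n : ℕ) {M : Type u} [TopologicalSpace M]
    [ChartedSpace (EuclideanSpace ℝ (Fin n)) M] (γ : ℝ → M) (t : ℝ) : TangentSpace (𝓡 n) (γ t) :=
  mfderiv 𝓘(ℝ, ℝ) (𝓡 n) γ t (1 : ℝ)

/-- `γ` is a geodesic on the open interval `J`: it is smooth there and the covariant derivative of
`γ'` along `γ` vanishes. The last condition is tested against vector fields `Z`: by the
compatibility of `∇` with the metric, `⟨∇γ'/dt, Z⟩ = d/dt ⟨γ', Z⟩ - ⟨γ', ∇_γ' Z⟩`. -/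
def IsGeodesic (n : ℕ) {M : Type u} [TopologicalSpace M]
    [ChartedSpace (EuclideanSpace ℝ (Fin n)) M] [IsManifold (𝓡 n) ∞ M]
    [RiemannianBundle (fun p : M => TangentSpace (𝓡 n) p)] (γ : ℝ → M) (J : Set ℝ) : Prop :=
  ContMDiffOn 𝓘(ℝ, ℝ) (𝓡 n) ∞ γ J ∧
    ∀ Z : (p : M) → TangentSpace (𝓡 n) p, IsSmoothField univ Z → ∀ t ∈ J,
      HasDerivAt (fun s => (inner ℝ (velocity n γ s) (Z (γ s)) : ℝ))
        (inner ℝ (velocity n γ t) (nabla Z (γ t) (velocity n γ t))) t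

end Riemannian

/-! ### Singular Riemannian foliations -/

/-- A decomposition of `M` into disjoint connected immersed submanifolds, the leaves, of possibly
different dimensions. A leaf is a connected smooth manifold with an injective smooth immersion
into `M`. -/
structure LeafDecomposition (n : ℕ) (M : Type u) [TopologicalSpace M]
    [ChartedSpace (EuclideanSpace ℝ (Fin n)) M] where
  /-- the set of leaves -/
  Leaf : Type u
  /-- the dimension of a leaf -/
  dim : Leaf → ℕ
  /-- the points of a leaf -/
  carrier : Leaf → Type u
  [topology : ∀ L, TopologicalSpace (carrier L)]
  [charted : ∀ L, ChartedSpace (EuclideanSpace ℝ (Fin (dim L))) (carrier L)]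
  [manifold : ∀ L, IsManifold (𝓡 (dim L)) ∞ (carrier L)]
  [connected : ∀ L, ConnectedSpace (carrier L)]
  /-- the inclusion of a leaf -/
  incl : ∀ L, carrier L → M
  contMDiff_incl : ∀ L, ContMDiff (𝓡 (dim L)) (𝓡 n) ∞ (incl L)
  injective_incl : ∀ L, Function.Injective (incl L)
  injective_mfderiv : ∀ L q, Function.Injective (mfderiv (𝓡 (dim L)) (𝓡 n) (incl L) q)
  partition : ∀ p : M, ∃! L, p ∈ range (incl L)

attribute [instance] LeafDecomposition.topology LeafDecomposition.charted
  LeafDecomposition.manifold LeafDecomposition.connected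

namespace LeafDecomposition

section Vertical

variable {n : ℕ} {M : Type u} [TopologicalSpace M] [ChartedSpace (EuclideanSpace ℝ (Fin n)) M]

/-- `v ∈ T_p M` is tangent to the leaf through `p`. -/
def IsTangentVec (F : LeafDecomposition n M) (p : M) (v : TangentSpace (𝓡 n) p) : Prop :=
  ∃ (L : F.Leaf) (w : TangentBundle (𝓡 (F.dim L)) (F.carrier L)),
    tangentMap (𝓡 (F.dim L)) (𝓡 n) (F.incl L) w = (⟨p, v⟩ : TangentBundle (𝓡 n) M)

theorem isTangentVec_iff (F : LeafDecomposition n M) (L : F.Leaf) (q : F.carrier L)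
    (v : TangentSpace (𝓡 n) (F.incl L q)) :
    F.IsTangentVec (F.incl L q) v ↔
      ∃ w, mfderiv (𝓡 (F.dim L)) (𝓡 n) (F.incl L) q w = v := by
  constructor
  · rintro ⟨L', ⟨q', w⟩, h⟩
    have h1 : F.incl L' q' = F.incl L q := congrArg TotalSpace.proj h
    obtain rfl : L' = L := (F.partition (F.incl L q)).unique ⟨q', h1⟩ ⟨q, rfl⟩
    obtain rfl : q' = q := F.injective_incl _ h1
    simp only [tangentMap, TotalSpace.mk.injEq, heq_eq_eq, true_and] at h
    exact ⟨w, h⟩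
  · rintro ⟨w, rfl⟩
    exact ⟨L, ⟨q, w⟩, rfl⟩

/-- The vertical space at `p`: the tangent space of the leaf through `p`. -/
def vertical (F : LeafDecomposition n M) (p : M) : Submodule ℝ (TangentSpace (𝓡 n) p) where
  carrier := {v | F.IsTangentVec p v}
  zero_mem' := by
    obtain ⟨L, ⟨q, rfl⟩, -⟩ := F.partition p
    exact (F.isTangentVec_iff L q 0).2 ⟨0, map_zero _⟩
  add_mem' := by
    obtain ⟨L, ⟨q, rfl⟩, -⟩ := F.partition p
    intro a b ha hb
    obtain ⟨v, rfl⟩ := (F.isTangentVec_iff L q a).1 ha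
    obtain ⟨w, rfl⟩ := (F.isTangentVec_iff L q b).1 hb
    exact (F.isTangentVec_iff L q _).2 ⟨v + w, map_add _ _ _⟩
  smul_mem' := by
    obtain ⟨L, ⟨q, rfl⟩, -⟩ := F.partition p
    intro r a ha
    obtain ⟨v, rfl⟩ := (F.isTangentVec_iff L q a).1 ha
    exact (F.isTangentVec_iff L q _).2 ⟨r • v, map_smul _ _ _⟩

/-- The regular part of `M`: the points whose leaf has maximal dimension. -/
def regularPart (F : LeafDecomposition n M) : Set M :=
  {p | ∀ L L' : F.Leaf, p ∈ range (F.incl L) → F.dim L' ≤ F.dim L}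

/-- `f` is a basic function on `U`: it is smooth on `U` and locally constant along the leaves
(with respect to the topology of the leaves). -/
def IsBasicFunction (F : LeafDecomposition n M) (U : Set M) (f : M → ℝ) : Prop :=
  ContMDiffOn (𝓡 n) 𝓘(ℝ, ℝ) ∞ f U ∧
    ∀ (L : F.Leaf) (q : F.carrier L), F.incl L q ∈ U →
      ∀ᶠ q' in 𝓝 q, f (F.incl L q') = f (F.incl L q)

variable [IsManifold (𝓡 n) ∞ M] [RiemannianBundle (fun p : M => TangentSpace (𝓡 n) p)]

/-- The horizontal space at `p`: the normal space of the leaf through `p`. -/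
def horizontal (F : LeafDecomposition n M) (p : M) : Submodule ℝ (TangentSpace (𝓡 n) p) :=
  (F.vertical p)ᗮ

/-- `X` is a basic vector field on `U`: it is smooth, horizontal, and `[X, V]` is vertical for all
(locally defined) smooth vertical vector fields `V`. -/
structure IsBasicField (F : LeafDecomposition n M) (U : Set M)
    (X : (p : M) → TangentSpace (𝓡 n) p) : Prop where
  smooth : IsSmoothField U X
  mem_horizontal : ∀ p ∈ U, X p ∈ F.horizontal p
  bracket_mem_vertical : ∀ U' : Set M, IsOpen U' → U' ⊆ U →
    ∀ V : (p : M) → TangentSpace (𝓡 n) p, IsSmoothField U' V → (∀ p ∈ U', V p ∈ F.vertical p) →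
      ∀ p ∈ U', mlieBracket (𝓡 n) X V p ∈ F.vertical p

/-- The shape operator `S_X u = -(∇_u X)^v` of the leaf through `p`, for a horizontal vector
field `X`. -/
def shape (F : LeafDecomposition n M) (X : (p : M) → TangentSpace (𝓡 n) p) (p : M) :
    Module.End ℝ (F.vertical p) :=
  -((F.vertical p).orthogonalProjectionOnto.toLinearMap ∘ₗ nabla X p ∘ₗ (F.vertical p).subtype)

/-- O'Neill's tensor `A_X Y = (∇_X Y)^v`, for horizontal vector fields `X` and `Y`. -/
def oneill (F : LeafDecomposition n M) (X Y : (p : M) → TangentSpace (𝓡 n) p) (p : M) :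
    F.vertical p :=
  (F.vertical p).orthogonalProjectionOnto (nabla Y p (X p))

end Vertical

end LeafDecomposition

/-- A singular Riemannian foliation of the Riemannian manifold `M`. The leaves may have different
dimensions, and are not required to be complete; so regular Riemannian foliations are those where
all leaves have the same dimension. -/
structure SingularRiemannianFoliation (n : ℕ) (M : Type u) [TopologicalSpace M]
    [ChartedSpace (EuclideanSpace ℝ (Fin n)) M] [IsManifold (𝓡 n) ∞ M]
    [RiemannianBundle (fun p : M => TangentSpace (𝓡 n) p)] extends LeafDecomposition n M where
  /-- A geodesic that meets one leaf perpendicularly is perpendicular to all leaves it meets. -/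
  transnormal : ∀ (γ : ℝ → M) (J : Set ℝ), IsOpen J → IsPreconnected J → IsGeodesic n γ J →
    (∃ t ∈ J, velocity n γ t ∈ toLeafDecomposition.horizontal (γ t)) →
      ∀ t ∈ J, velocity n γ t ∈ toLeafDecomposition.horizontal (γ t)
  /-- Around each point, local smooth vector fields span the tangent spaces of the leaves. -/
  spanned : ∀ p : M, ∃ U : Set M, IsOpen U ∧ p ∈ U ∧
    ∃ 𝒳 : Set ((q : M) → TangentSpace (𝓡 n) q), (∀ X ∈ 𝒳, IsSmoothField U X) ∧
      ∀ q ∈ U, Submodule.span ℝ {v | ∃ X ∈ 𝒳, X q = v} = toLeafDecomposition.vertical q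

end RiemFol

end

set_option linter.unusedSectionVars false

noncomputable section

/-! Let A_X^* be the adjoint of A_X, taking vertical fields to horizontal ones. Then ⟨S_X^k A_X Y,
A_X Z⟩ = ⟨A_X^* S_X^k A_X Y, Z⟩, and the inner product of two basic fields is constant along the
leaves. So the first claim reduces to showing that the field A_X^* S_X^k A_X Y is basic
(`shapeHor_mem_basic`).

This goes by strong induction on k. The tool is that (∇_X Y)^h is basic whenever X and Y are
(`hor_nab_mem_basic`). For k = 0, the horizontal part of the constant curvature identity for R(X,Y)X
writes 3 A_X^* A_X Y in terms of such derivatives. For the step, its vertical part says how A_X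
varies along X (`proj_nab_oneill`), and R(X,u)X with u vertical gives the Riccati equation for S_X
(`proj_nab_shape`). Hence (∇_X(A_X^* S_X^k A_X Y))^h equals (k+4) A_X^* S_X^{k+1} A_X Y plus three
kinds of terms: the same expression with (∇_X Y)^h for Y, its derivative in the variable X in the
direction T = (∇_X X)^h, and compositions of lower order. The derivative in X is the linear
coefficient of a polynomial in t, the expression for X + tT. All its values are basic by induction,
so its coefficients are too.

For the second claim put Z = Y. If a_i = ⟨A_X Y, V_i⟩ and μ_i are the eigenvalues, the first claim
says that every moment ∑ μ_i^k a_i² is locally constant on a leaf. By continuity and distinctness of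
the μ_i, suitable polynomials in the moments isolate each a_i², and continuity fixes the sign of a_i
(`eventually_eq_of_moments`).

The tensor calculus is done in an algebraic model, a module of fields with a connection and a
vertical projection. The geometric work is to build this model on U: the identities of the
Levi-Civita connection, involutivity of the vertical spaces, smoothness of the projection on the
regular part, and the infinitesimal form of transnormality, obtained from the existence of
geodesics. -/

/-- An algebraic model of a Riemannian manifold: an algebra `A` of functions and a module `𝔛` of
vector fields, with the Levi-Civita connection `nab` of the metric `metric`. -/
structure LeviCivita (A 𝔛 : Type*) [CommRing A] [Algebra ℝ A] [AddCommGroup 𝔛] [Module ℝ 𝔛]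
    [Module A 𝔛] [IsScalarTower ℝ A 𝔛] where
  der : 𝔛 →ₗ[A] Derivation ℝ A A
  metric : 𝔛 →ₗ[A] 𝔛 →ₗ[A] A
  nab : 𝔛 →ₗ[A] 𝔛 →ₗ[ℝ] 𝔛
  metric_comm : ∀ X Y, metric X Y = metric Y X
  eq_zero_of_metric_self : ∀ X, metric X X = 0 → X = 0
  nab_smul : ∀ X (f : A) Y, nab X (f • Y) = f • nab X Y + der X f • Y
  der_metric : ∀ X Y Z, der X (metric Y Z) = metric (nab X Y) Z + metric Y (nab X Z)
  der_bracket : ∀ X Y f, der (nab X Y - nab Y X) f = der X (der Y f) - der Y (der X f)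
  jacobi : ∀ X Y Z,
    nab X (nab Y Z - nab Z Y) - nab (nab Y Z - nab Z Y) X =
      (nab (nab X Y - nab Y X) Z - nab Z (nab X Y - nab Y X)) +
      (nab Y (nab X Z - nab Z X) - nab (nab X Z - nab Z X) Y)

/-! ### Symmetries of the curvature tensor in the algebraic model. -/

namespace LeviCivita

variable {A 𝔛 : Type*} [CommRing A] [Algebra ℝ A] [AddCommGroup 𝔛] [Module ℝ 𝔛]
    [Module A 𝔛] [IsScalarTower ℝ A 𝔛] (G : LeviCivita A 𝔛)

/-- The ring `A` may have zero divisors; 2 cancels because it is invertible in a real algebra. -/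
theorem eq_of_two_mul {a b : A} (h : 2 * a = 2 * b) : a = b := by
  have h2 : ∀ x : A, ((1 / 2 : ℝ)) • (2 * x) = x := fun x => by
    rw [two_mul, ← two_smul ℝ x, smul_smul]; norm_num
  rw [← h2 a, h, h2]

theorem ext_metric {X Y : 𝔛} (h : ∀ Z, G.metric X Z = G.metric Y Z) : X = Y := by
  rw [← sub_eq_zero]
  apply G.eq_zero_of_metric_self
  rw [map_sub G.metric, LinearMap.sub_apply, h, sub_self]

/-- The Lie bracket. -/
def bracket (X Y : 𝔛) : 𝔛 := G.nab X Y - G.nab Y X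

/-- The curvature tensor. -/
def curv (X Y Z : 𝔛) : 𝔛 := G.nab X (G.nab Y Z) - G.nab Y (G.nab X Z) - G.nab (G.bracket X Y) Z

theorem curv_swap (X Y Z : 𝔛) : G.curv X Y Z = -G.curv Y X Z := by
  simp only [curv, bracket, map_sub, LinearMap.sub_apply]; abel

theorem bianchi (X Y Z : 𝔛) : G.curv X Y Z + G.curv Y Z X + G.curv Z X Y = 0 := by
  have := G.jacobi X Y Z
  rw [← sub_eq_zero] at this
  rw [← this]
  simp only [curv, bracket, map_sub, LinearMap.sub_apply]; abel

theorem metric_curv_skew (X Y Z W : 𝔛) :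
    G.metric (G.curv X Y Z) W = -G.metric (G.curv X Y W) Z := by
  have h1 := G.der_bracket X Y (G.metric Z W)
  have hs := G.metric_comm
  rw [G.der_metric, G.der_metric, G.der_metric, map_add, map_add, G.der_metric, G.der_metric,
    G.der_metric, G.der_metric] at h1
  simp only [curv, bracket, map_sub, LinearMap.sub_apply] at h1 ⊢
  rw [hs Z (G.nab Y (G.nab X W)), hs Z (G.nab X (G.nab Y W)), hs Z (G.nab (G.nab X Y) W),
    hs Z (G.nab (G.nab Y X) W)] at h1
  linear_combination -h1

/-- Formal consequence of the first Bianchi identity for four cyclic arrangements of the arguments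
and of the skew symmetry in each pair; what remains is twice the claim. -/
theorem metric_curv_pair (X Y Z W : 𝔛) :
    G.metric (G.curv X Y Z) W = G.metric (G.curv Z W X) Y := by
  apply eq_of_two_mul
  have B : ∀ X Y Z W, G.metric (G.curv X Y Z) W + G.metric (G.curv Y Z X) W
      + G.metric (G.curv Z X Y) W = 0 := fun X Y Z W => by
    rw [← LinearMap.add_apply, ← map_add, ← LinearMap.add_apply, ← map_add, G.bianchi]; simp
  have S := G.metric_curv_skew
  have T : ∀ X Y Z W, G.metric (G.curv X Y Z) W = -G.metric (G.curv Y X Z) W := fun X Y Z W => by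
    rw [G.curv_swap, map_neg, LinearMap.neg_apply]
  linear_combination B X Y Z W + B Y Z W X - B Z W X Y - B W X Y Z
    - S Y Z X W - T Z X Y W + S X Z Y W - T W Y Z X + S Y W Z X + S W X Z Y + S X Y Z W - S Z W X Y

/-- Polarization of the sectional curvature identity in `Y` alone: with `X` fixed, pair symmetry
makes ⟨R(X,Y)W, X⟩ symmetric in `Y` and `W`, so its quadratic form determines it. -/
theorem curv_self_of_const {c : A}
    (hc : ∀ X Y, G.metric (G.curv X Y Y) X
      = c * (G.metric X X * G.metric Y Y - G.metric X Y ^ 2)) (X Y : 𝔛) :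
    G.curv X Y X = c • (G.metric X Y • X - G.metric X X • Y) := by
  apply G.ext_metric
  intro W
  apply eq_of_two_mul
  have h1 := hc X (Y + W)
  have h2 := hc X Y
  have h3 := hc X W
  have h4 : ∀ V, G.curv X (Y + W) V = G.curv X Y V + G.curv X W V := fun V => by
    simp only [curv, bracket, map_sub, map_add, LinearMap.sub_apply, LinearMap.add_apply]; abel
  have h5 : ∀ V U U', G.curv X V (U + U') = G.curv X V U + G.curv X V U' := fun V U U' => by
    simp only [curv, map_add]; abel
  rw [h4, h5, h5] at h1
  simp only [map_add, LinearMap.add_apply, map_sub, map_smul, LinearMap.smul_apply,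
    LinearMap.sub_apply, smul_eq_mul] at h1 ⊢
  have p := G.metric_curv_pair X W Y X
  have s1 := G.metric_curv_skew X Y X W
  have s2 := G.metric_curv_skew Y X X W
  rw [G.curv_swap Y X W, map_neg, LinearMap.neg_apply] at s2
  rw [G.metric_comm W Y] at h1
  linear_combination 2 * s1 - (h1 - h2 - h3) + p + s2
end LeviCivita

/-- An algebraic model of a Riemannian foliation of a manifold of constant curvature: the vector
fields of a `LeviCivita` structure together with the projection `proj` to the vertical fields. -/
structure FoliatedLeviCivita (A 𝔛 : Type*) [CommRing A] [Algebra ℝ A] [AddCommGroup 𝔛]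
    [Module ℝ 𝔛] [Module A 𝔛] [IsScalarTower ℝ A 𝔛] extends LeviCivita A 𝔛 where
  proj : 𝔛 →ₗ[A] 𝔛
  proj_proj : ∀ X, proj (proj X) = proj X
  metric_proj : ∀ X Y, metric (proj X) Y = metric X (proj Y)
  proj_bracket : ∀ U V, proj U = U → proj V = V →
    proj (nab U V - nab V U) = nab U V - nab V U
  transnormal : ∀ X V, proj X = 0 → proj V = V → metric (nab X V) X = 0
  const : A
  der_const : ∀ X, der X const = 0
  curv_const : ∀ X Y, metric (toLeviCivita.curv X Y Y) X
    = const * (metric X X * metric Y Y - metric X Y ^ 2)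

/-! ### Vector-valued polynomials with values in a subspace. -/

section Polynomial

variable {E : Type*} [AddCommGroup E] [Module ℝ E]

/-- A linear functional on the quotient by `W` turns the sum into a real polynomial vanishing at
every real number, hence zero. Functionals separate points of the quotient, so no finite dimension
is needed. -/
theorem coeff_mem_of_forall_sum_pow_smul_mem (W : Submodule ℝ E) {N : ℕ} {a : ℕ → E}
    (h : ∀ t : ℝ, ∑ i ∈ Finset.range N, t ^ i • a i ∈ W) {i : ℕ} (hi : i < N) : a i ∈ W := by
  rw [← Submodule.Quotient.mk_eq_zero, ← Module.forall_dual_apply_eq_zero_iff ℝ]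
  intro φ
  let p : Polynomial ℝ :=
    ∑ i ∈ Finset.range N, Polynomial.monomial i (φ (Submodule.Quotient.mk (a i)))
  have hp : p = 0 := by
    apply Polynomial.funext
    intro t
    have := congrArg φ ((Submodule.Quotient.mk_eq_zero W).2 (h t))
    rw [← Submodule.mkQ_apply, map_sum, map_sum, map_zero] at this
    rw [Polynomial.eval_zero, ← this, Polynomial.eval_finsetSum]
    exact Finset.sum_congr rfl fun i _ => by
      rw [Polynomial.eval_monomial, map_smul, map_smul, smul_eq_mul, mul_comm, Submodule.mkQ_apply]
  have := congrArg (fun q => Polynomial.coeff q i) hp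
  simpa [p, Polynomial.finsetSum_coeff, Polynomial.coeff_monomial, hi] using this

/-- `f` is a polynomial map whose coefficients of degree `0` and `1` are `x` and `y`. -/
def IsPolynomialMap (f : ℝ → E) (x y : E) : Prop :=
  ∃ (N : ℕ) (a : ℕ → E), a 0 = x ∧ a 1 = y ∧ (∀ i, N ≤ i → a i = 0) ∧
    ∀ t, f t = ∑ i ∈ Finset.range N, t ^ i • a i

theorem IsPolynomialMap.affine (x y : E) : IsPolynomialMap (fun t => x + t • y) x y := by
  refine ⟨2, fun i => if i = 0 then x else if i = 1 then y else 0, by simp, by simp, ?_, ?_⟩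
  · intro i hi
    simp [show i ≠ 0 by omega, show i ≠ 1 by omega]
  · intro t
    simp [Finset.sum_range_succ]

/-- The product rule for the linear coefficient. The pencil `L + t L'` will be the shape operator,
or the adjoint of O'Neill's tensor, of the field X + tT. -/
theorem IsPolynomialMap.add_smul {f : ℝ → E} {x y : E} (hf : IsPolynomialMap f x y)
    (L L' : E →ₗ[ℝ] E) :
    IsPolynomialMap (fun t => L (f t) + t • L' (f t)) (L x) (L y + L' x) := by
  obtain ⟨N, a, rfl, rfl, h, hf⟩ := hf
  refine ⟨N + 1, fun i => L (a i) + (match i with | 0 => 0 | j + 1 => L' (a j)), by simp, rfl,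
    ?_, ?_⟩
  · rintro (_ | i) hi
    · omega
    · simp [h (i + 1) (by omega), h i (by omega)]
  · intro t
    have h1 : f t = ∑ i ∈ Finset.range (N + 1), t ^ i • a i := by
      rw [Finset.sum_range_succ, h N le_rfl, smul_zero, add_zero, hf]
    simp only [smul_add, Finset.sum_add_distrib]
    congr 1
    · rw [h1, map_sum]; simp
    · rw [Finset.sum_range_succ', hf, map_sum, Finset.smul_sum]
      simp [pow_succ', mul_smul]

theorem IsPolynomialMap.coeff_one_mem {f : ℝ → E} {x y : E} (hf : IsPolynomialMap f x y)
    (W : Submodule ℝ E) (h : ∀ t, f t ∈ W) : y ∈ W := by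
  obtain ⟨N, a, rfl, rfl, h0, hf⟩ := hf
  rcases lt_or_ge 1 N with hN | hN
  · exact coeff_mem_of_forall_sum_pow_smul_mem W (fun t => hf t ▸ h t) hN
  · rw [h0 1 hN]; exact W.zero_mem

end Polynomial

/-! ### Tensor calculus of a Riemannian foliation in constant curvature. -/

namespace FoliatedLeviCivita

variable {A 𝔛 : Type*} [CommRing A] [Algebra ℝ A] [AddCommGroup 𝔛] [Module ℝ 𝔛]
    [Module A 𝔛] [IsScalarTower ℝ A 𝔛] (G : FoliatedLeviCivita A 𝔛)

open LeviCivita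

/-- The horizontal part. -/
def hor (X : 𝔛) : 𝔛 := X - G.proj X

/-- The shape operator. -/
def shape (X u : 𝔛) : 𝔛 := -G.proj (G.nab u X)

/-- The O'Neill tensor. -/
def oneill (X Y : 𝔛) : 𝔛 := G.proj (G.nab X Y)

/-- The adjoint of the O'Neill tensor. -/
def oneillAdj (X u : 𝔛) : 𝔛 := -G.hor (G.nab X u)

@[simp] theorem proj_hor (X : 𝔛) : G.proj (G.hor X) = 0 := by
  simp [hor, G.proj_proj]

theorem hor_of_proj_eq_zero {X : 𝔛} (h : G.proj X = 0) : G.hor X = X := by simp [hor, h]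

theorem hor_of_proj_eq {X : 𝔛} (h : G.proj X = X) : G.hor X = 0 := by simp [hor, h]

theorem hor_add_proj (X : 𝔛) : G.hor X + G.proj X = X := by simp [hor]

@[simp] theorem hor_add (X Y : 𝔛) : G.hor (X + Y) = G.hor X + G.hor Y := by
  simp only [hor, map_add]; abel

@[simp] theorem hor_sub (X Y : 𝔛) : G.hor (X - Y) = G.hor X - G.hor Y := by
  simp only [hor, map_sub]; abel

@[simp] theorem hor_neg (X : 𝔛) : G.hor (-X) = -G.hor X := by
  simp only [hor, map_neg]; abel

@[simp] theorem hor_smul (f : A) (X : 𝔛) : G.hor (f • X) = f • G.hor X := by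
  simp only [hor, map_smul, smul_sub]

theorem metric_eq_zero {X V : 𝔛} (hX : G.proj X = 0) (hV : G.proj V = V) : G.metric X V = 0 := by
  rw [← hV, ← G.metric_proj, hX, map_zero, LinearMap.zero_apply]

theorem metric_eq_zero' {X V : 𝔛} (hX : G.proj X = 0) (hV : G.proj V = V) :
    G.metric V X = 0 := by
  rw [G.metric_comm, G.metric_eq_zero hX hV]

theorem metric_proj_vertical (X : 𝔛) {V : 𝔛} (hV : G.proj V = V) :
    G.metric (G.proj X) V = G.metric X V := by rw [G.metric_proj, hV]

theorem metric_hor_horizontal (X : 𝔛) {Y : 𝔛} (hY : G.proj Y = 0) :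
    G.metric (G.hor X) Y = G.metric X Y := by
  simp [hor, G.metric_proj, hY]

theorem ext_horizontal {X Y : 𝔛} (hX : G.proj X = 0) (hY : G.proj Y = 0)
    (h : ∀ Z, G.proj Z = 0 → G.metric X Z = G.metric Y Z) : X = Y := by
  apply G.ext_metric
  intro Z
  rw [← G.hor_add_proj Z, map_add, map_add, h _ (G.proj_hor Z),
    G.metric_eq_zero hX (G.proj_proj Z), G.metric_eq_zero hY (G.proj_proj Z)]

theorem ext_vertical {X Y : 𝔛} (hX : G.proj X = X) (hY : G.proj Y = Y)
    (h : ∀ Z, G.proj Z = Z → G.metric X Z = G.metric Y Z) : X = Y := by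
  apply G.ext_metric
  intro Z
  rw [← hX, ← hY, G.metric_proj, G.metric_proj, h _ (G.proj_proj Z)]

theorem vertical_bracket {U V : 𝔛} (hU : G.proj U = U) (hV : G.proj V = V) :
    G.proj (G.bracket U V) = G.bracket U V := G.proj_bracket U V hU hV

/-- Polarized transnormality makes ⟨∇_X V, Y⟩ skew in X and Y; differentiating ⟨Y, V⟩ = 0 moves the
derivative from V to Y. -/
theorem oneill_skew {X Y : 𝔛} (hX : G.proj X = 0) (hY : G.proj Y = 0) :
    G.oneill X Y = -G.oneill Y X := by
  apply G.ext_vertical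
  · simp [oneill, G.proj_proj]
  · simp [oneill, G.proj_proj]
  intro V hV
  have h1 := G.transnormal (X + Y) V (by simp [hX, hY]) hV
  have h2 := G.transnormal X V hX hV
  have h3 := G.transnormal Y V hY hV
  have h4 := G.der_metric X Y V
  have h5 := G.der_metric Y X V
  rw [G.metric_eq_zero hY hV, map_zero, G.metric_comm Y] at h4
  rw [G.metric_eq_zero hX hV, map_zero, G.metric_comm X] at h5
  rw [map_neg, LinearMap.neg_apply, oneill, oneill, G.metric_proj_vertical _ hV,
    G.metric_proj_vertical _ hV]
  simp only [map_add, LinearMap.add_apply] at h1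
  linear_combination -h4 - h5 - h1 + h2 + h3

theorem oneill_self {X : 𝔛} (hX : G.proj X = 0) : G.oneill X X = 0 := by
  have h := G.oneill_skew hX hX
  have h2 : (2 : ℝ) • G.oneill X X = 0 := by
    rw [two_smul]; nth_rewrite 2 [h]; abel
  simpa using h2

theorem metric_oneillAdj {X u Y : 𝔛} (hu : G.proj u = u) (hY : G.proj Y = 0) :
    G.metric (G.oneillAdj X u) Y = G.metric u (G.oneill X Y) := by
  have h := G.der_metric X u Y
  rw [G.metric_eq_zero' hY hu, map_zero] at h
  rw [oneillAdj, map_neg, LinearMap.neg_apply, G.metric_hor_horizontal _ hY, oneill,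
    ← G.metric_proj, hu]
  linear_combination h

@[simp] theorem proj_oneill (X Y : 𝔛) : G.proj (G.oneill X Y) = G.oneill X Y := by
  simp [oneill, G.proj_proj]

@[simp] theorem proj_shape (X Y : 𝔛) : G.proj (G.shape X Y) = G.shape X Y := by
  simp [shape, G.proj_proj]

@[simp] theorem proj_oneillAdj (X Y : 𝔛) : G.proj (G.oneillAdj X Y) = 0 := by
  simp [oneillAdj]

variable {G}

variable (G) in
/-- The basic fields. -/
def basic : Submodule ℝ 𝔛 where
  carrier := {X | G.proj X = 0 ∧
    ∀ V, G.proj V = V → G.hor (G.bracket V X) = 0}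
  zero_mem' := ⟨map_zero _, fun V _ => by simp [LeviCivita.bracket, hor]⟩
  add_mem' := by
    rintro X Y ⟨hX, hX'⟩ ⟨hY, hY'⟩
    refine ⟨by simp [hX, hY], fun V hV => ?_⟩
    have : G.bracket V (X + Y) = G.bracket V X + G.bracket V Y := by
      simp only [LeviCivita.bracket, map_add, LinearMap.add_apply]; abel
    rw [this, hor_add, hX' V hV, hY' V hV, add_zero]
  smul_mem' := by
    rintro t X ⟨hX, hX'⟩
    have hs : ∀ X : 𝔛, t • X = algebraMap ℝ A t • X := fun X => (algebraMap_smul A t X).symm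
    refine ⟨by rw [hs, map_smul, hX, smul_zero], fun V hV => ?_⟩
    have : G.bracket V (t • X) = algebraMap ℝ A t • G.bracket V X := by
      rw [LeviCivita.bracket, map_smul, hs X, map_smul, LinearMap.smul_apply, hs, ← smul_sub,
        LeviCivita.bracket]
    rw [this, hor_smul, hX' V hV, smul_zero]

theorem basic_bracket {X V : 𝔛} (hX : X ∈ G.basic) (hV : G.proj V = V) :
    G.proj (G.bracket V X) = G.bracket V X := by
  have := hX.2 V hV
  rw [hor, sub_eq_zero] at this
  exact this.symm

/-- Polarized transnormality again: the Lie derivative of the metric along a vertical field vanishes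
on horizontal pairs. -/
theorem der_metric_vertical {V X Y : 𝔛} (hV : G.proj V = V) (hX : G.proj X = 0)
    (hY : G.proj Y = 0) :
    G.der V (G.metric X Y) = G.metric (G.bracket V X) Y + G.metric X (G.bracket V Y) := by
  have h1 := G.transnormal (X + Y) V (by simp [hX, hY]) hV
  have h2 := G.transnormal X V hX hV
  have h3 := G.transnormal Y V hY hV
  rw [G.der_metric]
  simp only [LeviCivita.bracket, map_add, LinearMap.add_apply, map_sub, LinearMap.sub_apply] at h1 ⊢
  rw [G.metric_comm X (G.nab Y V)]
  linear_combination h1 - h2 - h3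

theorem bracket_add (X Y Z : 𝔛) : G.bracket X (Y + Z) = G.bracket X Y + G.bracket X Z := by
  simp only [LeviCivita.bracket, map_add, LinearMap.add_apply]; abel

theorem der_metric_vertical_left {V X Y : 𝔛} (hV : G.proj V = V) (hY : G.proj Y = 0) :
    G.der V (G.metric X Y)
      = G.metric (G.bracket V X) Y + G.metric X (G.hor (G.bracket V Y)) := by
  rw [← G.metric_hor_horizontal X hY, der_metric_vertical hV (G.proj_hor X) hY]
  nth_rewrite 3 [← G.hor_add_proj X]
  rw [bracket_add, map_add, LinearMap.add_apply,
    G.metric_eq_zero' hY (G.vertical_bracket hV (G.proj_proj X)), add_zero,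
    ← G.metric_hor_horizontal X (G.proj_hor (G.bracket V Y)),
    ← add_zero (G.metric (G.hor X) (G.hor (G.bracket V Y))),
    ← G.metric_eq_zero (G.proj_hor X) (G.proj_proj (G.bracket V Y)), ← map_add, G.hor_add_proj]

theorem der_metric_basic {V X Y : 𝔛} (hV : G.proj V = V) (hX : X ∈ G.basic) (hY : Y ∈ G.basic) :
    G.der V (G.metric X Y) = 0 := by
  rw [der_metric_vertical hV hX.1 hY.1, G.metric_eq_zero hX.1 (basic_bracket hY hV),
    G.metric_eq_zero' hY.1 (basic_bracket hX hV), add_zero]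

theorem smul_mem_basic {f : A} {X : 𝔛} (hf : ∀ V, G.proj V = V → G.der V f = 0)
    (hX : X ∈ G.basic) : f • X ∈ G.basic := by
  refine ⟨by rw [map_smul, hX.1, smul_zero], fun V hV => ?_⟩
  have : G.bracket V (f • X) = f • G.bracket V X := by
    rw [LeviCivita.bracket, G.nab_smul, hf V hV, map_smul, LinearMap.smul_apply,
      LeviCivita.bracket, smul_sub, zero_smul, add_zero]
  rw [this, hor_smul, hX.2 V hV, smul_zero]

variable (G) in
theorem koszul_formula (X Y Z : 𝔛) : 2 * G.metric (G.nab X Y) Z =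
    G.der X (G.metric Y Z) + G.der Y (G.metric X Z) - G.der Z (G.metric X Y)
      + G.metric (G.bracket X Y) Z - G.metric (G.bracket X Z) Y - G.metric (G.bracket Y Z) X := by
  simp only [G.der_metric, LeviCivita.bracket, map_sub, LinearMap.sub_apply]
  rw [G.metric_comm Y, G.metric_comm X (G.nab Y Z), G.metric_comm X]
  ring

theorem bracket_jacobi (X Y Z : 𝔛) : G.bracket X (G.bracket Y Z)
    = G.bracket (G.bracket X Y) Z + G.bracket Y (G.bracket X Z) := G.jacobi X Y Z

theorem bracket_swap (X Y : 𝔛) : G.bracket X Y = -G.bracket Y X := by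
  simp [LeviCivita.bracket]

/-- The horizontal part of the connection is determined through the Koszul formula by the transverse
metric and brackets, which vertical fields preserve. Concretely, the Koszul formula is tested
against a horizontal `Z` and differentiated along the vertical `V`. -/
theorem hor_nab_mem_basic {X Y : 𝔛} (hX : X ∈ G.basic) (hY : Y ∈ G.basic) :
    G.hor (G.nab X Y) ∈ G.basic := by
  refine ⟨G.proj_hor _, fun V hV => ?_⟩
  apply G.ext_horizontal (G.proj_hor _) (map_zero _)
  intro Z hZ
  rw [G.metric_hor_horizontal _ hZ, map_zero, LinearMap.zero_apply]
  have hA := basic_bracket hX hV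
  have hB := basic_bracket hY hV
  have vert : ∀ {W}, G.proj W = W → G.metric W Z = 0 := fun h => G.metric_eq_zero' hZ h
  have hbv : ∀ {X W}, X ∈ G.basic → G.proj W = W → G.proj (G.bracket X W) = G.bracket X W :=
    fun {X W} h hW => by rw [bracket_swap, map_neg, basic_bracket h hW]
  -- The test field `Z` is not assumed basic. Differentiation along `V` should reproduce the Koszul
  -- formula with `Z₁` in place of `Z`; the difference of the two is the wanted vanishing. The extra
  -- terms with [[V,X],Z] and [[V,Y],Z] from `t1` and `t5` cancel.
  set Z₁ := G.hor (G.bracket V Z) with hZ₁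
  have eZ : G.bracket V Z = Z₁ + G.proj (G.bracket V Z) := (G.hor_add_proj _).symm
  have hW : G.metric (G.bracket V (G.hor (G.nab X Y))) Z
      = G.metric (G.bracket V (G.nab X Y)) Z := by
    nth_rewrite 2 [← G.hor_add_proj (G.nab X Y)]
    rw [bracket_add, map_add, LinearMap.add_apply, vert (G.vertical_bracket hV (G.proj_proj _)),
      add_zero]
  have dW := der_metric_vertical_left (X := G.nab X Y) hV hZ
  have dYZ : ∀ {Y}, Y ∈ G.basic → ∀ {V}, G.proj V = V → G.der V (G.metric Y Z)
      = G.metric Y (G.hor (G.bracket V Z)) := fun {Y} hY {V} hV => by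
    rw [der_metric_vertical_left hV hZ, vert (basic_bracket hY hV), zero_add]
  have t1 : ∀ {X Y}, X ∈ G.basic → Y ∈ G.basic → G.der V (G.der X (G.metric Y Z))
      = G.der X (G.metric Y Z₁) + G.metric (G.bracket (G.bracket V X) Z) Y :=
    fun {X Y} hX hY => by
      have := G.der_bracket V X (G.metric Y Z)
      rw [dYZ hY hV] at this
      have h2 := dYZ hY (basic_bracket hX hV)
      rw [G.metric_comm Y (G.hor _), G.metric_hor_horizontal _ hY.1] at h2
      rw [← h2, LeviCivita.bracket]
      linear_combination -this
  have t3 : G.der V (G.der Z (G.metric X Y)) = G.der Z₁ (G.metric X Y) := by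
    have := G.der_bracket V Z (G.metric X Y)
    have h1 := der_metric_basic hV hX hY
    rw [h1, map_zero] at this
    have h2 := der_metric_basic (G.proj_proj (G.bracket V Z)) hX hY
    rw [← LeviCivita.bracket, eZ, map_add, Derivation.add_apply, h2] at this
    linear_combination -this
  have t4 : G.der V (G.metric (G.bracket X Y) Z) = G.metric (G.bracket X Y) Z₁ := by
    rw [der_metric_vertical_left hV hZ, bracket_jacobi, bracket_swap, map_add, LinearMap.add_apply,
      vert (hbv hX hB), map_neg, LinearMap.neg_apply, vert (hbv hY hA), neg_zero, zero_add,
      zero_add]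
  have t5 : ∀ {X Y}, X ∈ G.basic → Y ∈ G.basic → G.der V (G.metric (G.bracket X Z) Y)
      = G.metric (G.bracket (G.bracket V X) Z) Y + G.metric (G.bracket X Z₁) Y :=
    fun {X Y} hX hY => by
      rw [der_metric_vertical_left hV hY.1, hY.2 V hV, map_zero, add_zero, bracket_jacobi, eZ,
        bracket_add]
      simp only [map_add, LinearMap.add_apply]
      rw [G.metric_eq_zero' hY.1 (hbv hX (G.proj_proj _)), add_zero]
  have k1 := congrArg (G.der V) (koszul_formula G X Y Z)
  have k2 := koszul_formula G X Y Z₁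
  simp only [map_add, map_sub] at k1
  rw [t1 hX hY, t1 hY hX, t3, t4, t5 hX hY, t5 hY hX, two_mul, map_add, dW] at k1
  rw [hW]
  apply eq_of_two_mul
  linear_combination k1 - k2

theorem bracket_eq_oneill {X Y : 𝔛} (hX : G.proj X = 0) (hY : G.proj Y = 0) :
    G.bracket X Y = G.hor (G.nab X Y) - G.hor (G.nab Y X) + (G.oneill X Y + G.oneill X Y) := by
  nth_rewrite 2 [G.oneill_skew hX hY]
  simp only [LeviCivita.bracket, hor, oneill]
  abel

theorem curv_self (X Y : 𝔛) :
    G.curv X Y X = G.const • (G.metric X Y • X - G.metric X X • Y) :=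
  G.curv_self_of_const G.curv_const X Y

theorem nab_horizontal {X Y : 𝔛} (hX : G.proj X = 0) (hY : G.proj Y = 0) :
    G.nab Y X = G.hor (G.nab Y X) - G.oneill X Y := by
  rw [G.oneill_skew hX hY, sub_neg_eq_add, oneill, G.hor_add_proj]

theorem nab_self {X : 𝔛} (hX : G.proj X = 0) : G.nab X X = G.hor (G.nab X X) := by
  rw [hor, ← oneill, G.oneill_self hX, sub_zero]

/-- The covariant derivative of the O'Neill tensor. -/
theorem proj_nab_oneill {X Y : 𝔛} (hX : G.proj X = 0) (hY : G.proj Y = 0) :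
    G.proj (G.nab X (G.oneill X Y)) = G.oneill X (G.hor (G.nab X Y))
      + G.oneill (G.hor (G.nab X X)) Y + 2 • G.shape X (G.oneill X Y) := by
  -- In constant curvature R(X,Y)X is a combination of X and Y, so its vertical part vanishes. The
  -- factor 2 in the claim comes from the vertical part 2 A_X Y of [X,Y].
  have h := congrArg G.proj (curv_self (G := G) X Y)
  rw [map_smul, map_sub, map_smul, map_smul, hX, hY, LeviCivita.curv,
    nab_horizontal hX hY, nab_self hX, bracket_eq_oneill hX hY] at h
  simp only [map_add, map_sub, LinearMap.add_apply, LinearMap.sub_apply, smul_zero, sub_zero] at h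
  have s1 := G.oneill_skew hX (G.proj_hor (G.nab Y X))
  have s2 := G.oneill_skew hX (G.proj_hor (G.nab X Y))
  have s3 := G.oneill_skew hY (G.proj_hor (G.nab X X))
  simp only [oneill, shape, two_smul] at h s1 s2 s3 ⊢
  linear_combination (norm := abel) -h + s1 - s2 - s3

/-- As [u,X] is vertical, ∇_u X and ∇_X u have the same horizontal part, which is −A_X^* u. -/
theorem nab_basic {X u : 𝔛} (hX : X ∈ G.basic) (hu : G.proj u = u) :
    G.nab u X = -G.shape X u - G.oneillAdj X u := by
  have h := hX.2 u hu
  rw [LeviCivita.bracket, hor_sub, sub_eq_zero] at h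
  rw [shape, oneillAdj, ← h, neg_neg, sub_neg_eq_add, add_comm, G.hor_add_proj]

theorem bracket_vertical {X u : 𝔛} (hX : X ∈ G.basic) (hu : G.proj u = u) :
    G.bracket X u = G.proj (G.nab X u) + G.shape X u := by
  have h := basic_bracket hX hu
  rw [bracket_swap, map_neg, neg_inj] at h
  rw [← h, LeviCivita.bracket, map_sub, shape, sub_eq_add_neg]

/-- The Riccati equation for the shape operator. -/
theorem proj_nab_shape {X u : 𝔛} (hX : X ∈ G.basic) (hu : G.proj u = u) :
    G.proj (G.nab X (G.shape X u)) = G.shape X (G.proj (G.nab X u)) + G.shape X (G.shape X u)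
      + (G.const * G.metric X X) • u + G.shape (G.hor (G.nab X X)) u
      - G.oneill X (G.oneillAdj X u) := by
  -- The vertical part of R(X,u)X is −c⟨X,X⟩u, the source of the curvature term.
  have h := congrArg G.proj (curv_self (G := G) X u)
  rw [map_smul, map_sub, map_smul, map_smul, hX.1, hu, LeviCivita.curv,
    nab_basic hX hu, nab_self hX.1, bracket_vertical hX hu, smul_zero, zero_sub, smul_neg,
    smul_smul] at h
  simp only [map_add, map_sub, map_neg, LinearMap.add_apply] at h
  have e : ∀ Y v, G.shape Y v = -G.proj (G.nab v Y) := fun _ _ => rfl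
  rw [e X (G.proj (G.nab X u)), e X (G.shape X u), e (G.hor (G.nab X X)) u, oneill]
  linear_combination (norm := abel) -h

theorem metric_shape {X u w : 𝔛} (hX : G.proj X = 0) (hw : G.proj w = w) :
    G.metric (G.shape X u) w = G.metric X (G.nab u w) := by
  have h := G.der_metric u X w
  rw [G.metric_eq_zero hX hw, map_zero] at h
  rw [shape, map_neg, LinearMap.neg_apply, G.metric_proj_vertical _ hw]
  linear_combination h

/-- The difference of the two sides is the inner product of `X` with the bracket of two vertical
fields, which is vertical. -/
theorem metric_shape_comm {X u w : 𝔛} (hX : G.proj X = 0) (hu : G.proj u = u)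
    (hw : G.proj w = w) : G.metric (G.shape X u) w = G.metric u (G.shape X w) := by
  rw [G.metric_comm u, metric_shape hX hw, metric_shape hX hu, ← sub_eq_zero, ← map_sub]
  exact G.metric_eq_zero hX (G.vertical_bracket hu hw)

/-- The adjoint of `proj_nab_oneill`: differentiate ⟨A_X^* u, Y⟩ = ⟨u, A_X Y⟩ along X and use the
symmetry of the shape operator. -/
theorem hor_nab_oneillAdj {X u : 𝔛} (hX : G.proj X = 0) (hu : G.proj u = u) :
    G.hor (G.nab X (G.oneillAdj X u)) = G.oneillAdj X (G.proj (G.nab X u))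
      + G.oneillAdj (G.hor (G.nab X X)) u + 2 • G.oneillAdj X (G.shape X u) := by
  apply G.ext_horizontal
  · simp
  · simp
  intro Y hY
  simp only [two_smul, map_add, LinearMap.add_apply]
  rw [G.metric_hor_horizontal _ hY, G.metric_oneillAdj (G.proj_proj _) hY,
    G.metric_oneillAdj hu hY, G.metric_oneillAdj (G.proj_shape _ _) hY,
    metric_shape_comm hX hu (G.proj_oneill _ _)]
  have h1 := G.der_metric X (G.oneillAdj X u) Y
  rw [G.metric_oneillAdj hu hY, G.der_metric, ← G.proj_oneill X Y,
    ← G.metric_proj, ← hu, G.metric_proj u (G.nab X _), hu, G.proj_oneill,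
    proj_nab_oneill hX hY] at h1
  have h2 : G.metric (G.oneillAdj X u) (G.nab X Y)
      = G.metric u (G.oneill X (G.hor (G.nab X Y))) := by
    rw [← G.metric_oneillAdj hu (G.proj_hor _), G.metric_comm, G.metric_comm _ (G.hor _),
      G.metric_hor_horizontal _ (G.proj_oneillAdj _ _)]
  rw [h2] at h1
  simp only [two_smul, map_add] at h1
  linear_combination -h1

end FoliatedLeviCivita

/-! ### The induction: the fields A_X^* S_X^k A_X Y are basic. -/

namespace FoliatedLeviCivita

variable {A 𝔛 : Type*} [CommRing A] [Algebra ℝ A] [AddCommGroup 𝔛] [Module ℝ 𝔛]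
    [Module A 𝔛] [IsScalarTower ℝ A 𝔛] {G : FoliatedLeviCivita A 𝔛}

theorem hor_real_smul (t : ℝ) (X : 𝔛) : G.hor (t • X) = t • G.hor X := by
  rw [← algebraMap_smul A t X, hor_smul, algebraMap_smul]

theorem proj_real_smul (t : ℝ) (X : 𝔛) : G.proj (t • X) = t • G.proj X := by
  rw [← algebraMap_smul A t X, map_smul, algebraMap_smul]

theorem nab_real_smul_left (t : ℝ) (X Y : 𝔛) : G.nab (t • X) Y = t • G.nab X Y := by
  rw [← algebraMap_smul A t X, map_smul, LinearMap.smul_apply, algebraMap_smul]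

variable (G) in
/-- The shape operator as a linear map. -/
def shapeₗ (X : 𝔛) : 𝔛 →ₗ[ℝ] 𝔛 where
  toFun := G.shape X
  map_add' u v := by simp only [shape, map_add, LinearMap.add_apply]; abel
  map_smul' t u := by simp [shape]

variable (G) in
/-- The adjoint of the O'Neill tensor as a linear map. -/
def oneillAdjₗ (X : 𝔛) : 𝔛 →ₗ[ℝ] 𝔛 where
  toFun := G.oneillAdj X
  map_add' u v := by simp only [oneillAdj, map_add, hor_add]; abel
  map_smul' t u := by simp [oneillAdj, hor_real_smul]

theorem shapeₗ_apply (X u : 𝔛) : G.shapeₗ X u = G.shape X u := rfl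

theorem oneillAdjₗ_apply (X u : 𝔛) : G.oneillAdjₗ X u = G.oneillAdj X u := rfl

theorem shape_add_smul (X T u : 𝔛) (t : ℝ) :
    G.shape (X + t • T) u = G.shapeₗ X u + t • G.shapeₗ T u := by
  simp only [shape, shapeₗ_apply, map_add, map_smul, proj_real_smul, smul_neg]
  abel

theorem oneillAdj_add_smul (X T u : 𝔛) (t : ℝ) :
    G.oneillAdj (X + t • T) u = G.oneillAdjₗ X u + t • G.oneillAdjₗ T u := by
  simp only [oneillAdj, oneillAdjₗ_apply, map_add, LinearMap.add_apply, nab_real_smul_left,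
    hor_add, hor_real_smul, smul_neg]
  abel

theorem shape_smul (X u : 𝔛) (f : A) : G.shape X (f • u) = f • G.shape X u := by
  simp [shape]

theorem oneillAdj_smul (X : 𝔛) {u : 𝔛} (hu : G.proj u = u) (f : A) :
    G.oneillAdj X (f • u) = f • G.oneillAdj X u := by
  simp [oneillAdj, G.nab_smul, G.hor_of_proj_eq hu]

variable (G) in
/-- The fields `S_X^k A_X Y`. -/
def shapePow (X : 𝔛) : ℕ → 𝔛 → 𝔛
  | 0, Y => G.oneill X Y
  | k + 1, Y => G.shape X (shapePow X k Y)

variable (G) in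
/-- The derivative of `shapePow X k Y` in the direction `T` of the variable `X`. -/
def shapePowDeriv (X T : 𝔛) : ℕ → 𝔛 → 𝔛
  | 0, Y => G.oneill T Y
  | k + 1, Y => G.shape X (shapePowDeriv X T k Y) + G.shape T (G.shapePow X k Y)

theorem proj_shapePow (X : 𝔛) (k : ℕ) (Y : 𝔛) : G.proj (G.shapePow X k Y) = G.shapePow X k Y := by
  cases k <;> simp [shapePow]

theorem isPolynomialMap_shapePow (X T : 𝔛) (k : ℕ) (Y : 𝔛) :
    IsPolynomialMap (fun t : ℝ => G.shapePow (X + t • T) k Y) (G.shapePow X k Y)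
      (G.shapePowDeriv X T k Y) := by
  induction k with
  | zero =>
    convert IsPolynomialMap.affine (G.oneill X Y) (G.oneill T Y) using 2 with t
    on_goal 2 => rfl
    on_goal 2 => rfl
    simp only [shapePow, oneill, map_add, LinearMap.add_apply, nab_real_smul_left, proj_real_smul]
  | succ k ih =>
    convert ih.add_smul (G.shapeₗ X) (G.shapeₗ T) using 2 with t
    on_goal 2 => rfl
    on_goal 2 => rfl
    exact shape_add_smul X T _ t

variable (G) in
/-- The error term in the covariant derivative of `shapePow X k Y`. -/
def shapePowError (X : 𝔛) (k : ℕ) (Y : 𝔛) : 𝔛 :=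
  ∑ i ∈ Finset.range k, ((G.const * G.metric X X) • G.shapePow X (k - 1) Y
    - G.shapePow X (k - 1 - i) (G.oneillAdj X (G.shapePow X i Y)))

theorem shapePowError_succ (X : 𝔛) (k : ℕ) (Y : 𝔛) :
    G.shapePowError X (k + 1) Y = G.shape X (G.shapePowError X k Y)
      + ((G.const * G.metric X X) • G.shapePow X k Y
        - G.oneill X (G.oneillAdj X (G.shapePow X k Y))) := by
  rw [shapePowError, Finset.sum_range_succ]
  congr 1
  · rw [shapePowError, ← shapeₗ_apply, map_sum]
    apply Finset.sum_congr rfl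
    intro i hi
    -- This turns the truncated subtractions in the exponents into honest ones. At k = 0 the
    -- exponent `k - 1` is harmless because the sum is empty.
    obtain ⟨j, rfl⟩ : ∃ j, k = i + j + 1 := ⟨k - i - 1, by have := Finset.mem_range.1 hi; omega⟩
    rw [map_sub, shapeₗ_apply, shapeₗ_apply, shape_smul]
    simp only [Nat.add_sub_cancel, show i + j + 1 - i = j + 1 by omega,
      show i + j - i = j by omega, shapePow]
  · simp [shapePow]

/-- Leibniz rule along X: differentiating A_X contributes 2 S_X, and each of the k factors S_X
contributes one more S_X by the Riccati equation, together with a curvature term and a term −A_X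
A_X^* collected in the error. -/
theorem proj_nab_shapePow {X Y : 𝔛} (hX : X ∈ G.basic) (hY : G.proj Y = 0) (k : ℕ) :
    G.proj (G.nab X (G.shapePow X k Y)) = G.shapePow X k (G.hor (G.nab X Y))
      + G.shapePowDeriv X (G.hor (G.nab X X)) k Y + (k + 2) • G.shapePow X (k + 1) Y
      + G.shapePowError X k Y := by
  induction k with
  | zero => simp [shapePow, shapePowDeriv, shapePowError, proj_nab_oneill hX.1 hY]
  | succ k ih =>
    rw [shapePow, proj_nab_shape hX (proj_shapePow X k Y), ih, shapePowError_succ]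
    simp only [← shapeₗ_apply, map_add, map_nsmul]
    simp only [shapePow, shapePowDeriv, shapeₗ_apply, add_smul, one_smul]
    abel

variable (G) in
/-- The fields `A_X^* S_X^k A_X Y`. -/
def shapeHor (X : 𝔛) (k : ℕ) (Y : 𝔛) : 𝔛 := G.oneillAdj X (G.shapePow X k Y)

/-- The outer A_X^* adds a further 2 to the coefficient k + 2. Being positive, k + 4 can be divided
out, which makes the recursion usable. -/
theorem hor_nab_shapeHor {X Y : 𝔛} (hX : X ∈ G.basic) (hY : G.proj Y = 0) (k : ℕ) :
    G.hor (G.nab X (G.shapeHor X k Y)) = G.shapeHor X k (G.hor (G.nab X Y))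
      + (G.oneillAdj X (G.shapePowDeriv X (G.hor (G.nab X X)) k Y)
        + G.oneillAdj (G.hor (G.nab X X)) (G.shapePow X k Y))
      + (k + 4) • G.shapeHor X (k + 1) Y + G.oneillAdj X (G.shapePowError X k Y) := by
  rw [shapeHor, hor_nab_oneillAdj hX.1 (proj_shapePow X k Y), proj_nab_shapePow hX hY]
  simp only [← oneillAdjₗ_apply, map_add, map_nsmul]
  simp only [shapeHor, shapePow, oneillAdjₗ_apply, add_smul]
  abel

theorem oneillAdj_shapePowError (X : 𝔛) (k : ℕ) (Y : 𝔛) :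
    G.oneillAdj X (G.shapePowError X k Y) =
      ∑ i ∈ Finset.range k, ((G.const * G.metric X X) • G.shapeHor X (k - 1) Y
        - G.shapeHor X (k - 1 - i) (G.shapeHor X i Y)) := by
  rw [shapePowError, ← oneillAdjₗ_apply, map_sum]
  refine Finset.sum_congr rfl fun i _ => ?_
  rw [map_sub, oneillAdjₗ_apply, oneillAdjₗ_apply, oneillAdj_smul X (proj_shapePow _ _ _)]
  rfl

theorem der_const_metric {X V : 𝔛} (hX : X ∈ G.basic) (hV : G.proj V = V) :
    G.der V (G.const * G.metric X X) = 0 := by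
  rw [Derivation.leibniz, G.der_const, der_metric_basic hV hX hX, smul_zero, smul_zero, add_zero]

/-- In the horizontal part of R(X,Y)X the field A_X^* A_X Y appears once through ∇_X∇_Y X and twice
through ∇_[X,Y] X. All other terms are iterated horizontal derivatives of basic fields or multiples
of `X` and `Y` by functions constant along the leaves. -/
theorem shapeHor_zero_mem_basic {X Y : 𝔛} (hX : X ∈ G.basic) (hY : Y ∈ G.basic) :
    G.shapeHor X 0 Y ∈ G.basic := by
  have hYX := hor_nab_mem_basic hY hX
  have hXY := hor_nab_mem_basic hX hY
  have hXX := hor_nab_mem_basic hX hX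
  have hbr := G.basic.sub_mem hXY hYX
  have h := congrArg G.hor (curv_self (G := G) X Y)
  have hv : G.hor (G.nab (G.oneill X Y) X) = -G.oneillAdj X (G.oneill X Y) := by
    rw [nab_basic hX (G.proj_oneill X Y), hor_sub, hor_neg, G.hor_of_proj_eq (G.proj_shape _ _),
      neg_zero, zero_sub, G.hor_of_proj_eq_zero (G.proj_oneillAdj _ _)]
  rw [LeviCivita.curv, nab_horizontal hX.1 hY.1, nab_self hX.1, bracket_eq_oneill hX.1 hY.1] at h
  rw [map_sub (G.nab X), hor_sub, hor_sub, map_add, LinearMap.add_apply, hor_add, map_add,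
    LinearMap.add_apply, hor_add, hv, hor_sub,
    hor_smul, hor_sub, hor_smul, hor_smul, G.hor_of_proj_eq_zero hX.1, G.hor_of_proj_eq_zero hY.1,
    smul_sub, smul_smul, smul_smul] at h
  have e : G.oneillAdj X (G.oneill X Y) = -G.hor (G.nab X (G.oneill X Y)) := rfl
  have h3 : (3 : ℝ) • G.shapeHor X 0 Y
      = (G.const * G.metric X Y) • X - (G.const * G.metric X X) • Y
        - G.hor (G.nab X (G.hor (G.nab Y X))) + G.hor (G.nab Y (G.hor (G.nab X X)))
        + G.hor (G.nab (G.hor (G.nab X Y) - G.hor (G.nab Y X)) X) := by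
    rw [← h, shapeHor, shapePow, show (3 : ℝ) = 1 + 1 + 1 by norm_num, add_smul, add_smul,
      one_smul, e]
    abel
  have hc : ∀ {X Y}, X ∈ G.basic → Y ∈ G.basic → ∀ V, G.proj V = V →
      G.der V (G.const * G.metric X Y) = 0 := fun {X Y} hX hY V hV => by
    rw [Derivation.leibniz, G.der_const, der_metric_basic hV hX hY, smul_zero, smul_zero, add_zero]
  have : (3 : ℝ) • G.shapeHor X 0 Y ∈ G.basic := by
    rw [h3]
    exact G.basic.add_mem (G.basic.add_mem (G.basic.sub_mem (G.basic.sub_mem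
      (smul_mem_basic (hc hX hY) hX) (smul_mem_basic (hc hX hX) hY))
      (hor_nab_mem_basic hX hYX)) (hor_nab_mem_basic hY hXX)) (hor_nab_mem_basic hbr hX)
  exact (G.basic.smul_mem_iff (by norm_num)).1 this

/-- Strong induction with `X` and `Y` left free: the hypothesis is needed for all X + tT and with
`Y` replaced by derivatives or by other fields of the same form. -/
theorem shapeHor_mem_basic (k : ℕ) : ∀ {X Y : 𝔛}, X ∈ G.basic → Y ∈ G.basic →
    G.shapeHor X k Y ∈ G.basic := by
  induction k using Nat.strong_induction_on with
  | _ k ih =>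
  intro X Y hX hY
  cases k with
  | zero => exact shapeHor_zero_mem_basic hX hY
  | succ k =>
  have hXX := hor_nab_mem_basic hX hX
  have hk : ∀ {X Y : 𝔛}, X ∈ G.basic → Y ∈ G.basic → G.shapeHor X k Y ∈ G.basic :=
    ih k (Nat.lt_succ_self k)
  have hd : G.oneillAdj X (G.shapePowDeriv X (G.hor (G.nab X X)) k Y)
      + G.oneillAdj (G.hor (G.nab X X)) (G.shapePow X k Y) ∈ G.basic := by
    -- The sum in question is the coefficient of t in the order-k field built from X + tT, T = (∇_X
    -- X)^h. That field is basic for every real t by induction.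
    refine IsPolynomialMap.coeff_one_mem ((isPolynomialMap_shapePow X (G.hor (G.nab X X)) k
      Y).add_smul (G.oneillAdjₗ X) (G.oneillAdjₗ (G.hor (G.nab X X)))) _ fun t => ?_
    rw [← oneillAdj_add_smul]
    exact hk (G.basic.add_mem hX (G.basic.smul_mem t hXX)) hY
  -- The error consists of the field of order k − 1 and compositions of orders k − 1 − i and i, all
  -- covered by the strong induction.
  have he : G.oneillAdj X (G.shapePowError X k Y) ∈ G.basic := by
    rw [oneillAdj_shapePowError]
    refine G.basic.sum_mem fun i hi => ?_
    have hi := Finset.mem_range.1 hi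
    exact G.basic.sub_mem (smul_mem_basic (fun V hV => der_const_metric hX hV)
      (ih _ (by omega) hX hY)) (ih _ (by omega) hX (ih i (by omega) hX hY))
  have h := hor_nab_shapeHor hX hY.1 k
  have : ((k + 4 : ℕ) : ℝ) • G.shapeHor X (k + 1) Y ∈ G.basic := by
    rw [Nat.cast_smul_eq_nsmul]
    have h' : (k + 4) • G.shapeHor X (k + 1) Y = G.hor (G.nab X (G.shapeHor X k Y))
        - G.shapeHor X k (G.hor (G.nab X Y)) - (G.oneillAdj X (G.shapePowDeriv X
          (G.hor (G.nab X X)) k Y) + G.oneillAdj (G.hor (G.nab X X)) (G.shapePow X k Y))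
        - G.oneillAdj X (G.shapePowError X k Y) := by rw [h]; abel
    rw [h']
    exact G.basic.sub_mem (G.basic.sub_mem (G.basic.sub_mem (hor_nab_mem_basic hX (hk hX hY))
      (hk hX (hor_nab_mem_basic hX hY))) hd) he
  exact (G.basic.smul_mem_iff (by positivity)).1 this

theorem der_metric_shapePow {X Y Z V : 𝔛} (hX : X ∈ G.basic) (hY : Y ∈ G.basic)
    (hZ : Z ∈ G.basic) (hV : G.proj V = V) (k : ℕ) :
    G.der V (G.metric (G.shapePow X k Y) (G.oneill X Z)) = 0 := by
  rw [← G.metric_oneillAdj (proj_shapePow X k Y) hZ.1]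
  exact der_metric_basic hV (shapeHor_mem_basic k hX hY) hZ

end FoliatedLeviCivita

namespace RiemFol

/-! ### The Levi-Civita connection: Koszul formula, Leibniz rule, metric compatibility, torsion. -/

section Connection

variable {n : ℕ} {M : Type u} [TopologicalSpace M] [ChartedSpace (EuclideanSpace ℝ (Fin n)) M]
  [IsManifold (𝓡 n) ∞ M]

/-- The vector field `X` is differentiable at `p`. -/
abbrev IsDiffFieldAt (X : (p : M) → TangentSpace (𝓡 n) p) (p : M) : Prop :=
  MDifferentiableAt (𝓡 n) (𝓡 n).tangent (fun q => (⟨q, X q⟩ : TangentBundle (𝓡 n) M)) p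

theorem IsSmoothField.mdifferentiableAt {U : Set M} {X : (p : M) → TangentSpace (𝓡 n) p}
    (hX : IsSmoothField U X) (hU : IsOpen U) {p : M} (hp : p ∈ U) :
    IsDiffFieldAt X p :=
  (hX.contMDiffAt (hU.mem_nhds hp)).mdifferentiableAt (by simp)

variable [RiemannianBundle (fun p : M => TangentSpace (𝓡 n) p)]
  [IsContMDiffRiemannianBundle (𝓡 n) ∞ (EuclideanSpace ℝ (Fin n))
      (fun p : M => TangentSpace (𝓡 n) p)]

scoped instance isContMDiffRiemannianBundle_one : IsContMDiffRiemannianBundle (𝓡 n) 1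
    (EuclideanSpace ℝ (Fin n)) (fun p : M => TangentSpace (𝓡 n) p) :=
  IsContMDiffRiemannianBundle.of_le (n := ∞) (by simp)

theorem mdifferentiableAt_inner {p : M} {X Y : (p : M) → TangentSpace (𝓡 n) p}
    (hX : IsDiffFieldAt X p) (hY : IsDiffFieldAt Y p) :
    MDifferentiableAt (𝓡 n) 𝓘(ℝ, ℝ) (fun q => (inner ℝ (X q) (Y q) : ℝ)) p :=
  MDifferentiableAt.inner_bundle hX hY

theorem derivInner_smul_left (f : M → ℝ) (X Y Z : (p : M) → TangentSpace (𝓡 n) p) (p : M) :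
    derivInner (f • X) Y Z p = f p * derivInner X Y Z p := by
  simp [derivInner]

theorem derivInner_comm (X Y Z : (p : M) → TangentSpace (𝓡 n) p) (p : M) :
    derivInner X Y Z p = derivInner X Z Y p := by
  simp [derivInner, real_inner_comm]

theorem derivInner_smul_mid {f : M → ℝ} (X : (p : M) → TangentSpace (𝓡 n) p)
    {Y Z : (p : M) → TangentSpace (𝓡 n) p} {p : M}
    (hf : MDifferentiableAt (𝓡 n) 𝓘(ℝ, ℝ) f p) (hY : IsDiffFieldAt Y p) (hZ : IsDiffFieldAt Z p) :
    derivInner X (f • Y) Z p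
      = f p * derivInner X Y Z p + mvfderiv (𝓡 n) f p (X p) * inner ℝ (Y p) (Z p) := by
  have : (fun q => (inner ℝ ((f • Y) q) (Z q) : ℝ)) = fun q => f q * inner ℝ (Y q) (Z q) := by
    ext q; simp [inner_smul_left]
  rw [derivInner, this, mvfderiv_fun_mul hf (mdifferentiableAt_inner hY hZ)]
  simp [derivInner]; ring

theorem derivInner_add_mid (X : (p : M) → TangentSpace (𝓡 n) p)
    {Y Y' Z : (p : M) → TangentSpace (𝓡 n) p} {p : M}
    (hY : IsDiffFieldAt Y p) (hY' : IsDiffFieldAt Y' p) (hZ : IsDiffFieldAt Z p) :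
    derivInner X (Y + Y') Z p = derivInner X Y Z p + derivInner X Y' Z p := by
  have : (fun q => (inner ℝ ((Y + Y') q) (Z q) : ℝ))
      = fun q => inner ℝ (Y q) (Z q) + inner ℝ (Y' q) (Z q) := by
    ext q; simp [inner_add_left]
  rw [derivInner, this, mvfderiv_fun_add (mdifferentiableAt_inner hY hZ)
    (mdifferentiableAt_inner hY' hZ)]
  simp [derivInner]

theorem derivInner_add_left (X X' Y Z : (p : M) → TangentSpace (𝓡 n) p) (p : M) :
    derivInner (X + X') Y Z p = derivInner X Y Z p + derivInner X' Y Z p := by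
  simp [derivInner]

/-- The terms containing derivatives of f cancel between metric derivatives and brackets.
Tensoriality in both outer slots lets arbitrary fields replace the chosen extensions in the
definition of `nabla`. -/
theorem tensorialAt_koszul_left {Y Z : (p : M) → TangentSpace (𝓡 n) p} {p : M}
    (hY : IsDiffFieldAt Y p) (hZ : IsDiffFieldAt Z p) :
    TensorialAt (𝓡 n) (EuclideanSpace ℝ (Fin n)) (fun X => koszul X Y Z p) p where
  smul {f X} hf hX := by
    simp only [koszul]
    rw [derivInner_smul_left, derivInner_smul_mid Y hf hX hZ, derivInner_smul_mid Z hf hX hY,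
      mlieBracket_smul_left hf hX, mlieBracket_smul_left hf hX]
    simp only [inner_add_left, inner_smul_left, inner_neg_left, Pi.smul_apply', inner_smul_right,
      smul_eq_mul, RCLike.conj_to_real, neg_smul]
    ring
  add {X X'} hX hX' := by
    simp only [koszul]
    rw [derivInner_add_left, derivInner_add_mid Y hX hX' hZ, derivInner_add_mid Z hX hX' hY,
      mlieBracket_add_left hX hX', mlieBracket_add_left hX hX']
    simp only [inner_add_left, Pi.add_apply, inner_add_right]
    ring

theorem tensorialAt_koszul_right {X Y : (p : M) → TangentSpace (𝓡 n) p} {p : M}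
    (hX : IsDiffFieldAt X p) (hY : IsDiffFieldAt Y p) :
    TensorialAt (𝓡 n) (EuclideanSpace ℝ (Fin n)) (fun Z => koszul X Y Z p) p where
  smul {f Z} hf hZ := by
    simp only [koszul]
    rw [derivInner_smul_left, derivInner_comm X, derivInner_comm Y, derivInner_smul_mid X hf hZ hY,
      derivInner_smul_mid Y hf hZ hX, mlieBracket_smul_right hf hZ, mlieBracket_smul_right hf hZ,
      derivInner_comm X Z, derivInner_comm Y Z]
    simp only [inner_add_left, inner_smul_left, Pi.smul_apply', inner_smul_right,
      smul_eq_mul, RCLike.conj_to_real]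
    ring
  add {Z Z'} hZ hZ' := by
    simp only [koszul]
    rw [derivInner_add_left, derivInner_comm X, derivInner_comm Y, derivInner_add_mid X hZ hZ' hY,
      derivInner_add_mid Y hZ hZ' hX, mlieBracket_add_right hZ hZ', mlieBracket_add_right hZ hZ',
      derivInner_comm X Z, derivInner_comm Y Z, derivInner_comm X Z', derivInner_comm Y Z']
    simp only [inner_add_left, Pi.add_apply, inner_add_right]
    ring

/-- The Koszul formula. -/
theorem inner_nabla {X Y Z : (p : M) → TangentSpace (𝓡 n) p} {p : M}
    (hX : IsDiffFieldAt X p) (hY : IsDiffFieldAt Y p) (hZ : IsDiffFieldAt Z p) :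
    inner ℝ (nabla Y p (X p)) (Z p) = koszul X Y Z p / 2 := by
  let B := TensorialAt.mkHom₂ (I := 𝓡 n) (F := EuclideanSpace ℝ (Fin n))
    (F' := EuclideanSpace ℝ (Fin n)) (fun X Z => koszul X Y Z p) p
    (fun Z hZ => tensorialAt_koszul_left hY hZ) (fun X hX => tensorialAt_koszul_right hX hY)
  have hB : B (X p) (Z p) = koszul X Y Z p := TensorialAt.mkHom₂_apply _ _ hX hZ
  rw [← hB]
  let e := stdOrthonormalBasis ℝ (TangentSpace (𝓡 n) p)
  have key : ∀ i j, inner ℝ (nabla Y p (e i)) (e j) = B (e i) (e j) / 2 := by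
    intro i j
    have h1 : B (e i) (e j) = koszul (extendVec (e i)) Y (extendVec (e j)) p :=
      TensorialAt.mkHom₂_apply_eq_extend _ _ _ _
    have h2 : nabla Y p (e i)
        = ∑ j, (koszul (extendVec (e i)) Y (extendVec (e j)) p / 2) • e j := by
      rw [nabla, ← OrthonormalBasis.coe_toBasis, Module.Basis.constr_basis]
    rw [h1, h2, sum_inner]
    simp [inner_smul_left, e.inner_eq_ite]
  generalize X p = v
  generalize Z p = w
  have hv := e.sum_repr v
  have hw := e.sum_repr w
  rw [← hv, ← hw]
  simp only [map_sum, map_smul, sum_inner, inner_sum, inner_smul_left, inner_smul_right, key,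
    RCLike.conj_to_real, sum_apply,
    smul_apply, smul_eq_mul]
  simp only [Finset.mul_sum, Finset.sum_div]
  refine Finset.sum_congr rfl fun i _ => Finset.sum_congr rfl fun j _ => ?_
  ring

theorem extendVec_apply_self {p : M} (v : TangentSpace (𝓡 n) p) : extendVec v p = v := by
  simp [extendVec]

theorem mdifferentiableAt_extendVec {p : M} (v : TangentSpace (𝓡 n) p) :
    IsDiffFieldAt (extendVec v) p := FiberBundle.mdifferentiableAt_extend ..

theorem inner_nabla_vec {Y : (p : M) → TangentSpace (𝓡 n) p} {p : M} (hY : IsDiffFieldAt Y p)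
    (v w : TangentSpace (𝓡 n) p) :
    inner ℝ (nabla Y p v) w = koszul (extendVec v) Y (extendVec w) p / 2 := by
  rw [← inner_nabla (mdifferentiableAt_extendVec v) hY (mdifferentiableAt_extendVec w),
    extendVec_apply_self, extendVec_apply_self]

theorem nabla_add {Y Y' : (p : M) → TangentSpace (𝓡 n) p} {p : M} (hY : IsDiffFieldAt Y p)
    (hY' : IsDiffFieldAt Y' p) : nabla (Y + Y') p = nabla Y p + nabla Y' p := by
  ext v
  refine ext_inner_right ℝ fun w => ?_
  have hv := mdifferentiableAt_extendVec v
  have hw := mdifferentiableAt_extendVec w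
  rw [LinearMap.add_apply, inner_add_left, inner_nabla_vec hY, inner_nabla_vec hY',
    inner_nabla_vec (mdifferentiableAt_add_section hY hY')]
  simp only [koszul]
  rw [derivInner_add_left, derivInner_add_mid _ hY hY' hw, derivInner_comm _ _ (Y + Y'),
    derivInner_add_mid _ hY hY' hv, mlieBracket_add_right hY hY', mlieBracket_add_left hY hY',
    derivInner_comm (extendVec w) (extendVec v) Y, derivInner_comm (extendVec w) (extendVec v) Y']
  simp only [inner_add_left, Pi.add_apply, inner_add_right]
  ring

theorem nabla_smul {f : M → ℝ} {Y : (p : M) → TangentSpace (𝓡 n) p} {p : M}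
    (hf : MDifferentiableAt (𝓡 n) 𝓘(ℝ, ℝ) f p) (hY : IsDiffFieldAt Y p)
    (v : TangentSpace (𝓡 n) p) :
    nabla (f • Y) p v = f p • nabla Y p v + mvfderiv (𝓡 n) f p v • Y p := by
  refine ext_inner_right ℝ fun w => ?_
  have hv := mdifferentiableAt_extendVec v
  have hw := mdifferentiableAt_extendVec w
  rw [inner_add_left, inner_smul_left, inner_smul_left, inner_nabla_vec hY,
    inner_nabla_vec (hf.smul_section hY)]
  simp only [koszul]
  rw [derivInner_smul_left, derivInner_smul_mid _ hf hY hw, derivInner_comm _ _ (f • Y),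
    derivInner_smul_mid _ hf hY hv, mlieBracket_smul_right hf hY, mlieBracket_smul_left hf hY,
    derivInner_comm (extendVec w) (extendVec v) Y]
  simp only [inner_add_left, inner_smul_left, inner_neg_left, Pi.smul_apply', inner_smul_right,
      RCLike.conj_to_real, neg_smul, extendVec_apply_self]
  ring

theorem mvfderiv_inner {Y Z : (p : M) → TangentSpace (𝓡 n) p} {p : M}
    (hY : IsDiffFieldAt Y p) (hZ : IsDiffFieldAt Z p) (v : TangentSpace (𝓡 n) p) :
    mvfderiv (𝓡 n) (fun q => (inner ℝ (Y q) (Z q) : ℝ)) p v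
      = inner ℝ (nabla Y p v) (Z p) + inner ℝ (Y p) (nabla Z p v) := by
  have hv := mdifferentiableAt_extendVec v
  rw [real_inner_comm]
  nth_rewrite 2 3 [← extendVec_apply_self v]
  rw [real_inner_comm, inner_nabla hv hY hZ, real_inner_comm, inner_nabla hv hZ hY]
  simp only [koszul]
  rw [derivInner_comm (extendVec v) Z, derivInner_comm Y _ Z, derivInner_comm Z _ Y,
    mlieBracket_swap_apply (V := Z) (W := Y)]
  have : derivInner (extendVec v) Y Z p
      = mvfderiv (𝓡 n) (fun q => (inner ℝ (Y q) (Z q) : ℝ)) p v := by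
    simp [derivInner, extendVec_apply_self]
  rw [this, inner_neg_left]
  ring

theorem nabla_torsion {X Y : (p : M) → TangentSpace (𝓡 n) p} {p : M}
    (hX : IsDiffFieldAt X p) (hY : IsDiffFieldAt Y p) :
    nabla Y p (X p) - nabla X p (Y p) = mlieBracket (𝓡 n) X Y p := by
  refine ext_inner_right ℝ fun w => ?_
  have hw := mdifferentiableAt_extendVec w
  rw [← extendVec_apply_self w, inner_sub_left, inner_nabla hX hY hw, inner_nabla hY hX hw]
  simp only [koszul]
  rw [derivInner_comm _ Y X, mlieBracket_swap_apply (V := Y) (W := X), inner_neg_left]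
  ring

/-- Every ingredient of the Koszul expression depends only on germs, so no differentiability is
required. This allows cut-offs and extensions by zero. -/
theorem nabla_congr {Y Y' : (p : M) → TangentSpace (𝓡 n) p} {p : M}
    (h : Y =ᶠ[𝓝 p] Y') : nabla Y p = nabla Y' p := by
  have hc : ∀ (v w : TangentSpace (𝓡 n) p), koszul (extendVec v) Y (extendVec w) p
      = koszul (extendVec v) Y' (extendVec w) p := by
    intro v w
    have d1 : ∀ X Z : (p : M) → TangentSpace (𝓡 n) p,
        derivInner X Y Z p = derivInner X Y' Z p := fun X Z => by
      have e : (fun q => (inner ℝ (Y q) (Z q) : ℝ)) =ᶠ[𝓝 p] fun q => inner ℝ (Y' q) (Z q) := by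
        filter_upwards [h] with q hq
        rw [hq]
      change (mfderiv (𝓡 n) 𝓘(ℝ, ℝ) (fun q => (inner ℝ (Y q) (Z q) : ℝ)) p (X p) : ℝ)
        = mfderiv (𝓡 n) 𝓘(ℝ, ℝ) (fun q => (inner ℝ (Y' q) (Z q) : ℝ)) p (X p)
      rw [e.mfderiv_eq]
      rfl
    have b1 : ∀ X : (p : M) → TangentSpace (𝓡 n) p,
        mlieBracket (𝓡 n) X Y p = mlieBracket (𝓡 n) X Y' p := fun X =>
      EventuallyEq.rfl.mlieBracket_vectorField_eq h
    have b2 : ∀ X : (p : M) → TangentSpace (𝓡 n) p,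
        mlieBracket (𝓡 n) Y X p = mlieBracket (𝓡 n) Y' X p := fun X =>
      h.mlieBracket_vectorField_eq EventuallyEq.rfl
    simp only [koszul]
    rw [d1, derivInner_comm (extendVec w) _ Y, d1, derivInner_comm (extendVec w) Y', b1, b2]
    simp only [derivInner, h.self_of_nhds]
  simp only [nabla, hc]

end Connection

/-! ### Smooth fields, orthonormal frames, and the bracket as a commutator of derivations. -/

section Smooth

variable {n : ℕ} {M : Type u} [TopologicalSpace M] [ChartedSpace (EuclideanSpace ℝ (Fin n)) M]
  [IsManifold (𝓡 n) ∞ M] {U : Set M}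

theorem IsSmoothField.mono {N : Set M} {X : (p : M) → TangentSpace (𝓡 n) p}
    (hX : IsSmoothField U X) (h : N ⊆ U) : IsSmoothField N X := ContMDiffOn.mono hX h

theorem IsSmoothField.add {X Y : (p : M) → TangentSpace (𝓡 n) p}
    (hX : IsSmoothField U X) (hY : IsSmoothField U Y) : IsSmoothField U (X + Y) :=
  ContMDiffOn.add_section hX hY

theorem IsSmoothField.sub {X Y : (p : M) → TangentSpace (𝓡 n) p}
    (hX : IsSmoothField U X) (hY : IsSmoothField U Y) : IsSmoothField U (X - Y) :=
  ContMDiffOn.sub_section hX hY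

theorem IsSmoothField.smul {f : M → ℝ} {X : (p : M) → TangentSpace (𝓡 n) p}
    (hf : ContMDiffOn (𝓡 n) 𝓘(ℝ, ℝ) ∞ f U) (hX : IsSmoothField U X) : IsSmoothField U (f • X) :=
  ContMDiffOn.smul_section hf hX

theorem IsSmoothField.sum {ι : Type*} {s : Finset ι} {X : ι → (p : M) → TangentSpace (𝓡 n) p}
    (hX : ∀ i ∈ s, IsSmoothField U (X i)) : IsSmoothField U (fun p => ∑ i ∈ s, X i p) :=
  ContMDiffOn.sum_section hX

theorem isSmoothField_zero : IsSmoothField U (0 : (p : M) → TangentSpace (𝓡 n) p) :=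
  (contMDiff_zeroSection ℝ _).contMDiffOn

theorem IsSmoothField.congr {X Y : (p : M) → TangentSpace (𝓡 n) p}
    (hX : IsSmoothField U X) (h : ∀ p ∈ U, Y p = X p) : IsSmoothField U Y :=
  ContMDiffOn.congr hX fun p hp => by rw [h p hp]

theorem IsSmoothField.of_locally {X : (p : M) → TangentSpace (𝓡 n) p}
    (h : ∀ p ∈ U, ∃ N, IsOpen N ∧ p ∈ N ∧ IsSmoothField N X) : IsSmoothField U X := by
  intro p hp
  obtain ⟨N, hN, hpN, hX⟩ := h p hp
  exact (hX.contMDiffAt (hN.mem_nhds hpN)).contMDiffWithinAt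

scoped instance isManifold_minSmoothness_two : IsManifold (𝓡 n) (minSmoothness ℝ 2) M := by
  rw [minSmoothness_of_isRCLikeNormedField]; infer_instance

scoped instance isManifold_minSmoothness_three : IsManifold (𝓡 n) (minSmoothness ℝ 3) M := by
  rw [minSmoothness_of_isRCLikeNormedField]; infer_instance

scoped instance isManifold_infty_add_one : IsManifold (𝓡 n) (∞ + 1) M :=
  inferInstanceAs (IsManifold (𝓡 n) ∞ M)

theorem IsSmoothField.mlieBracket {X Y : (p : M) → TangentSpace (𝓡 n) p}
    (hU : IsOpen U) (hX : IsSmoothField U X) (hY : IsSmoothField U Y) :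
    IsSmoothField U (mlieBracket (𝓡 n) X Y) := fun p hp =>
  (ContMDiffAt.mlieBracket_vectorField (m := ⊤) (n := ⊤) (hX.contMDiffAt (hU.mem_nhds hp))
    (hY.contMDiffAt (hU.mem_nhds hp)) (by simp)).contMDiffWithinAt

theorem mdifferentiableAt_of_contMDiffOn {f : M → ℝ} (hU : IsOpen U)
    (hf : ContMDiffOn (𝓡 n) 𝓘(ℝ, ℝ) ∞ f U) {p : M} (hp : p ∈ U) :
    MDifferentiableAt (𝓡 n) 𝓘(ℝ, ℝ) f p :=
  (hf.contMDiffAt (hU.mem_nhds hp)).mdifferentiableAt (by simp)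

theorem contMDiffOn_mvfderiv {f : M → ℝ} {X : (p : M) → TangentSpace (𝓡 n) p} (hU : IsOpen U)
    (hf : ContMDiffOn (𝓡 n) 𝓘(ℝ, ℝ) ∞ f U) (hX : IsSmoothField U X) :
    ContMDiffOn (𝓡 n) 𝓘(ℝ, ℝ) ∞ (fun p => mvfderiv (𝓡 n) f p (X p)) U := by
  have h1 := hf.contMDiffOn_tangentMapWithin (m := ∞) (by simp) hU.uniqueMDiffOn
  have h2 := (contMDiff_snd_tangentBundle_modelSpace ℝ 𝓘(ℝ, ℝ) (n := ∞)).comp_contMDiffOn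
    (h1.comp hX fun p hp => hp)
  refine h2.congr fun p hp => ?_
  simp only [Function.comp, tangentMapWithin, mfderivWithin_of_isOpen hU hp]
  rfl

variable [RiemannianBundle (fun p : M => TangentSpace (𝓡 n) p)]
  [IsContMDiffRiemannianBundle (𝓡 n) ∞ (EuclideanSpace ℝ (Fin n))
      (fun p : M => TangentSpace (𝓡 n) p)]

theorem IsSmoothField.inner {X Y : (p : M) → TangentSpace (𝓡 n) p}
    (hX : IsSmoothField U X) (hY : IsSmoothField U Y) :
    ContMDiffOn (𝓡 n) 𝓘(ℝ, ℝ) ∞ (fun p => (inner ℝ (X p) (Y p) : ℝ)) U :=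
  ContMDiffOn.inner_bundle hX hY

theorem contMDiffOn_koszul {X Y Z : (p : M) → TangentSpace (𝓡 n) p} (hU : IsOpen U)
    (hX : IsSmoothField U X) (hY : IsSmoothField U Y) (hZ : IsSmoothField U Z) :
    ContMDiffOn (𝓡 n) 𝓘(ℝ, ℝ) ∞ (fun p => koszul X Y Z p) U := by
  have hd : ∀ {X Y Z : (p : M) → TangentSpace (𝓡 n) p}, IsSmoothField U X → IsSmoothField U Y →
      IsSmoothField U Z → ContMDiffOn (𝓡 n) 𝓘(ℝ, ℝ) ∞ (fun p => derivInner X Y Z p) U :=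
    fun hX hY hZ => contMDiffOn_mvfderiv hU (hY.inner hZ) hX
  exact (((((hd hX hY hZ).add (hd hY hX hZ)).sub (hd hZ hX hY)).add
    ((hX.mlieBracket hU hY).inner hZ)).sub ((hX.mlieBracket hU hZ).inner hY)).sub
    ((hY.mlieBracket hU hZ).inner hX)

theorem isSmoothField_gramSchmidt {m : ℕ} {s : Fin m → (p : M) → TangentSpace (𝓡 n) p}
    (hs : ∀ i, IsSmoothField U (s i)) (hli : ∀ p ∈ U, LinearIndependent ℝ fun i => s i p)
    (i : Fin m) :
    IsSmoothField U (fun p => InnerProductSpace.gramSchmidt ℝ (fun j => s j p) i) := by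
  induction i using WellFoundedLT.induction with
  | ind i ih =>
  have h : (fun p => InnerProductSpace.gramSchmidt ℝ (fun j => s j p) i) = s i -
      fun p => ∑ j ∈ Finset.Iio i, ((fun p => inner ℝ (InnerProductSpace.gramSchmidt ℝ
        (fun j => s j p) j) (s i p) / inner ℝ (InnerProductSpace.gramSchmidt ℝ (fun j => s j p) j)
          (InnerProductSpace.gramSchmidt ℝ (fun j => s j p) j)) •
        fun p => InnerProductSpace.gramSchmidt ℝ (fun j => s j p) j) p := by
    funext p
    have := InnerProductSpace.gramSchmidt_def'' ℝ (fun j => s j p) i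
    rw [Pi.sub_apply, eq_sub_iff_add_eq]
    conv_rhs => rw [this]
    simp
  rw [h]
  refine (hs i).sub (IsSmoothField.sum fun j hj => ?_)
  have hj := ih j (Finset.mem_Iio.1 hj)
  refine IsSmoothField.smul ((hj.inner (hs i)).div₀ (hj.inner hj) fun p hp => ?_) hj
  rw [real_inner_self_eq_norm_sq]
  exact pow_ne_zero _ (norm_ne_zero_iff.2 (InnerProductSpace.gramSchmidt_ne_zero j (hli p hp)))

theorem isSmoothField_gramSchmidtNormed {m : ℕ} {s : Fin m → (p : M) → TangentSpace (𝓡 n) p}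
    (hs : ∀ i, IsSmoothField U (s i)) (hli : ∀ p ∈ U, LinearIndependent ℝ fun i => s i p)
    (i : Fin m) :
    IsSmoothField U (fun p => InnerProductSpace.gramSchmidtNormed ℝ (fun j => s j p) i) := by
  have hj := isSmoothField_gramSchmidt hs hli i
  refine IsSmoothField.smul (f := fun p => (‖InnerProductSpace.gramSchmidt ℝ
    (fun j => s j p) i‖)⁻¹) (fun p hp => ?_) hj
  have h := hj.inner hj p hp
  have hne := norm_ne_zero_iff.2 (InnerProductSpace.gramSchmidt_ne_zero i (hli p hp))
  have hne' : inner ℝ (InnerProductSpace.gramSchmidt ℝ (fun j => s j p) i)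
      (InnerProductSpace.gramSchmidt ℝ (fun j => s j p) i) ≠ 0 := by
    rw [real_inner_self_eq_norm_sq]; exact pow_ne_zero _ hne
  have h2 : ContDiffAt ℝ ∞ (fun x => (√x)⁻¹) (inner ℝ (InnerProductSpace.gramSchmidt ℝ
      (fun j => s j p) i) (InnerProductSpace.gramSchmidt ℝ (fun j => s j p) i)) := by
    refine (Real.contDiffAt_sqrt hne').inv ?_
    rwa [real_inner_self_eq_norm_sq, Real.sqrt_sq (norm_nonneg _)]
  refine (h2.contMDiffAt.comp_contMDiffWithinAt p h).congr (fun q _ => ?_) ?_ <;>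
  · rw [Function.comp, real_inner_self_eq_norm_sq, Real.sqrt_sq (norm_nonneg _)]

/-- `e` is a smooth orthonormal frame on `N`. -/
structure IsOrthonormalFrame {m : ℕ} (N : Set M) (e : Fin m → (p : M) → TangentSpace (𝓡 n) p) :
    Prop where
  smooth : ∀ i, IsSmoothField N (e i)
  orthonormal : ∀ p ∈ N, Orthonormal ℝ fun i => e i p

theorem exists_isOrthonormalFrame (p : M) :
    ∃ (N : Set M) (e : Fin n → (p : M) → TangentSpace (𝓡 n) p), IsOpen N ∧ p ∈ N ∧
      IsOrthonormalFrame N e := by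
  let t := trivializationAt (EuclideanSpace ℝ (Fin n)) (TangentSpace (𝓡 n) (M := M)) p
  let b := (EuclideanSpace.basisFun (Fin n) ℝ).toBasis
  have h := t.isLocalFrameOn_localFrame_baseSet (𝓡 n) ∞ b
  exact ⟨t.baseSet, _, t.open_baseSet, FiberBundle.mem_baseSet_trivializationAt' p,
    fun i => isSmoothField_gramSchmidtNormed (s := t.localFrame b) h.contMDiffOn
      (fun p hp => h.linearIndependent hp) i,
    fun p hp => InnerProductSpace.gramSchmidtNormed_orthonormal (h.linearIndependent hp)⟩

theorem finrank_tangentSpace (p : M) : Module.finrank ℝ (TangentSpace (𝓡 n) p) = n :=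
  finrank_euclideanSpace_fin

/-- The orthonormal basis of the tangent space given by an orthonormal frame. -/
def IsOrthonormalFrame.basis {N : Set M} {e : Fin n → (p : M) → TangentSpace (𝓡 n) p}
    (he : IsOrthonormalFrame N e) {p : M} (hp : p ∈ N) :
    OrthonormalBasis (Fin n) ℝ (TangentSpace (𝓡 n) p) :=
  OrthonormalBasis.mk (he.orthonormal p hp) (by
    rw [((he.orthonormal p hp).linearIndependent).span_eq_top_of_card_eq_finrank'
      (by rw [Fintype.card_fin, finrank_tangentSpace])])

theorem IsOrthonormalFrame.basis_apply {N : Set M} {e : Fin n → (p : M) → TangentSpace (𝓡 n) p}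
    (he : IsOrthonormalFrame N e) {p : M} (hp : p ∈ N) (i : Fin n) : he.basis hp i = e i p := by
  simp [IsOrthonormalFrame.basis]

theorem IsOrthonormalFrame.sum_inner {N : Set M} {e : Fin n → (p : M) → TangentSpace (𝓡 n) p}
    (he : IsOrthonormalFrame N e) {p : M} (hp : p ∈ N) (v : TangentSpace (𝓡 n) p) :
    ∑ i, (inner ℝ (e i p) v : ℝ) • e i p = v := by
  simp only [← he.basis_apply hp]
  exact (he.basis hp).sum_repr' v

/-- In a local orthonormal frame the coefficients of `X` are such inner products. -/
theorem isSmoothField_of_inner (hU : IsOpen U) {X : (p : M) → TangentSpace (𝓡 n) p}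
    (h : ∀ N : Set M, IsOpen N → N ⊆ U → ∀ Z : (p : M) → TangentSpace (𝓡 n) p,
      IsSmoothField N Z → ContMDiffOn (𝓡 n) 𝓘(ℝ, ℝ) ∞ (fun p => (inner ℝ (Z p) (X p) : ℝ)) N) :
    IsSmoothField U X := by
  refine IsSmoothField.of_locally fun p hp => ?_
  obtain ⟨N, e, hN, hpN, he⟩ := exists_isOrthonormalFrame (n := n) p
  have hs : ∀ i, IsSmoothField (N ∩ U) (e i) := fun i => (he.smooth i).mono inter_subset_left
  refine ⟨N ∩ U, hN.inter hU, ⟨hpN, hp⟩, ?_⟩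
  have := IsSmoothField.sum (s := Finset.univ) fun i _ =>
    IsSmoothField.smul (h _ (hN.inter hU) inter_subset_right _ (hs i)) (hs i)
  refine this.congr fun q hq => ?_
  exact (he.sum_inner hq.1 _).symm

theorem isSmoothField_nabla {X Y : (p : M) → TangentSpace (𝓡 n) p} (hU : IsOpen U)
    (hX : IsSmoothField U X) (hY : IsSmoothField U Y) :
    IsSmoothField U (fun p => nabla Y p (X p)) := by
  refine isSmoothField_of_inner hU fun N hN hNU Z hZ => ?_
  have h := (contMDiffOn_koszul hN (hX.mono hNU) (hY.mono hNU) hZ).div_const 2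
  refine h.congr fun p hp => ?_
  rw [real_inner_comm]
  exact inner_nabla (hX.mdifferentiableAt hU (hNU hp)) (hY.mdifferentiableAt hU (hNU hp))
    (hZ.mdifferentiableAt hN hp)

/-- The Jacobi identity for X, Y and f•Z minus f times the one for X, Y, Z leaves the claimed
identity multiplied by `Z`; a member of a frame serves as `Z`, since it does not vanish. -/
theorem mvfderiv_mlieBracket {X Y : (p : M) → TangentSpace (𝓡 n) p} {f : M → ℝ} (hU : IsOpen U)
    (hX : IsSmoothField U X) (hY : IsSmoothField U Y) (hf : ContMDiffOn (𝓡 n) 𝓘(ℝ, ℝ) ∞ f U)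
    {p : M} (hp : p ∈ U) :
    mvfderiv (𝓡 n) f p (mlieBracket (𝓡 n) X Y p)
      = mvfderiv (𝓡 n) (fun q => mvfderiv (𝓡 n) f q (Y q)) p (X p)
        - mvfderiv (𝓡 n) (fun q => mvfderiv (𝓡 n) f q (X q)) p (Y p) := by
  -- In dimension zero there is no nonvanishing field, but all vectors are zero.
  rcases subsingleton_or_nontrivial (TangentSpace (𝓡 n) p) with hs | hs
  · rw [Subsingleton.elim (mlieBracket (𝓡 n) X Y p) 0, Subsingleton.elim (X p) 0,
      Subsingleton.elim (Y p) 0]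
    simp
  obtain ⟨N, e, hN, hpN, he⟩ := exists_isOrthonormalFrame (n := n) p
  obtain ⟨i⟩ : Nonempty (Fin n) := by
    by_contra h
    have := finrank_tangentSpace (n := n) p
    rcases n with _ | n
    · exact (Module.finrank_pos (R := ℝ) (M := TangentSpace (𝓡 0) p)).ne' this
    · exact h ⟨0⟩
  set O := N ∩ U with hO
  have hOo : IsOpen O := hN.inter hU
  have hpO : p ∈ O := ⟨hpN, hp⟩
  replace hX := hX.mono (inter_subset_right : O ⊆ U)
  replace hY := hY.mono (inter_subset_right : O ⊆ U)
  replace hf := hf.mono (inter_subset_right : O ⊆ U)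
  have hZ := (he.smooth i).mono (inter_subset_left : O ⊆ N)
  set Z := e i
  have at2 : ∀ {X : (p : M) → TangentSpace (𝓡 n) p}, IsSmoothField O X →
      ContMDiffAt (𝓡 n) (𝓡 n).tangent (minSmoothness ℝ 2)
        (fun q => (⟨q, X q⟩ : TangentBundle (𝓡 n) M)) p := fun {X} hX =>
    (hX.contMDiffAt (hOo.mem_nhds hpO)).of_le (by simpa using ENat.LEInfty.out)
  have dV : ∀ {X : (p : M) → TangentSpace (𝓡 n) p}, IsSmoothField O X → ∀ {q}, q ∈ O →
      IsDiffFieldAt X q := fun {X} hX {q} hq => hX.mdifferentiableAt hOo hq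
  have df : ∀ {f : M → ℝ}, ContMDiffOn (𝓡 n) 𝓘(ℝ, ℝ) ∞ f O → ∀ {q}, q ∈ O →
      MDifferentiableAt (𝓡 n) 𝓘(ℝ, ℝ) f q := fun {f} hf {q} hq =>
    mdifferentiableAt_of_contMDiffOn hOo hf hq
  have hfX := contMDiffOn_mvfderiv hOo hf hX
  have hfY := contMDiffOn_mvfderiv hOo hf hY
  have key : ∀ {X : (p : M) → TangentSpace (𝓡 n) p}, IsSmoothField O X →
      mlieBracket (𝓡 n) X (f • Z) =ᶠ[𝓝 p] (fun q => mvfderiv (𝓡 n) f q (X q)) • Z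
        + f • mlieBracket (𝓡 n) X Z := fun {X} hX => by
    filter_upwards [hOo.mem_nhds hpO] with q hq
    rw [mlieBracket_smul_right (df hf hq) (dV hZ hq)]
    rfl
  have J1 := leibniz_identity_mlieBracket_apply (at2 hX) (at2 hY) (at2 (hZ.smul hf))
  have J2 := leibniz_identity_mlieBracket_apply (at2 hX) (at2 hY) (at2 hZ)
  have hXZ := hX.mlieBracket hOo hZ
  have hYZ := hY.mlieBracket hOo hZ
  rw [EventuallyEq.rfl.mlieBracket_vectorField_eq (key hY),
    EventuallyEq.rfl.mlieBracket_vectorField_eq (key hX),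
    mlieBracket_smul_right (df hf hpO) (dV hZ hpO),
    mlieBracket_add_right (dV (hZ.smul hfY) hpO) (dV (hYZ.smul hf) hpO),
    mlieBracket_add_right (dV (hZ.smul hfX) hpO) (dV (hXZ.smul hf) hpO),
    mlieBracket_smul_right (df hfY hpO) (dV hZ hpO),
    mlieBracket_smul_right (df hfX hpO) (dV hZ hpO),
    mlieBracket_smul_right (df hf hpO) (dV hYZ hpO),
    mlieBracket_smul_right (df hf hpO) (dV hXZ hpO), J2] at J1
  have hZ0 : Z p ≠ 0 := (he.orthonormal p hpN).ne_zero i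
  have : (mvfderiv (𝓡 n) f p (mlieBracket (𝓡 n) X Y p)
      - (mvfderiv (𝓡 n) (fun q => mvfderiv (𝓡 n) f q (Y q)) p (X p)
        - mvfderiv (𝓡 n) (fun q => mvfderiv (𝓡 n) f q (X q)) p (Y p))) • Z p = 0 := by
    rw [← sub_eq_zero] at J1
    rw [← neg_eq_zero, ← J1]
    module
  exact sub_eq_zero.1 ((smul_eq_zero.1 this).resolve_right hZ0)

end Smooth

/-! ### Passing from local to global fields. -/

section Extension

variable {n : ℕ} {M : Type u} [TopologicalSpace M] [T2Space M]
  [ChartedSpace (EuclideanSpace ℝ (Fin n)) M] [IsManifold (𝓡 n) ∞ M] {U : Set M}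

/-- Curvature and geodesics are tested against globally smooth fields only. A bump function makes a
local field global without changing its germ at `p`. -/
theorem IsSmoothField.exists_extension {X : (p : M) → TangentSpace (𝓡 n) p}
    (hX : IsSmoothField U X) (hU : IsOpen U) {p : M} (hp : p ∈ U) :
    ∃ f : M → ℝ, IsSmoothField univ (f • X) ∧ (f • X) =ᶠ[𝓝 p] X := by
  obtain ⟨f, -, hf⟩ := (SmoothBumpFunction.nhds_basis_tsupport (I := 𝓡 n) p).mem_iff.1
    (hU.mem_nhds hp)
  refine ⟨f, ?_, ?_⟩
  · exact contMDiffOn_univ.2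
      (ContMDiffOn.smul_section_of_tsupport f.contMDiff.contMDiffOn hU hf hX)
  · filter_upwards [f.eventuallyEq_one] with q hq
    simp [hq]
    rfl

variable [RiemannianBundle (fun p : M => TangentSpace (𝓡 n) p)]
  [IsContMDiffRiemannianBundle (𝓡 n) ∞ (EuclideanSpace ℝ (Fin n))
      (fun p : M => TangentSpace (𝓡 n) p)]

theorem eventuallyEq_nabla {X X' Y Y' : (p : M) → TangentSpace (𝓡 n) p} {p : M}
    (hX : X =ᶠ[𝓝 p] X') (hY : Y =ᶠ[𝓝 p] Y') :
    (fun q => nabla Y q (X q)) =ᶠ[𝓝 p] fun q => nabla Y' q (X' q) := by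
  filter_upwards [hX, hY.eventuallyEq_nhds] with q h1 h2
  rw [h1, nabla_congr h2]

theorem curvature_congr {X X' Y Y' Z Z' : (p : M) → TangentSpace (𝓡 n) p} {p : M}
    (hX : X =ᶠ[𝓝 p] X') (hY : Y =ᶠ[𝓝 p] Y') (hZ : Z =ᶠ[𝓝 p] Z') :
    curvature X Y Z p = curvature X' Y' Z' p := by
  rw [curvature, curvature, nabla_congr (eventuallyEq_nabla hY hZ),
    nabla_congr (eventuallyEq_nabla hX hZ), nabla_congr hZ, hX.self_of_nhds, hY.self_of_nhds,
    hX.mlieBracket_vectorField_eq hY]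

theorem HasConstantCurvature.inner_curvature {c : ℝ} (hc : HasConstantCurvature n M c)
    {X Y : (p : M) → TangentSpace (𝓡 n) p} (hU : IsOpen U) (hX : IsSmoothField U X)
    (hY : IsSmoothField U Y) {p : M} (hp : p ∈ U) :
    inner ℝ (curvature X Y Y p) (X p)
      = c * (inner ℝ (X p) (X p) * inner ℝ (Y p) (Y p) - inner ℝ (X p) (Y p) ^ 2) := by
  obtain ⟨f, hf, hfX⟩ := hX.exists_extension hU hp
  obtain ⟨g, hg, hgY⟩ := hY.exists_extension hU hp
  have := hc _ _ hf hg p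
  rwa [curvature_congr hfX hgY hgY, hfX.self_of_nhds, hgY.self_of_nhds] at this

end Extension

/-! ### Local existence of geodesics. -/

section Geodesic

theorem exists_contDiffOn_integralCurve {E : Type*} [NormedAddCommGroup E] [NormedSpace ℝ E]
    [CompleteSpace E] {f : E → E} {Ω : Set E} (hΩ : IsOpen Ω) (hf : ContDiffOn ℝ ∞ f Ω) {x : E}
    (hx : x ∈ Ω) : ∃ ε > (0 : ℝ), ∃ α : ℝ → E, α 0 = x ∧ ContDiffOn ℝ ∞ α (Ioo (-ε) ε) ∧
      ∀ t ∈ Ioo (-ε) ε, α t ∈ Ω ∧ HasDerivAt α (f (α t)) t := by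
  obtain ⟨α, h0, ε, hε, hα⟩ :=
    ((hf.contDiffAt (hΩ.mem_nhds hx)).of_le
      (by simp)).exists_forall_mem_closedBall_exists_eq_forall_mem_Ioo_hasDerivAt₀ 0
  simp only [zero_sub, zero_add] at hα
  have hc : ∀ᶠ t in 𝓝 (0 : ℝ), α t ∈ Ω :=
    (hα 0 (by simp [hε])).continuousAt.eventually_mem (by rw [h0]; exact hΩ.mem_nhds hx)
  obtain ⟨δ, hδ, hd⟩ := Metric.eventually_nhds_iff_ball.1 hc
  -- Halving puts the closed interval inside both the domain of the solution and the times spent in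
  -- `Ω`; the smoothness theorem for solutions is stated on closed intervals.
  set η := min ε δ / 2
  have hη : 0 < η := by positivity
  have h1 : η < ε := (half_lt_self (lt_min hε hδ)).trans_le (min_le_left _ _)
  have h2 : η < δ := (half_lt_self (lt_min hε hδ)).trans_le (min_le_right _ _)
  have key : ∀ t ∈ Icc (-η) η, α t ∈ Ω ∧ HasDerivAt α (f (α t)) t := fun t ht =>
    ⟨hd t (by rw [Metric.mem_ball, dist_zero_right, Real.norm_eq_abs, abs_lt]
              exact ⟨by linarith [ht.1], by linarith [ht.2]⟩),
      hα t ⟨by linarith [ht.1], by linarith [ht.2]⟩⟩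
  refine ⟨η, hη, α, h0, ?_, fun t ht => key t (Ioo_subset_Icc_self ht)⟩
  refine ContDiffOn.mono (ODE.contDiffOn_enat_Icc_of_hasDerivWithinAt (f := fun _ => f) (u := Ω)
    (n := ⊤) ?_ (fun t ht => (key t ht).2.hasDerivWithinAt) fun t ht => (key t ht).1)
    Ioo_subset_Icc_self
  exact hf.comp contDiffOn_snd fun y hy => hy.2

variable {n : ℕ} {M : Type u} [TopologicalSpace M]
  [ChartedSpace (EuclideanSpace ℝ (Fin n)) M] [IsManifold (𝓡 n) ∞ M] {U : Set M}

theorem contMDiffOn_mfderiv_apply {F : Type*} [NormedAddCommGroup F] [NormedSpace ℝ F] {f : M → F}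
    {X : (p : M) → TangentSpace (𝓡 n) p} (hU : IsOpen U)
    (hf : ContMDiffOn (𝓡 n) 𝓘(ℝ, F) ∞ f U) (hX : IsSmoothField U X) :
    ContMDiffOn (𝓡 n) 𝓘(ℝ, F) ∞ (fun p => (mfderiv (𝓡 n) 𝓘(ℝ, F) f p (X p) : F)) U := by
  have h1 := hf.contMDiffOn_tangentMapWithin (m := ∞) (by simp) hU.uniqueMDiffOn
  have h2 := (contMDiff_snd_tangentBundle_modelSpace F 𝓘(ℝ, F) (n := ∞)).comp_contMDiffOn
    (h1.comp hX fun p hp => hp)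
  refine h2.congr fun p hp => ?_
  simp only [Function.comp, tangentMapWithin, mfderivWithin_of_isOpen hU hp]
  rfl

/-- A frame `e` and coefficients `G` give a second order differential equation for curves with
velocity `∑ i, a i • e i`. -/
theorem exists_curve_of_frame {m : ℕ} {N : Set M} (hN : IsOpen N)
    {e : Fin m → (p : M) → TangentSpace (𝓡 n) p} (he : ∀ i, IsSmoothField N (e i))
    {G : Fin m → Fin m → Fin m → M → ℝ} (hG : ∀ i j k, ContMDiffOn (𝓡 n) 𝓘(ℝ, ℝ) ∞ (G i j k) N)
    {p : M} (hp : p ∈ N) (a₀ : Fin m → ℝ) :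
    ∃ ε > (0 : ℝ), ∃ (γ : ℝ → M) (a : ℝ → Fin m → ℝ), γ 0 = p ∧ a 0 = a₀ ∧
      ContMDiffOn 𝓘(ℝ, ℝ) (𝓡 n) ∞ γ (Ioo (-ε) ε) ∧ ∀ t ∈ Ioo (-ε) ε, γ t ∈ N ∧
        velocity n γ t = ∑ i, a t i • e i (γ t) ∧
        ∀ k, HasDerivAt (fun s => a s k) (∑ i, ∑ j, a t i * a t j * G i j k (γ t)) t := by
  set φ := extChartAt (𝓡 n) p with hφ
  set Ω := φ.target ∩ φ.symm ⁻¹' N with hΩ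
  have hΩo : IsOpen Ω :=
    (continuousOn_extChartAt_symm p).isOpen_inter_preimage (isOpen_extChartAt_target p) hN
  have hsymm : ContMDiffOn 𝓘(ℝ, EuclideanSpace ℝ (Fin n)) (𝓡 n) ∞ φ.symm Ω :=
    (contMDiffOn_extChartAt_symm p).mono inter_subset_left
  have hmaps : MapsTo φ.symm Ω (N ∩ φ.source) := fun x hx => ⟨hx.2, φ.map_target hx.1⟩
  have hNs : IsOpen (N ∩ φ.source) := hN.inter (isOpen_extChartAt_source p)
  have hsm : ContMDiffOn (𝓡 n) 𝓘(ℝ, EuclideanSpace ℝ (Fin n)) ∞ φ (N ∩ φ.source) :=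
    (contMDiffOn_extChartAt (x := p)).mono (by
      intro y hy; simpa [hφ, extChartAt_source] using hy.2)
  -- The frame read in the chart. With it the equations become an autonomous first order system for
  -- the pair (position, coefficients).
  let ε' : Fin m → EuclideanSpace ℝ (Fin n) → EuclideanSpace ℝ (Fin n) := fun i x =>
    mfderiv (𝓡 n) 𝓘(ℝ, EuclideanSpace ℝ (Fin n)) φ (φ.symm x) (e i (φ.symm x))
  have hε' : ∀ i, ContDiffOn ℝ ∞ (ε' i) Ω := fun i => contMDiffOn_iff_contDiffOn.1
    ((contMDiffOn_mfderiv_apply hNs hsm ((he i).mono inter_subset_left)).comp hsymm hmaps)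
  have hG' : ∀ i j k, ContDiffOn ℝ ∞ (fun x => G i j k (φ.symm x)) Ω := fun i j k =>
    contMDiffOn_iff_contDiffOn.1 ((hG i j k).comp hsymm fun x hx => (hmaps hx).1)
  let f : EuclideanSpace ℝ (Fin n) × (Fin m → ℝ) → EuclideanSpace ℝ (Fin n) × (Fin m → ℝ) :=
    fun z => (∑ i, z.2 i • ε' i z.1, fun k => ∑ i, ∑ j, z.2 i * z.2 j * G i j k (φ.symm z.1))
  have h1 : MapsTo (Prod.fst : EuclideanSpace ℝ (Fin n) × (Fin m → ℝ) → _) (Ω ×ˢ univ) Ω :=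
    fun z hz => hz.1
  have hc : ∀ i, ContDiffOn ℝ ∞
      (fun z : EuclideanSpace ℝ (Fin n) × (Fin m → ℝ) => z.2 i) (Ω ×ˢ univ) := fun i =>
    ((contDiff_apply ℝ ℝ i).comp contDiff_snd).contDiffOn
  have hf : ContDiffOn ℝ ∞ f (Ω ×ˢ univ) := by
    refine ContDiffOn.prodMk (ContDiffOn.sum fun i _ => ?_) (contDiffOn_pi.2 fun k =>
      ContDiffOn.sum fun i _ => ContDiffOn.sum fun j _ => ?_)
    · exact (hc i).smul ((hε' i).comp contDiffOn_fst h1)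
    · exact ((hc i).mul (hc j)).mul ((hG' i j k).comp contDiffOn_fst h1)
  have hx0 : φ p ∈ Ω := ⟨mem_extChartAt_target p, by
    simpa [hφ, extChartAt_to_inv] using hp⟩
  obtain ⟨ε, hε, α, hα0, hαs, hα⟩ := exists_contDiffOn_integralCurve (hΩo.prod isOpen_univ) hf
    (x := (φ p, a₀)) ⟨hx0, mem_univ _⟩
  have hx : ContDiffOn ℝ ∞ (fun t => (α t).1) (Ioo (-ε) ε) := hαs.fst
  refine ⟨ε, hε, fun t => φ.symm (α t).1, fun t => (α t).2, ?_, by simp [hα0], ?_, ?_⟩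
  · simp [hα0, hφ]
  · exact hsymm.comp (contMDiffOn_iff_contDiffOn.2 hx) fun t ht => (hα t ht).1.1
  intro t ht
  obtain ⟨hm, hd⟩ := hα t ht
  have hm' := hmaps hm.1
  refine ⟨hm'.1, ?_, fun k => ?_⟩
  · have hd1 : HasDerivAt (fun t => (α t).1) (f (α t)).1 t := hd.fst
    have d2 : MDifferentiableAt 𝓘(ℝ, EuclideanSpace ℝ (Fin n)) (𝓡 n) φ.symm (α t).1 :=
      ((hsymm.contMDiffAt (hΩo.mem_nhds hm.1)).mdifferentiableAt (by simp))
    have d3 := HasMFDerivAt.comp t d2.hasMFDerivAt hd1.hasFDerivAt.hasMFDerivAt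
    have key := mfderivWithin_extChartAt_symm_comp_mfderiv_extChartAt (I := 𝓡 n) (x := p)
      (y := (α t).1) hm.1.1
    rw [ModelWithCorners.range_eq_univ, mfderivWithin_univ] at key
    have d4 : velocity n (fun t => φ.symm (α t).1) t
        = mfderiv 𝓘(ℝ, EuclideanSpace ℝ (Fin n)) (𝓡 n) φ.symm (α t).1 ((1 : ℝ) • (f (α t)).1) :=
      DFunLike.congr_fun d3.mfderiv (1 : ℝ)
    have d5 : (f (α t)).1 = mfderiv (𝓡 n) 𝓘(ℝ, EuclideanSpace ℝ (Fin n)) φ (φ.symm (α t).1)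
        (∑ i, (α t).2 i • e i (φ.symm (α t).1)) := by
      rw [map_sum]
      simp only [map_smul]
      rfl
    rw [d4, one_smul, d5]
    exact DFunLike.congr_fun key _
  · exact hasDerivAt_pi.1 hd.snd k

variable [T2Space M] [RiemannianBundle (fun p : M => TangentSpace (𝓡 n) p)]
  [IsContMDiffRiemannianBundle (𝓡 n) ∞ (EuclideanSpace ℝ (Fin n))
      (fun p : M => TangentSpace (𝓡 n) p)]

theorem hasDerivAt_comp_curve {f : M → ℝ} {γ : ℝ → M} {t : ℝ}
    (hf : MDifferentiableAt (𝓡 n) 𝓘(ℝ, ℝ) f (γ t))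
    (hγ : MDifferentiableAt 𝓘(ℝ, ℝ) (𝓡 n) γ t) :
    HasDerivAt (fun s => f (γ s)) (mvfderiv (𝓡 n) f (γ t) (velocity n γ t)) t := by
  have key : ∀ (g : ℝ → ℝ) (L : ℝ →L[ℝ] ℝ), HasFDerivAt g L t → HasDerivAt g (L 1) t :=
    fun g L h => h.hasDerivAt
  exact key _ _ (hasMFDerivAt_iff_hasFDerivAt.1 (HasMFDerivAt.comp t hf.hasMFDerivAt
    hγ.hasMFDerivAt))

/-- For γ' = ∑ a_i e_i in an orthonormal frame, the geodesic equation is a_l' = −∑ a_j a_k ⟨∇_{e_j}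
e_k, e_l⟩, which dictates the coefficients given to `exists_curve_of_frame`. -/
theorem exists_isGeodesic {p : M} (v : TangentSpace (𝓡 n) p) :
    ∃ ε > (0 : ℝ), ∃ γ : ℝ → M, IsGeodesic n γ (Ioo (-ε) ε) ∧
      (⟨γ 0, velocity n γ 0⟩ : TangentBundle (𝓡 n) M) = ⟨p, v⟩ := by
  obtain ⟨N, e, hN, hp, he⟩ := exists_isOrthonormalFrame (n := n) p
  obtain ⟨ε, hε, γ, a, h0, ha0, hγ, h⟩ := exists_curve_of_frame hN he.smooth
    (G := fun j k l q => -inner ℝ (nabla (e k) q (e j q)) (e l q))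
    (fun j k l => ((isSmoothField_nabla hN (he.smooth j) (he.smooth k)).inner (he.smooth l)).neg)
    hp (fun i => inner ℝ (e i p) v)
  have hmem : (0 : ℝ) ∈ Ioo (-ε) ε := by simp [hε]
  refine ⟨ε, hε, γ, ⟨hγ, fun Z hZ t ht => ?_⟩, ?_⟩
  · have hs : ∀ s ∈ Ioo (-ε) ε, (inner ℝ (velocity n γ s) (Z (γ s)) : ℝ)
        = ∑ k, a s k * inner ℝ (e k (γ s)) (Z (γ s)) := fun s hs => by
      rw [(h s hs).2.1, sum_inner]
      simp [inner_smul_left]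
    obtain ⟨hm, hv, hd⟩ := h t ht
    have hZd : IsDiffFieldAt Z (γ t) := hZ.mdifferentiableAt isOpen_univ (mem_univ _)
    have hed : ∀ k, IsDiffFieldAt (e k) (γ t) := fun k => (he.smooth k).mdifferentiableAt hN hm
    have hγd : MDifferentiableAt 𝓘(ℝ, ℝ) (𝓡 n) γ t :=
      (hγ.contMDiffAt (isOpen_Ioo.mem_nhds ht)).mdifferentiableAt (by simp)
    have h1 := HasDerivAt.fun_sum (u := Finset.univ) fun k _ =>
      (hd k).mul (hasDerivAt_comp_curve (mdifferentiableAt_inner (hed k) hZd) hγd)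
    refine (h1.congr_of_eventuallyEq ?_).congr_deriv ?_
    · filter_upwards [isOpen_Ioo.mem_nhds ht] with s hs' using hs s hs'
    · have e1 : ∀ k, nabla (e k) (γ t) (velocity n γ t)
          = ∑ j, a t j • nabla (e k) (γ t) (e j (γ t)) := fun k => by
        rw [hv, map_sum]; simp only [map_smul]
      have e2 : ∀ w : TangentSpace (𝓡 n) (γ t), (inner ℝ w (Z (γ t)) : ℝ)
          = ∑ l, inner ℝ w (e l (γ t)) * inner ℝ (e l (γ t)) (Z (γ t)) := fun w => by
        conv_lhs => rw [← he.sum_inner hm (Z (γ t))]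
        rw [inner_sum]
        exact Finset.sum_congr rfl fun l _ => by rw [inner_smul_right]; ring
      simp only [mvfderiv_inner (hed _) hZd, mul_add, Finset.sum_add_distrib]
      have e3 : ∑ k, a t k * (inner ℝ (e k (γ t)) (nabla Z (γ t) (velocity n γ t)) : ℝ)
          = inner ℝ (velocity n γ t) (nabla Z (γ t) (velocity n γ t)) := by
        conv_rhs => rw [hv]
        rw [sum_inner]
        simp only [hv, inner_smul_left, RCLike.conj_to_real]
      rw [e3, ← add_assoc, add_eq_right]
      simp only [e1, sum_inner, inner_smul_left, RCLike.conj_to_real]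
      simp only [e2 (nabla _ _ _), Finset.mul_sum, Finset.sum_mul]
      rw [← sub_neg_eq_add, sub_eq_zero, ← Finset.sum_neg_distrib]
      rw [Finset.sum_comm]
      conv_lhs => enter [2, j]; rw [Finset.sum_comm]
      rw [Finset.sum_comm]
      refine Finset.sum_congr rfl fun k _ => ?_
      rw [← Finset.sum_neg_distrib]
      refine Finset.sum_congr rfl fun j _ => ?_
      rw [← Finset.sum_neg_distrib]
      refine Finset.sum_congr rfl fun l _ => ?_
      ring
  · obtain ⟨-, hv, -⟩ := h 0 hmem
    rw [hv, ha0]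
    subst h0
    rw [he.sum_inner hp]

end Geodesic

/-! ### The infinitesimal form of transnormality. -/

section Transnormal

variable {n : ℕ} {M : Type u} [TopologicalSpace M] [T2Space M]
  [ChartedSpace (EuclideanSpace ℝ (Fin n)) M] [IsManifold (𝓡 n) ∞ M]
  [RiemannianBundle (fun p : M => TangentSpace (𝓡 n) p)]
  [IsContMDiffRiemannianBundle (𝓡 n) ∞ (EuclideanSpace ℝ (Fin n))
      (fun p : M => TangentSpace (𝓡 n) p)]

/-- The geodesic with initial velocity `x` stays horizontal, so ⟨γ', V⟩ vanishes along it; its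
derivative at 0 is ⟨x, ∇_x V⟩. -/
theorem SingularRiemannianFoliation.inner_nabla_eq_zero (F : SingularRiemannianFoliation n M)
    {N : Set M} (hN : IsOpen N) {V : (p : M) → TangentSpace (𝓡 n) p} (hV : IsSmoothField N V)
    (hvert : ∀ p ∈ N, V p ∈ F.vertical p) {p : M} (hp : p ∈ N) {x : TangentSpace (𝓡 n) p}
    (hx : x ∈ F.horizontal p) : inner ℝ (nabla V p x) x = (0 : ℝ) := by
  obtain ⟨ε, hε, γ, hγ, h0⟩ := exists_isGeodesic x
  obtain rfl : γ 0 = p := congrArg TotalSpace.proj h0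
  obtain rfl : velocity n γ 0 = x := by simpa using h0
  have hmem : (0 : ℝ) ∈ Ioo (-ε) ε := by simp [hε]
  obtain ⟨f, hf, hfV⟩ := hV.exists_extension hN hp
  have h1 := hγ.2 _ hf 0 hmem
  have hhor := F.transnormal γ _ isOpen_Ioo isPreconnected_Ioo hγ ⟨0, hmem, hx⟩
  have hγc : ContinuousAt γ 0 := (hγ.1.contMDiffAt (isOpen_Ioo.mem_nhds hmem)).continuousAt
  have h2 : (fun s => (inner ℝ (velocity n γ s) ((f • V) (γ s)) : ℝ)) =ᶠ[𝓝 0] fun _ => 0 := by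
    filter_upwards [isOpen_Ioo.mem_nhds hmem, hγc.eventually hfV,
      hγc.eventually_mem (hN.mem_nhds hp)] with s hs h3 h4
    rw [h3]
    exact Submodule.inner_left_of_mem_orthogonal (hvert _ h4) (hhor s hs)
  have h3 := h1.unique ((hasDerivAt_const (0 : ℝ) (0 : ℝ)).congr_of_eventuallyEq h2)
  rwa [nabla_congr hfV, real_inner_comm] at h3

end Transnormal

/-! ### Brackets of vertical fields are vertical. -/

section Involutive

/-- If `V` is tangent to the immersion `j` near `x`, it has a differentiable lift. -/
theorem exists_differentiableAt_lift {E E' : Type*} [NormedAddCommGroup E] [NormedSpace ℝ E]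
    [FiniteDimensional ℝ E] [NormedAddCommGroup E'] [NormedSpace ℝ E'] [FiniteDimensional ℝ E']
    {j : E' → E} {x : E'} (hj : ContDiffAt ℝ 2 j x) (hinj : Function.Injective (fderiv ℝ j x))
    {V : E → E} (hV : DifferentiableAt ℝ V (j x))
    (hVj : ∀ᶠ y in 𝓝 x, ∃ w, fderiv ℝ j y w = V (j y)) :
    ∃ a : E' → E', DifferentiableAt ℝ a x ∧ ∀ᶠ y in 𝓝 x, fderiv ℝ j y (a y) = V (j y) := by
  obtain ⟨ρ', hρ'⟩ := (fderiv ℝ j x).toLinearMap.exists_leftInverse_of_injective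
    (LinearMap.ker_eq_bot.2 hinj)
  let ρ : E →L[ℝ] E' := LinearMap.toContinuousLinearMap ρ'
  have hρ : ρ.comp (fderiv ℝ j x) = 1 := by
    ext v; exact DFunLike.congr_fun hρ' v
  let T : E' → (E' →L[ℝ] E') := fun y => ρ.comp (fderiv ℝ j y)
  have hD : DifferentiableAt ℝ (fderiv ℝ j) x :=
    (hj.fderiv_right (m := 1) (by norm_num)).differentiableAt (by simp)
  have hT : DifferentiableAt ℝ T x := (differentiableAt_const ρ).clm_comp hD
  have hTx : T x = 1 := hρ
  have hU : ∀ᶠ y in 𝓝 x, IsUnit (T y) :=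
    hT.continuousAt.eventually_mem (Units.isOpen.mem_nhds (by rw [hTx]; exact isUnit_one))
  have hjd : DifferentiableAt ℝ j x := hj.differentiableAt (by simp)
  -- With ρ a left inverse of Dj(x), the operator ρ∘Dj(y) is invertible near x, so the lift is (ρ
  -- Dj(y))⁻¹ ρ V(j y), differentiable in y.
  refine ⟨fun y => Ring.inverse (T y) (ρ (V (j y))), ?_, ?_⟩
  · have h1 : DifferentiableAt ℝ (fun y => Ring.inverse (T y)) x := by
      have : DifferentiableAt ℝ (Ring.inverse : (E' →L[ℝ] E') → _) (T x) := by
        rw [hTx]; exact differentiableAt_inverse isUnit_one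
      exact this.comp x hT
    exact h1.clm_apply (ρ.differentiableAt.comp x (hV.comp x hjd))
  · filter_upwards [hVj, hU] with y ⟨w, hw⟩ hy
    have : Ring.inverse (T y) (ρ (V (j y))) = w := by
      rw [← hw]
      exact DFunLike.congr_fun (Ring.inverse_mul_cancel _ hy) w
    rw [this, hw]

/-- Differentiate Dj(a) = V∘j and Dj(b) = W∘j for lifts a, b. By symmetry of the second derivative
of j its contributions cancel, and [V,W] at j(x) is the image of [a,b]. -/
theorem lieBracket_mem_range_fderiv {E E' : Type*} [NormedAddCommGroup E] [NormedSpace ℝ E]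
    [FiniteDimensional ℝ E] [NormedAddCommGroup E'] [NormedSpace ℝ E'] [FiniteDimensional ℝ E']
    {j : E' → E} {x : E'} (hj : ContDiffAt ℝ 2 j x) (hinj : Function.Injective (fderiv ℝ j x))
    {V W : E → E} (hV : DifferentiableAt ℝ V (j x)) (hW : DifferentiableAt ℝ W (j x))
    (hVj : ∀ᶠ y in 𝓝 x, ∃ w, fderiv ℝ j y w = V (j y))
    (hWj : ∀ᶠ y in 𝓝 x, ∃ w, fderiv ℝ j y w = W (j y)) :
    ∃ w, fderiv ℝ j x w = lieBracket ℝ V W (j x) := by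
  have hD : DifferentiableAt ℝ (fderiv ℝ j) x :=
    (hj.fderiv_right (m := 1) (by norm_num)).differentiableAt (by simp)
  have hjd : DifferentiableAt ℝ j x := hj.differentiableAt (by simp)
  have key : ∀ {V : E → E} {a : E' → E'}, DifferentiableAt ℝ V (j x) → DifferentiableAt ℝ a x →
      (∀ᶠ y in 𝓝 x, fderiv ℝ j y (a y) = V (j y)) → ∀ b, fderiv ℝ V (j x) (fderiv ℝ j x b)
        = fderiv ℝ (fderiv ℝ j) x b (a x) + fderiv ℝ j x (fderiv ℝ a x b) := by
    intro V a hV ha h b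
    have h1 := (hV.hasFDerivAt.comp x hjd.hasFDerivAt)
    have h2 := hD.hasFDerivAt.clm_apply ha.hasFDerivAt
    have h3 := DFunLike.congr_fun (h1.unique (h2.congr_of_eventuallyEq
      (h.mono fun y hy => hy.symm))) b
    simp at h3
    rw [h3, add_comm]
  obtain ⟨a, ha, haV⟩ := exists_differentiableAt_lift hj hinj hV hVj
  obtain ⟨b, hb, hbW⟩ := exists_differentiableAt_lift hj hinj hW hWj
  have hsymm : IsSymmSndFDerivAt ℝ j x := hj.isSymmSndFDerivAt (by simp)
  refine ⟨fderiv ℝ b x (a x) - fderiv ℝ a x (b x), ?_⟩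
  rw [lieBracket, ← haV.self_of_nhds, ← hbW.self_of_nhds, key hV ha haV, key hW hb hbW,
    hsymm.eq (a x) (b x), map_sub]
  abel

variable {n : ℕ} {M : Type u} [TopologicalSpace M] [ChartedSpace (EuclideanSpace ℝ (Fin n)) M]
  [IsManifold (𝓡 n) ∞ M]

theorem mpullbackWithin_extChartAt_symm (V : (p : M) → TangentSpace (𝓡 n) p) {p z : M}
    (hz : z ∈ (extChartAt (𝓡 n) p).source) :
    (mpullbackWithin 𝓘(ℝ, EuclideanSpace ℝ (Fin n)) (𝓡 n) (extChartAt (𝓡 n) p).symm V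
      (range (𝓡 n)) (extChartAt (𝓡 n) p z) : EuclideanSpace ℝ (Fin n))
      = mfderiv (𝓡 n) 𝓘(ℝ, EuclideanSpace ℝ (Fin n)) (extChartAt (𝓡 n) p) z (V z) := by
  have key : ∀ y ∈ (extChartAt (𝓡 n) p).target,
      (mpullbackWithin 𝓘(ℝ, EuclideanSpace ℝ (Fin n)) (𝓡 n) (extChartAt (𝓡 n) p).symm V
        (range (𝓡 n)) y : EuclideanSpace ℝ (Fin n))
      = mfderiv (𝓡 n) 𝓘(ℝ, EuclideanSpace ℝ (Fin n)) (extChartAt (𝓡 n) p)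
        ((extChartAt (𝓡 n) p).symm y) (V ((extChartAt (𝓡 n) p).symm y)) := by
    intro y hy
    rw [mpullbackWithin_apply, ContinuousLinearMap.inverse_eq
      (mfderivWithin_extChartAt_symm_comp_mfderiv_extChartAt hy)
      (mfderiv_extChartAt_comp_mfderivWithin_extChartAt_symm hy)]
    rfl
  have := key _ ((extChartAt (𝓡 n) p).map_source hz)
  rwa [(extChartAt (𝓡 n) p).left_inv hz] at this

theorem LeafDecomposition.mlieBracket_mem_vertical (F : LeafDecomposition n M) {N : Set M}
    (hN : IsOpen N) {V W : (p : M) → TangentSpace (𝓡 n) p} (hV : IsSmoothField N V)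
    (hW : IsSmoothField N W) (hVv : ∀ p ∈ N, V p ∈ F.vertical p)
    (hWv : ∀ p ∈ N, W p ∈ F.vertical p) {p : M} (hp : p ∈ N) :
    mlieBracket (𝓡 n) V W p ∈ F.vertical p := by
  obtain ⟨L, ⟨q, rfl⟩, -⟩ := F.partition p
  set i := F.incl L with hi
  have his := F.contMDiff_incl L
  set φ := extChartAt (𝓡 n) (i q) with hφ
  set ψ := extChartAt (𝓡 (F.dim L)) q with hψ
  let E := EuclideanSpace ℝ (Fin n)
  let E' := EuclideanSpace ℝ (Fin (F.dim L))
  let j : E' → E := fun x => φ (i (ψ.symm x))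
  set x := ψ q with hx
  have hqx : ψ.symm x = q := by simp [hx, hψ]
  have hjx : j x = φ (i q) := by simp [j, hqx]
  have hev : ∀ᶠ y in 𝓝 x, y ∈ ψ.target ∧ i (ψ.symm y) ∈ φ.source ∩ N := by
    have h1 : ψ.target ∈ 𝓝 x := extChartAt_target_mem_nhds q
    have hc : ContinuousAt (fun y => i (ψ.symm y)) x :=
      ContinuousAt.comp (g := i) his.continuous.continuousAt (continuousAt_extChartAt_symm q)
    refine Filter.Eventually.and h1 (hc.eventually_mem ?_)
    simp only [hqx]
    exact inter_mem (extChartAt_source_mem_nhds _) (hN.mem_nhds hp)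
  have hjm : ∀ y, y ∈ ψ.target → i (ψ.symm y) ∈ φ.source →
      ContMDiffAt 𝓘(ℝ, E') 𝓘(ℝ, E) ∞ j y := by
    intro y hy hy'
    have h1 : ContMDiffAt 𝓘(ℝ, E') (𝓡 (F.dim L)) ∞ ψ.symm y :=
      (contMDiffOn_extChartAt_symm q).contMDiffAt ((isOpen_extChartAt_target q).mem_nhds hy)
    have h2 : ContMDiffAt (𝓡 n) 𝓘(ℝ, E) ∞ φ (i (ψ.symm y)) :=
      contMDiffAt_extChartAt' (by simpa [hφ, extChartAt_source] using hy')
    exact h2.comp y (his.contMDiffAt.comp y h1)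
  have hfd : ∀ y, y ∈ ψ.target → i (ψ.symm y) ∈ φ.source → ∀ w : E', fderiv ℝ j y w =
      mfderiv (𝓡 n) 𝓘(ℝ, E) φ (i (ψ.symm y)) (mfderiv (𝓡 (F.dim L)) (𝓡 n) i (ψ.symm y)
        (mfderiv 𝓘(ℝ, E') (𝓡 (F.dim L)) ψ.symm y w)) := by
    intro y hy hy' w
    have h1 : MDifferentiableAt 𝓘(ℝ, E') (𝓡 (F.dim L)) ψ.symm y :=
      ((contMDiffOn_extChartAt_symm q).contMDiffAt
        ((isOpen_extChartAt_target q).mem_nhds hy)).mdifferentiableAt (n := ∞) (by simp)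
    have h2 : MDifferentiableAt (𝓡 n) 𝓘(ℝ, E) φ (i (ψ.symm y)) :=
      mdifferentiableAt_extChartAt (by simpa [hφ, extChartAt_source] using hy')
    have h3 : MDifferentiableAt (𝓡 (F.dim L)) (𝓡 n) i (ψ.symm y) :=
      his.mdifferentiableAt (by simp)
    rw [← mfderiv_eq_fderiv]
    exact DFunLike.congr_fun (HasMFDerivAt.comp y h2.hasMFDerivAt
      (HasMFDerivAt.comp y h3.hasMFDerivAt h1.hasMFDerivAt)).mfderiv w
  -- This is the chart representative through which the manifold bracket is defined, so that bracket
  -- reduces to the one in Euclidean space.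
  let hat : ((p : M) → TangentSpace (𝓡 n) p) → E → E := fun V =>
    mpullbackWithin 𝓘(ℝ, E) (𝓡 n) φ.symm V (range (𝓡 n))
  have hlift : ∀ {V : (p : M) → TangentSpace (𝓡 n) p}, (∀ p ∈ N, V p ∈ F.vertical p) →
      ∀ᶠ y in 𝓝 x, ∃ w, fderiv ℝ j y w = hat V (j y) := by
    intro V hVv
    filter_upwards [hev] with y ⟨hy, hy1, hy2⟩
    obtain ⟨w, hw⟩ := (F.isTangentVec_iff L (ψ.symm y) _).1 (hVv _ hy2)
    refine ⟨mfderiv (𝓡 (F.dim L)) 𝓘(ℝ, E') ψ (ψ.symm y) w, ?_⟩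
    have h1 := mfderivWithin_extChartAt_symm_comp_mfderiv_extChartAt (I := 𝓡 (F.dim L)) hy
    rw [ModelWithCorners.range_eq_univ, mfderivWithin_univ] at h1
    have h2 : mfderiv 𝓘(ℝ, E') (𝓡 (F.dim L)) ψ.symm y
        (mfderiv (𝓡 (F.dim L)) 𝓘(ℝ, E') ψ (ψ.symm y) w) = w := DFunLike.congr_fun h1 w
    refine (hfd y hy hy1 _).trans ?_
    rw [h2, hw]
    exact (mpullbackWithin_extChartAt_symm V hy1).symm
  have hpre : φ.symm ⁻¹' univ ∩ range (𝓡 n) = univ := by simp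
  have hdiff : ∀ {V : (p : M) → TangentSpace (𝓡 n) p}, IsSmoothField N V →
      DifferentiableAt ℝ (hat V) (j x) := by
    intro V hV
    have h1 : IsDiffFieldAt V (i q) := hV.mdifferentiableAt hN hp
    have h2 := MDifferentiableWithinAt.differentiableWithinAt_mpullbackWithin_vectorField
      (mdifferentiableWithinAt_univ.2 h1)
    rw [hjx]
    rw [hpre] at h2
    exact differentiableWithinAt_univ.1 h2
  have hq0 := hev.self_of_nhds
  have hinj : Function.Injective (fderiv ℝ j x) := by
    intro v w hvw
    rw [hfd x hq0.1 hq0.2.1, hfd x hq0.1 hq0.2.1] at hvw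
    have h1 := (isInvertible_mfderiv_extChartAt (I := 𝓡 n) hq0.2.1).injective hvw
    have h2 := F.injective_mfderiv L _ h1
    have h3 := (isInvertible_mfderivWithin_extChartAt_symm (I := 𝓡 (F.dim L)) hq0.1)
    rw [ModelWithCorners.range_eq_univ, mfderivWithin_univ] at h3
    exact h3.injective h2
  have hj2 : ContDiffAt ℝ 2 j x :=
    (contMDiffAt_iff_contDiffAt.1 (hjm x hq0.1 hq0.2.1)).of_le (by simpa using ENat.LEInfty.out)
  obtain ⟨w, hw⟩ := lieBracket_mem_range_fderiv hj2 hinj (hdiff hV) (hdiff hW) (hlift hVv)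
    (hlift hWv)
  rw [hfd x hq0.1 hq0.2.1] at hw
  have hbr : mlieBracket (𝓡 n) V W (i q)
      = (mfderiv (𝓡 n) 𝓘(ℝ, E) φ (i q)).inverse (lieBracket ℝ (hat V) (hat W) (φ (i q))) := by
    have hlb : lieBracketWithin ℝ (hat V) (hat W) univ = lieBracket ℝ (hat V) (hat W) :=
      lieBracketWithin_univ
    rw [← mlieBracketWithin_univ, mlieBracketWithin_apply, hpre]
    exact congrArg (fun B : E → E => (mfderiv (𝓡 n) 𝓘(ℝ, E) φ (i q)).inverse (B (φ (i q)))) hlb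
  have hw' : ∃ u : TangentSpace (𝓡 (F.dim L)) (ψ.symm x), mfderiv (𝓡 n) 𝓘(ℝ, E) φ (i (ψ.symm x))
      (mfderiv (𝓡 (F.dim L)) (𝓡 n) i (ψ.symm x) u) = lieBracket ℝ (hat V) (hat W) (j x) := ⟨_, hw⟩
  rw [hqx, hjx] at hw'
  obtain ⟨u, hu⟩ := hw'
  refine (F.isTangentVec_iff L q _).2 ⟨u, ?_⟩
  rw [hbr]
  exact ((isInvertible_mfderiv_extChartAt
    (mem_extChartAt_source (i q))).inverse_apply_eq.2 hu.symm).symm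

end Involutive

/-! ### Smoothness of the vertical distribution on the regular part. -/

section VerticalFrame

variable {n : ℕ} {M : Type u} [TopologicalSpace M]
  [ChartedSpace (EuclideanSpace ℝ (Fin n)) M] [IsManifold (𝓡 n) ∞ M]

theorem LeafDecomposition.finrank_vertical (F : LeafDecomposition n M) (L : F.Leaf)
    (q : F.carrier L) : Module.finrank ℝ (F.vertical (F.incl L q)) = F.dim L := by
  have h : F.vertical (F.incl L q)
      = (mfderiv (𝓡 (F.dim L)) (𝓡 n) (F.incl L) q).toLinearMap.range := by
    ext v
    exact F.isTangentVec_iff L q v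
  rw [h, LinearMap.finrank_range_of_inj (F.injective_mfderiv L q)]
  exact finrank_euclideanSpace_fin

theorem LeafDecomposition.finrank_vertical_eq (F : LeafDecomposition n M) {p p' : M}
    (hp : p ∈ F.regularPart) (hp' : p' ∈ F.regularPart) :
    Module.finrank ℝ (F.vertical p) = Module.finrank ℝ (F.vertical p') := by
  obtain ⟨L, ⟨q, rfl⟩, -⟩ := F.partition p
  obtain ⟨L', ⟨q', rfl⟩, -⟩ := F.partition p'
  rw [F.finrank_vertical, F.finrank_vertical]
  exact le_antisymm (hp' L' L ⟨q', rfl⟩) (hp L L' ⟨q, rfl⟩)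

variable [RiemannianBundle (fun p : M => TangentSpace (𝓡 n) p)]
  [IsContMDiffRiemannianBundle (𝓡 n) ∞ (EuclideanSpace ℝ (Fin n))
      (fun p : M => TangentSpace (𝓡 n) p)]

/-- Independence is the nonvanishing of the Gram determinant, a continuous function. -/
theorem isOpen_setOf_linearIndependent_fields {m : ℕ} {N : Set M} (hN : IsOpen N)
    {s : Fin m → (p : M) → TangentSpace (𝓡 n) p} (hs : ∀ i, IsSmoothField N (s i)) :
    IsOpen {p ∈ N | LinearIndependent ℝ fun i => s i p} := by
  have h : {p ∈ N | LinearIndependent ℝ fun i => s i p}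
      = N ∩ (fun p => (Matrix.gram ℝ fun i => s i p).det) ⁻¹' {0}ᶜ := by
    ext p
    simp [Matrix.det_gram_ne_zero_iff_linearIndependent]
  rw [h]
  refine ContinuousOn.isOpen_inter_preimage ?_ hN isOpen_compl_singleton
  refine continuousOn_iff_continuous_domRestrict.2 (Continuous.matrix_det (continuous_matrix
    fun i j => ?_))
  exact continuousOn_iff_continuous_domRestrict.1 ((hs i).inner (hs j)).continuousOn

/-- Spanning fields that form a basis at `p` remain independent nearby. On the regular part the leaf
dimension is constant, so they remain a basis, and Gram–Schmidt makes it orthonormal. -/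
theorem SingularRiemannianFoliation.exists_verticalFrame (F : SingularRiemannianFoliation n M)
    {U : Set M} (hU : IsOpen U) (hUreg : U ⊆ F.regularPart) {p : M} (hp : p ∈ U) :
    ∃ (m : ℕ) (N : Set M) (e : Fin m → (p : M) → TangentSpace (𝓡 n) p), IsOpen N ∧ p ∈ N ∧ N ⊆ U ∧
      IsOrthonormalFrame N e ∧ ∀ q ∈ N, Submodule.span ℝ (range fun i => e i q) = F.vertical q := by
  obtain ⟨O, hO, hpO, 𝒳, h𝒳, hspan⟩ := F.spanned p
  obtain ⟨b, hb, hbs, hbl⟩ := exists_linearIndependent ℝ {v | ∃ X ∈ 𝒳, X p = v}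
  rw [hspan p hpO] at hbs
  have hfin : Finite b := hbl.finite
  choose s hs𝒳 hsp using fun v : b => hb v.2
  let eq := Finite.equivFin b
  let t : Fin (Nat.card b) → (p : M) → TangentSpace (𝓡 n) p := fun i => s (eq.symm i)
  have htp : ∀ i, t i p = (eq.symm i : b) := fun i => hsp _
  have hli : LinearIndependent ℝ fun i => t i p := by
    simp only [htp]
    exact hbl.comp _ eq.symm.injective
  have hts : ∀ i, IsSmoothField (O ∩ U) (t i) := fun i =>
    (h𝒳 _ (hs𝒳 _)).mono inter_subset_left
  have hrank : ∀ q ∈ U, Module.finrank ℝ (F.vertical q) = Nat.card b := fun q hq => by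
    rw [F.finrank_vertical_eq (hUreg hq) (hUreg hp), ← hbs]
    have h := finrank_span_eq_card hli
    have hr : range (fun i => t i p) = b := by
      simp only [htp]
      exact (eq.symm.surjective.range_comp Subtype.val).trans Subtype.range_coe
    rwa [hr, Fintype.card_fin] at h
  set N := {q ∈ O ∩ U | LinearIndependent ℝ fun i => t i q} with hN
  refine ⟨_, N, fun i p => InnerProductSpace.gramSchmidtNormed ℝ (fun j => t j p) i,
    isOpen_setOf_linearIndependent_fields (hO.inter hU) hts, ⟨⟨hpO, hp⟩, hli⟩,
    fun q hq => hq.1.2, ⟨fun i => isSmoothField_gramSchmidtNormed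
      (fun i => (hts i).mono fun q hq => hq.1) (fun q hq => hq.2) i,
      fun q hq => InnerProductSpace.gramSchmidtNormed_orthonormal hq.2⟩, fun q hq => ?_⟩
  rw [InnerProductSpace.span_gramSchmidtNormed_range, InnerProductSpace.span_gramSchmidt]
  refine Submodule.eq_of_le_of_finrank_eq (Submodule.span_le.2 ?_) ?_
  · rintro _ ⟨i, rfl⟩
    rw [← hspan q hq.1.1]
    exact Submodule.subset_span ⟨t i, hs𝒳 _, rfl⟩
  · rw [finrank_span_eq_card hq.2, Fintype.card_fin, hrank q hq.1.2]

/-- The vertical part of a vector field. -/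
def LeafDecomposition.vpart (F : LeafDecomposition n M) (X : (p : M) → TangentSpace (𝓡 n) p)
    (p : M) : TangentSpace (𝓡 n) p :=
  (F.vertical p).starProjection (X p)

theorem SingularRiemannianFoliation.isSmoothField_vpart (F : SingularRiemannianFoliation n M)
    {U : Set M} (hU : IsOpen U) (hUreg : U ⊆ F.regularPart) {X : (p : M) → TangentSpace (𝓡 n) p}
    (hX : IsSmoothField U X) : IsSmoothField U (F.vpart X) := by
  refine IsSmoothField.of_locally fun p hp => ?_
  obtain ⟨m, N, e, hN, hpN, hNU, he, hspan⟩ := F.exists_verticalFrame hU hUreg hp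
  refine ⟨N, hN, hpN, ?_⟩
  have := IsSmoothField.sum (s := Finset.univ) fun i _ =>
    IsSmoothField.smul ((he.smooth i).inner (hX.mono hNU)) (he.smooth i)
  refine this.congr fun q hq => ?_
  refine (Submodule.eq_starProjection_of_mem_of_inner_eq_zero ?_ ?_)
  · rw [← hspan q hq]
    exact Submodule.sum_mem _ fun i _ => Submodule.smul_mem _ _ (Submodule.subset_span ⟨i, rfl⟩)
  · intro w hw
    rw [← hspan q hq] at hw
    induction hw using Submodule.span_induction with
    | mem x h =>
      obtain ⟨i, rfl⟩ := h
      have h := (he.orthonormal q hq).inner_left_fintype (fun j => (inner ℝ (e j q) (X q) : ℝ)) i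
      rw [inner_sub_left, sub_eq_zero, real_inner_comm]
      exact h.symm
    | zero => simp
    | add x y _ _ hx hy => rw [inner_add_right, hx, hy, add_zero]
    | smul a x _ hx => rw [inner_smul_right, hx, mul_zero]

variable [T2Space M]

/-- Extend `v` arbitrarily and project. The projection makes sense at every point of `M`, so
verticality holds everywhere while smoothness is claimed on `U` only. -/
theorem SingularRiemannianFoliation.exists_vertical_extension
    (F : SingularRiemannianFoliation n M)
    {U : Set M} (hU : IsOpen U) (hUreg : U ⊆ F.regularPart) {p : M}
    {v : TangentSpace (𝓡 n) p} (hv : v ∈ F.vertical p) :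
    ∃ V : (p : M) → TangentSpace (𝓡 n) p, IsSmoothField U V ∧ (∀ q, V q ∈ F.vertical q) ∧
      V p = v := by
  obtain ⟨N, e, hN, hpN, he⟩ := exists_isOrthonormalFrame (n := n) p
  have h1 := IsSmoothField.sum (s := Finset.univ) fun i _ =>
    IsSmoothField.smul (f := fun _ => (inner ℝ (e i p) v : ℝ)) contMDiffOn_const (he.smooth i)
  obtain ⟨f, hf, hfe⟩ := h1.exists_extension hN hpN
  refine ⟨F.vpart _, F.isSmoothField_vpart hU hUreg (hf.mono (subset_univ _)),
    fun q => Submodule.starProjection_apply_mem _ _, ?_⟩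
  rw [LeafDecomposition.vpart, hfe.self_of_nhds]
  simp only [Pi.smul_apply']
  rw [he.sum_inner hpN]
  exact Submodule.starProjection_eq_self_iff.2 hv

end VerticalFrame

/-! ### The Levi-Civita structure on the smooth fields over an open set. -/

section Model

variable (n : ℕ) {M : Type u} [TopologicalSpace M]
  [ChartedSpace (EuclideanSpace ℝ (Fin n)) M] [IsManifold (𝓡 n) ∞ M]

/-- The algebra of functions that are smooth on `U`. -/
def smoothFunctions (U : Set M) : Subalgebra ℝ (M → ℝ) where
  carrier := {f | ContMDiffOn (𝓡 n) 𝓘(ℝ, ℝ) ∞ f U}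
  mul_mem' hf hg := hf.mul hg
  add_mem' hf hg := hf.add hg
  algebraMap_mem' _ := contMDiffOn_const

/-- The module of vector fields that are smooth on `U`. -/
def smoothFields (U : Set M) :
    Submodule (smoothFunctions n U) ((p : M) → TangentSpace (𝓡 n) p) where
  carrier := {X | IsSmoothField U X}
  add_mem' hX hY := hX.add hY
  zero_mem' := isSmoothField_zero
  smul_mem' f _ hX := hX.smul f.2

/-- The type of functions that are smooth on `U`. -/
def SmoothFun (U : Set M) : Type u := smoothFunctions n U

/-- The type of vector fields that are smooth on `U`. -/
def SmoothField (U : Set M) : Type u := smoothFields n U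

variable {n} {U : Set M}

instance : CommRing (SmoothFun n U) := inferInstanceAs (CommRing (smoothFunctions n U))

instance : Algebra ℝ (SmoothFun n U) := inferInstanceAs (Algebra ℝ (smoothFunctions n U))

instance : AddCommGroup (SmoothField n U) := inferInstanceAs (AddCommGroup (smoothFields n U))

instance : Module (SmoothFun n U) (SmoothField n U) :=
  inferInstanceAs (Module (smoothFunctions n U) (smoothFields n U))

instance : Module ℝ (SmoothField n U) :=
  Module.compHom (SmoothField n U) (algebraMap ℝ (SmoothFun n U))

instance : IsScalarTower ℝ (SmoothFun n U) (SmoothField n U) :=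
  IsScalarTower.of_algebraMap_smul fun _ _ => rfl

namespace SmoothFun

/-- The underlying function. -/
def val (f : SmoothFun n U) : M → ℝ := Subtype.val f

theorem prop (f : SmoothFun n U) : ContMDiffOn (𝓡 n) 𝓘(ℝ, ℝ) ∞ f.val U := Subtype.property f

/-- Constructor of `SmoothFun`. -/
def mk (f : M → ℝ) (hf : ContMDiffOn (𝓡 n) 𝓘(ℝ, ℝ) ∞ f U) : SmoothFun n U := ⟨f, hf⟩

theorem ext {f g : SmoothFun n U} (h : ∀ p, f.val p = g.val p) : f = g := Subtype.ext (funext h)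

@[simp] theorem val_mk (f : M → ℝ) (hf : ContMDiffOn (𝓡 n) 𝓘(ℝ, ℝ) ∞ f U) :
    (mk f hf).val = f := rfl

@[simp] theorem val_zero : (0 : SmoothFun n U).val = 0 := rfl

@[simp] theorem val_add (f g : SmoothFun n U) : (f + g).val = f.val + g.val := rfl

@[simp] theorem val_mul (f g : SmoothFun n U) : (f * g).val = f.val * g.val := rfl

@[simp] theorem val_smul (r : ℝ) (f : SmoothFun n U) : (r • f).val = (fun _ => r) * f.val := rfl

end SmoothFun

namespace SmoothField

/-- The underlying vector field. -/
def val (X : SmoothField n U) : (p : M) → TangentSpace (𝓡 n) p := Subtype.val X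

theorem prop (X : SmoothField n U) : IsSmoothField U X.val := Subtype.property X

/-- Constructor of `SmoothField`. -/
def mk (X : (p : M) → TangentSpace (𝓡 n) p) (hX : IsSmoothField U X) : SmoothField n U := ⟨X, hX⟩

theorem ext {X Y : SmoothField n U} (h : ∀ p, X.val p = Y.val p) : X = Y := Subtype.ext (funext h)

@[simp] theorem val_mk (X : (p : M) → TangentSpace (𝓡 n) p) (hX : IsSmoothField U X) :
    (mk X hX).val = X := rfl

@[simp] theorem val_zero : (0 : SmoothField n U).val = 0 := rfl

@[simp] theorem val_add (X Y : SmoothField n U) : (X + Y).val = X.val + Y.val := rfl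

@[simp] theorem val_sub (X Y : SmoothField n U) : (X - Y).val = X.val - Y.val := rfl

@[simp] theorem val_smul (f : SmoothFun n U) (X : SmoothField n U) : (f • X).val = f.val • X.val := rfl

@[simp] theorem val_smul_real (r : ℝ) (X : SmoothField n U) :
    (r • X).val = (fun _ : M => r) • X.val := rfl

theorem mdifferentiableAt (hU : IsOpen U) (X : SmoothField n U) {p : M} (hp : p ∈ U) :
    IsDiffFieldAt X.val p :=
  IsSmoothField.mdifferentiableAt X.prop hU hp

end SmoothField

theorem SmoothFun.mdifferentiableAt (hU : IsOpen U) (f : SmoothFun n U) {p : M}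
    (hp : p ∈ U) : MDifferentiableAt (𝓡 n) 𝓘(ℝ, ℝ) f.val p :=
  mdifferentiableAt_of_contMDiffOn hU f.prop hp

theorem mvfderiv_congr {f g : M → ℝ} {p : M} (h : f =ᶠ[𝓝 p] g) {v : TangentSpace (𝓡 n) p} :
    mvfderiv (𝓡 n) f p v = mvfderiv (𝓡 n) g p v := by
  change (mfderiv (𝓡 n) 𝓘(ℝ, ℝ) f p v : ℝ) = mfderiv (𝓡 n) 𝓘(ℝ, ℝ) g p v
  rw [h.mfderiv_eq]
  rfl

open Classical in
/-- The derivative of smooth functions along smooth vector fields on `U`. -/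
def derSmooth (hU : IsOpen U) :
    SmoothField n U →ₗ[SmoothFun n U] Derivation ℝ (SmoothFun n U) (SmoothFun n U) where
  toFun X := Derivation.mk'
    -- Elements are functions on all of `M`, equal only if they agree outside `U` as well. The value
    -- 0 there makes the axioms hold at every point.
    { toFun := fun f => .mk (fun p => if p ∈ U then mvfderiv (𝓡 n) f.val p (X.val p) else 0)
        ((contMDiffOn_mvfderiv hU f.prop X.prop).congr fun p hp => if_pos hp)
      map_add' := fun f g => by
        refine SmoothFun.ext fun p => ?_
        by_cases hp : p ∈ U
        · simp [hp, mvfderiv_add (f.mdifferentiableAt hU hp) (g.mdifferentiableAt hU hp)]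
        · simp [hp]
      map_smul' := fun r f => by
        refine SmoothFun.ext fun p => ?_
        by_cases hp : p ∈ U
        · have h := mvfderiv_mul (mdifferentiableAt_const (I := 𝓡 n) (c := r))
            (f.mdifferentiableAt hU hp)
          rw [mvfderiv_const, smul_zero, add_zero] at h
          simp [hp, h]
        · simp [hp] }
    fun f g => by
      refine SmoothFun.ext fun p => ?_
      by_cases hp : p ∈ U
      · simp [hp, mvfderiv_mul (f.mdifferentiableAt hU hp) (g.mdifferentiableAt hU hp)]
      · simp [hp]
  map_add' X Y := by
    refine Derivation.ext fun f => SmoothFun.ext fun p => ?_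
    by_cases hp : p ∈ U <;> simp [hp]
  map_smul' f X := by
    refine Derivation.ext fun g => SmoothFun.ext fun p => ?_
    by_cases hp : p ∈ U <;> simp [hp]

theorem derSmooth_apply (hU : IsOpen U) (X : SmoothField n U) (f : SmoothFun n U) {p : M}
    (hp : p ∈ U) : (derSmooth hU X f).val p = mvfderiv (𝓡 n) f.val p (X.val p) :=
  if_pos hp

theorem derSmooth_eventuallyEq (hU : IsOpen U) (X : SmoothField n U) (f : SmoothFun n U) {p : M}
    (hp : p ∈ U) : (derSmooth hU X f).val =ᶠ[𝓝 p] fun q => mvfderiv (𝓡 n) f.val q (X.val q) :=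
  (hU.eventually_mem hp).mono fun _ hq => derSmooth_apply hU X f hq

theorem derSmooth_apply_of_notMem (hU : IsOpen U) (X : SmoothField n U)
    (f : SmoothFun n U) {p : M} (hp : p ∉ U) : (derSmooth hU X f).val p = 0 :=
  if_neg hp

variable [RiemannianBundle (fun p : M => TangentSpace (𝓡 n) p)]
  [IsContMDiffRiemannianBundle (𝓡 n) ∞ (EuclideanSpace ℝ (Fin n))
      (fun p : M => TangentSpace (𝓡 n) p)]

/-- The metric on the smooth vector fields on `U`. -/
def metricSmooth (U : Set M) :
    SmoothField n U →ₗ[SmoothFun n U] SmoothField n U →ₗ[SmoothFun n U]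
      SmoothFun n U :=
  LinearMap.mk₂ _ (fun X Y => .mk (fun p => inner ℝ (X.val p) (Y.val p)) (IsSmoothField.inner X.prop Y.prop))
    (fun X X' Y => SmoothFun.ext fun p => by exact inner_add_left _ _ _)
    (fun f X Y => SmoothFun.ext fun p => by exact inner_smul_left _ _ _)
    (fun X Y Y' => SmoothFun.ext fun p => by exact inner_add_right _ _ _)
    (fun f X Y => SmoothFun.ext fun p => by exact inner_smul_right _ _ _)

open Classical in
/-- The Levi-Civita connection on the smooth vector fields on `U`. -/
def nablaSmooth (hU : IsOpen U) :
    SmoothField n U →ₗ[SmoothFun n U] SmoothField n U →ₗ[ℝ] SmoothField n U where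
  toFun X :=
    { toFun := fun Y => .mk (fun p => if p ∈ U then nabla Y.val p (X.val p) else 0)
        ((isSmoothField_nabla hU X.prop Y.prop).congr fun p hp => if_pos hp)
      map_add' := fun Y Y' => by
        refine SmoothField.ext fun p => ?_
        by_cases hp : p ∈ U
        · simp [hp, nabla_add (Y.mdifferentiableAt hU hp)
            (Y'.mdifferentiableAt hU hp)]
        · simp [hp]
      map_smul' := fun r Y => by
        refine SmoothField.ext fun p => ?_
        by_cases hp : p ∈ U
        · have h := nabla_smul (mdifferentiableAt_const (I := 𝓡 n) (c := r))
            (Y.mdifferentiableAt hU hp) (X.val p)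
          rw [mvfderiv_const, zero_apply, zero_smul, add_zero] at h
          simp [hp, h]
        · simp [hp] }
  map_add' X X' := by
    refine LinearMap.ext fun Y => SmoothField.ext fun p => ?_
    by_cases hp : p ∈ U <;> simp [hp]
  map_smul' f X := by
    refine LinearMap.ext fun Y => SmoothField.ext fun p => ?_
    by_cases hp : p ∈ U <;> simp [hp]

theorem nablaSmooth_apply (hU : IsOpen U) (X Y : SmoothField n U) {p : M}
    (hp : p ∈ U) : (nablaSmooth hU X Y).val p = nabla Y.val p (X.val p) :=
  if_pos hp

theorem nablaSmooth_apply_of_notMem (hU : IsOpen U) (X Y : SmoothField n U) {p : M}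
    (hp : p ∉ U) : (nablaSmooth hU X Y).val p = 0 :=
  if_neg hp

theorem nablaSmooth_eventuallyEq (hU : IsOpen U) (X Y : SmoothField n U) {p : M}
    (hp : p ∈ U) : (nablaSmooth hU X Y).val =ᶠ[𝓝 p] fun q => nabla Y.val q (X.val q) :=
  (hU.eventually_mem hp).mono fun _ hq => nablaSmooth_apply hU X Y hq

theorem bracketSmooth_apply (hU : IsOpen U) (X Y : SmoothField n U) {p : M} (hp : p ∈ U) :
    (nablaSmooth hU X Y - nablaSmooth hU Y X).val p = mlieBracket (𝓡 n) X.val Y.val p := by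
  rw [← nabla_torsion (X.mdifferentiableAt hU hp) (Y.mdifferentiableAt hU hp),
    ← nablaSmooth_apply hU X Y hp, ← nablaSmooth_apply hU Y X hp]
  rfl

theorem bracketSmooth_apply_of_notMem (hU : IsOpen U) (X Y : SmoothField n U) {p : M}
    (hp : p ∉ U) : (nablaSmooth hU X Y - nablaSmooth hU Y X).val p = 0 := by
  have : (nablaSmooth hU X Y).val p - (nablaSmooth hU Y X).val p = 0 := by
    rw [nablaSmooth_apply_of_notMem hU X Y hp, nablaSmooth_apply_of_notMem hU Y X hp, sub_zero]
  exact this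

theorem bracketSmooth_eventuallyEq (hU : IsOpen U) (X Y : SmoothField n U) {p : M} (hp : p ∈ U) :
    (nablaSmooth hU X Y - nablaSmooth hU Y X).val =ᶠ[𝓝 p] mlieBracket (𝓡 n) X.val Y.val :=
  (hU.eventually_mem hp).mono fun _ hq => bracketSmooth_apply hU X Y hq

/-- The Levi-Civita structure on the smooth vector fields on `U`. -/
def leviCivita (hU : IsOpen U) : LeviCivita (SmoothFun n U) (SmoothField n U) where
  der := derSmooth hU
  metric := metricSmooth U
  nab := nablaSmooth hU
  metric_comm X Y := SmoothFun.ext fun p => by exact real_inner_comm _ _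
  eq_zero_of_metric_self X h := by
    refine SmoothField.ext fun p => ?_
    exact (inner_self_eq_zero (𝕜 := ℝ)).1 (congrFun (congrArg SmoothFun.val h) p)
  nab_smul X f Y := by
    refine SmoothField.ext fun p => ?_
    by_cases hp : p ∈ U
    · refine (nablaSmooth_apply hU X (f • Y) hp).trans ((nabla_smul
        (f.mdifferentiableAt hU hp) (Y.mdifferentiableAt hU hp) _).trans ?_)
      rw [← derSmooth_apply hU X f hp, ← nablaSmooth_apply hU X Y hp]
      rfl
    · refine (nablaSmooth_apply_of_notMem hU X (f • Y) hp).trans ?_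
      change 0 = f.val p • (nablaSmooth hU X Y).val p + (derSmooth hU X f).val p • Y.val p
      rw [nablaSmooth_apply_of_notMem hU X Y hp, derSmooth_apply_of_notMem hU X f hp]
      simp
  der_metric X Y Z := by
    refine SmoothFun.ext fun p => ?_
    change _ = inner ℝ ((nablaSmooth hU X Y).val p) (Z.val p)
      + inner ℝ (Y.val p) ((nablaSmooth hU X Z).val p)
    by_cases hp : p ∈ U
    · rw [derSmooth_apply hU _ _ hp, nablaSmooth_apply hU X Y hp, nablaSmooth_apply hU X Z hp]
      exact mvfderiv_inner (Y.mdifferentiableAt hU hp)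
        (Z.mdifferentiableAt hU hp) _
    · rw [derSmooth_apply_of_notMem hU _ _ hp, nablaSmooth_apply_of_notMem hU X Y hp,
        nablaSmooth_apply_of_notMem hU X Z hp, inner_zero_left, inner_zero_right, add_zero]
  der_bracket X Y f := by
    refine SmoothFun.ext fun p => ?_
    change _ = (derSmooth hU X (derSmooth hU Y f)).val p - (derSmooth hU Y (derSmooth hU X f)).val p
    by_cases hp : p ∈ U
    · rw [derSmooth_apply hU _ _ hp, derSmooth_apply hU _ _ hp, derSmooth_apply hU _ _ hp,
        bracketSmooth_apply hU X Y hp, mvfderiv_mlieBracket hU X.prop Y.prop f.prop hp,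
        mvfderiv_congr (derSmooth_eventuallyEq hU X f hp),
        mvfderiv_congr (derSmooth_eventuallyEq hU Y f hp)]
    · rw [derSmooth_apply_of_notMem hU _ _ hp, derSmooth_apply_of_notMem hU _ _ hp,
        derSmooth_apply_of_notMem hU _ _ hp, sub_zero]
  jacobi X Y Z := by
    refine SmoothField.ext fun p => ?_
    by_cases hp : p ∈ U
    · have at2 : ∀ X : SmoothField n U,
          ContMDiffAt (𝓡 n) (𝓡 n).tangent (minSmoothness ℝ 2)
            (fun q => (⟨q, X.val q⟩ : TangentBundle (𝓡 n) M)) p := fun X =>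
        (ContMDiffOn.contMDiffAt X.prop (hU.mem_nhds hp)).of_le (by simpa using ENat.LEInfty.out)
      have J := leibniz_identity_mlieBracket_apply (at2 X) (at2 Y) (at2 Z)
      rw [← EventuallyEq.rfl.mlieBracket_vectorField_eq (bracketSmooth_eventuallyEq hU Y Z hp),
        ← EventuallyEq.rfl.mlieBracket_vectorField_eq (bracketSmooth_eventuallyEq hU X Z hp),
        ← (bracketSmooth_eventuallyEq hU X Y hp).mlieBracket_vectorField_eq
          (EventuallyEq.refl (𝓝 p) Z.val),
        ← bracketSmooth_apply hU _ _ hp, ← bracketSmooth_apply hU _ _ hp,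
        ← bracketSmooth_apply hU _ _ hp] at J
      exact J
    · refine (bracketSmooth_apply_of_notMem hU _ _ hp).trans (Eq.symm ?_)
      refine (congrArg₂ (· + ·) (bracketSmooth_apply_of_notMem hU _ _ hp)
        (bracketSmooth_apply_of_notMem hU _ _ hp)).trans (add_zero _)

end Model

/-! ### The foliated model, and the transfer of the algebraic result to the manifold. -/

section FoliatedModel

variable {n : ℕ} {M : Type u} [TopologicalSpace M] [T2Space M]
  [ChartedSpace (EuclideanSpace ℝ (Fin n)) M] [IsManifold (𝓡 n) ∞ M]
  [RiemannianBundle (fun p : M => TangentSpace (𝓡 n) p)]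
  [IsContMDiffRiemannianBundle (𝓡 n) ∞ (EuclideanSpace ℝ (Fin n))
      (fun p : M => TangentSpace (𝓡 n) p)] {U : Set M}

/-- The projection of the smooth vector fields on `U` to the vertical ones. -/
def projSmooth (F : SingularRiemannianFoliation n M) (hU : IsOpen U) (hUreg : U ⊆ F.regularPart) :
    SmoothField n U →ₗ[SmoothFun n U] SmoothField n U where
  toFun X := .mk (F.vpart X.val) (F.isSmoothField_vpart hU hUreg X.prop)
  map_add' _ _ := SmoothField.ext fun p => map_add (F.vertical p).starProjection _ _
  map_smul' f X := SmoothField.ext fun p => map_smul (F.vertical p).starProjection (f.val p) (X.val p)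

theorem projSmooth_apply (F : SingularRiemannianFoliation n M) (hU : IsOpen U)
    (hUreg : U ⊆ F.regularPart) (X : SmoothField n U) (p : M) :
    (projSmooth F hU hUreg X).val p = (F.vertical p).starProjection (X.val p) := rfl

theorem projSmooth_eq_self_iff {F : SingularRiemannianFoliation n M} {hU : IsOpen U}
    {hUreg : U ⊆ F.regularPart} {X : SmoothField n U} :
    projSmooth F hU hUreg X = X ↔ ∀ p, X.val p ∈ F.vertical p := by
  constructor
  · intro h p
    rw [← Submodule.starProjection_eq_self_iff, ← projSmooth_apply F hU hUreg, h]
  · exact fun h => SmoothField.ext fun p => Submodule.starProjection_eq_self_iff.2 (h p)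

theorem projSmooth_eq_zero_iff {F : SingularRiemannianFoliation n M} {hU : IsOpen U}
    {hUreg : U ⊆ F.regularPart} {X : SmoothField n U} :
    projSmooth F hU hUreg X = 0 ↔ ∀ p, X.val p ∈ F.horizontal p := by
  constructor
  · intro h p
    have h1 := projSmooth_apply F hU hUreg X p
    rw [h] at h1
    exact (Submodule.starProjection_apply_eq_zero_iff _).1 h1.symm
  · exact fun h => SmoothField.ext fun p => (Submodule.starProjection_apply_eq_zero_iff _).2 (h p)

theorem curv_leviCivita_apply (hU : IsOpen U) (X Y Z : SmoothField n U) {p : M} (hp : p ∈ U) :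
    ((leviCivita hU).curv X Y Z).val p = curvature X.val Y.val Z.val p := by
  have h1 := nablaSmooth_apply hU X (nablaSmooth hU Y Z) hp
  have h2 := nablaSmooth_apply hU Y (nablaSmooth hU X Z) hp
  have h3 := nablaSmooth_apply hU (nablaSmooth hU X Y - nablaSmooth hU Y X) Z hp
  rw [nabla_congr (nablaSmooth_eventuallyEq hU Y Z hp)] at h1
  rw [nabla_congr (nablaSmooth_eventuallyEq hU X Z hp)] at h2
  rw [bracketSmooth_apply hU X Y hp] at h3
  rw [curvature, ← h1, ← h2, ← h3]
  rfl

theorem curv_leviCivita_apply_of_notMem (hU : IsOpen U) (X Y Z : SmoothField n U) {p : M}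
    (hp : p ∉ U) : ((leviCivita hU).curv X Y Z).val p = 0 := by
  change (nablaSmooth hU X (nablaSmooth hU Y Z)).val p
    - (nablaSmooth hU Y (nablaSmooth hU X Z)).val p
    - (nablaSmooth hU (nablaSmooth hU X Y - nablaSmooth hU Y X) Z).val p = 0
  rw [nablaSmooth_apply_of_notMem hU _ _ hp, nablaSmooth_apply_of_notMem hU _ _ hp,
    nablaSmooth_apply_of_notMem hU _ _ hp, sub_zero, sub_zero]

open Classical in
/-- The algebraic model of a singular Riemannian foliation on an open set of regular points. -/
def foliatedLeviCivita {c : ℝ} (hc : HasConstantCurvature n M c)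
    (F : SingularRiemannianFoliation n M) (hU : IsOpen U) (hUreg : U ⊆ F.regularPart) :
    FoliatedLeviCivita (SmoothFun n U) (SmoothField n U) where
  __ := leviCivita hU
  proj := projSmooth F hU hUreg
  proj_proj X := projSmooth_eq_self_iff.2 fun p => Submodule.starProjection_apply_mem _ _
  metric_proj X Y := SmoothFun.ext fun _ =>
    Submodule.inner_starProjection_left_eq_right _ _ _
  proj_bracket V W hV hW := by
    rw [projSmooth_eq_self_iff] at hV hW ⊢
    intro p
    by_cases hp : p ∈ U
    · have h := F.mlieBracket_mem_vertical hU V.prop W.prop (fun p _ => hV p) (fun p _ => hW p) hp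
      rwa [← bracketSmooth_apply hU V W hp] at h
    · have h := (F.vertical p).zero_mem
      rwa [← bracketSmooth_apply_of_notMem hU V W hp] at h
  transnormal X V hX hV := by
    rw [projSmooth_eq_zero_iff] at hX
    rw [projSmooth_eq_self_iff] at hV
    refine SmoothFun.ext fun p => ?_
    change inner ℝ ((nablaSmooth hU X V).val p) (X.val p) = (0 : ℝ)
    by_cases hp : p ∈ U
    · rw [nablaSmooth_apply hU X V hp]
      exact F.inner_nabla_eq_zero hU V.prop (fun p _ => hV p) hp (hX p)
    · rw [nablaSmooth_apply_of_notMem hU X V hp, inner_zero_left]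
  -- It must vanish off `U`, because the curvature of the model does while the metric does not.
  const := .mk (fun p => if p ∈ U then c else 0)
    (contMDiffOn_const.congr fun p hp => if_pos hp)
  der_const X := by
    refine SmoothFun.ext fun p => ?_
    by_cases hp : p ∈ U
    · refine (derSmooth_apply hU X _ hp).trans ?_
      refine (mvfderiv_congr (g := fun _ => c)
        ((hU.eventually_mem hp).mono fun q hq => if_pos hq)).trans ?_
      rw [mvfderiv_const]
      rfl
    · exact derSmooth_apply_of_notMem hU X _ hp
  curv_const X Y := by
    refine SmoothFun.ext fun p => ?_
    change inner ℝ (((leviCivita hU).curv X Y Y).val p) (X.val p) = (if p ∈ U then c else 0) *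
      (inner ℝ (X.val p) (X.val p) * inner ℝ (Y.val p) (Y.val p)
        - (inner ℝ (X.val p) (Y.val p) ^ 2 : ℝ))
    by_cases hp : p ∈ U
    · rw [curv_leviCivita_apply hU _ _ _ hp, if_pos hp]
      exact hc.inner_curvature hU X.prop Y.prop hp
    · rw [curv_leviCivita_apply_of_notMem hU _ _ _ hp, if_neg hp, inner_zero_left, zero_mul]

open Classical in
/-- The restriction of a vector field to `U`, extended by zero. -/
def IsSmoothField.restrict {X : (p : M) → TangentSpace (𝓡 n) p} (hX : IsSmoothField U X) :
    SmoothField n U :=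
  .mk (fun p => if p ∈ U then X p else 0) (hX.congr fun _ hp => if_pos hp)

theorem IsSmoothField.restrict_apply {X : (p : M) → TangentSpace (𝓡 n) p}
    (hX : IsSmoothField U X) {p : M} (hp : p ∈ U) : hX.restrict.val p = X p := if_pos hp

theorem IsSmoothField.restrict_apply_of_notMem {X : (p : M) → TangentSpace (𝓡 n) p}
    (hX : IsSmoothField U X) {p : M} (hp : p ∉ U) : hX.restrict.val p = 0 := if_neg hp

theorem IsSmoothField.restrict_eventuallyEq {X : (p : M) → TangentSpace (𝓡 n) p}
    (hX : IsSmoothField U X) (hU : IsOpen U) {p : M} (hp : p ∈ U) : hX.restrict.val =ᶠ[𝓝 p] X :=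
  (hU.eventually_mem hp).mono fun _ hq => hX.restrict_apply hq

variable {X Y Z : (p : M) → TangentSpace (𝓡 n) p}

/-- Outside `U` nothing is known about `X`; extension by zero makes the pointwise horizontality and
bracket conditions of the model hold there too. -/
theorem restrict_mem_basic
    {c : ℝ} (hc : HasConstantCurvature n M c) (F : SingularRiemannianFoliation n M)
    (hU : IsOpen U) (hUreg : U ⊆ F.regularPart)
    (hX : F.IsBasicField U X) :
    hX.smooth.restrict ∈ (foliatedLeviCivita hc F hU hUreg).basic := by
  refine ⟨(projSmooth_eq_zero_iff (hU := hU) (hUreg := hUreg)).2 fun p => ?_, fun V hV => ?_⟩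
  · by_cases hp : p ∈ U
    · rw [hX.smooth.restrict_apply hp]; exact hX.mem_horizontal p hp
    · rw [hX.smooth.restrict_apply_of_notMem hp]; exact Submodule.zero_mem _
  · replace hV := (projSmooth_eq_self_iff (hU := hU) (hUreg := hUreg)).1 hV
    refine sub_eq_zero.2 (Eq.symm ((projSmooth_eq_self_iff (hU := hU) (hUreg := hUreg)).2 fun p => ?_))
    by_cases hp : p ∈ U
    · have h := hX.bracket_mem_vertical U hU Subset.rfl V.val V.prop (fun p _ => hV p) p hp
      rw [← neg_mem_iff, ← mlieBracket_swap_apply, ← EventuallyEq.rfl.mlieBracket_vectorField_eq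
        (hX.smooth.restrict_eventuallyEq hU hp), ← bracketSmooth_apply hU _ _ hp] at h
      exact h
    · have h := (F.vertical p).zero_mem
      rwa [← bracketSmooth_apply_of_notMem hU V hX.smooth.restrict hp] at h

theorem shapePow_apply
    {c : ℝ} (hc : HasConstantCurvature n M c) (F : SingularRiemannianFoliation n M)
    (hU : IsOpen U) (hUreg : U ⊆ F.regularPart)
    (hX : IsSmoothField U X) (hY : IsSmoothField U Y) (k : ℕ) {p : M}
    (hp : p ∈ U) :
    ((foliatedLeviCivita hc F hU hUreg).shapePow hX.restrict k hY.restrict).val p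
      = ((F.shape X p ^ k) (F.oneill X Y p) : TangentSpace (𝓡 n) p) := by
  induction k with
  | zero =>
    change (F.vertical p).starProjection ((nablaSmooth hU hX.restrict hY.restrict).val p) = _
    rw [nablaSmooth_apply hU _ _ hp, nabla_congr (hY.restrict_eventuallyEq hU hp),
      hX.restrict_apply hp]
    rfl
  | succ k ih =>
    change -(F.vertical p).starProjection ((nablaSmooth hU ((foliatedLeviCivita hc F hU
      hUreg).shapePow hX.restrict k hY.restrict) hX.restrict).val p) = _
    rw [nablaSmooth_apply hU _ _ hp, nabla_congr (hX.restrict_eventuallyEq hU hp), ih, pow_succ']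
    rfl

theorem contMDiffOn_inner_shape_pow
    {c : ℝ} (hc : HasConstantCurvature n M c) (F : SingularRiemannianFoliation n M)
    (hU : IsOpen U) (hUreg : U ⊆ F.regularPart)
    (hX : IsSmoothField U X) (hY : IsSmoothField U Y)
    (hZ : IsSmoothField U Z) (k : ℕ) : ContMDiffOn (𝓡 n) 𝓘(ℝ, ℝ) ∞
      (fun p => (inner ℝ ((F.shape X p ^ k) (F.oneill X Y p)) (F.oneill X Z p) : ℝ)) U := by
  have h := SmoothFun.prop ((foliatedLeviCivita hc F hU hUreg).metric
    ((foliatedLeviCivita hc F hU hUreg).shapePow hX.restrict k hY.restrict)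
    ((foliatedLeviCivita hc F hU hUreg).shapePow hX.restrict 0 hZ.restrict))
  refine h.congr fun p hp => ?_
  refine Eq.trans ?_ (congrArg₂ (inner ℝ) (shapePow_apply hc F hU hUreg hX hY k hp)
    (shapePow_apply hc F hU hUreg hX hZ 0 hp)).symm
  rfl

/-- The model speaks of vertical fields, so `v` is first extended to one. -/
theorem mvfderiv_inner_shape_pow
    {c : ℝ} (hc : HasConstantCurvature n M c) (F : SingularRiemannianFoliation n M)
    (hU : IsOpen U) (hUreg : U ⊆ F.regularPart)
    (hX : F.IsBasicField U X) (hY : F.IsBasicField U Y)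
    (hZ : F.IsBasicField U Z) (k : ℕ) {p : M} (hp : p ∈ U) {v : TangentSpace (𝓡 n) p}
    (hv : v ∈ F.vertical p) :
    mvfderiv (𝓡 n) (fun p => (inner ℝ ((F.shape X p ^ k) (F.oneill X Y p)) (F.oneill X Z p) : ℝ))
      p v = 0 := by
  obtain ⟨V, hV, hVv, rfl⟩ := F.exists_vertical_extension hU hUreg hv
  set G := foliatedLeviCivita hc F hU hUreg with hG
  have h := G.der_metric_shapePow (restrict_mem_basic hc F hU hUreg hX)
    (restrict_mem_basic hc F hU hUreg hY) (restrict_mem_basic hc F hU hUreg hZ)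
    (V := SmoothField.mk V hV) ((projSmooth_eq_self_iff (hU := hU) (hUreg := hUreg)).2 hVv) k
  have h2 := congrFun (congrArg SmoothFun.val h) p
  have h3 := (derSmooth_apply hU (SmoothField.mk V hV) _ hp).symm.trans h2
  refine Eq.trans ?_ (h3.trans rfl)
  refine (mvfderiv_congr ((hU.eventually_mem hp).mono fun q hq => ?_))
  refine Eq.trans ?_ (congrArg₂ (inner ℝ) (shapePow_apply hc F hU hUreg hX.smooth hY.smooth k hq)
    (shapePow_apply hc F hU hUreg hX.smooth hZ.smooth 0 hq)).symm
  rfl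

end FoliatedModel

/-! ### Recovering components from moments. -/

section Spectral

/-- Eigenvectors of a symmetric operator for distinct eigenvalues are orthogonal, so the `v i` form
an orthonormal basis diagonalizing `S`. -/
theorem inner_pow_apply_self_eq_sum {E : Type*} [NormedAddCommGroup E] [InnerProductSpace ℝ E]
    [FiniteDimensional ℝ E] {m : ℕ} (hm : Module.finrank ℝ E = m) {S : Module.End ℝ E}
    (hS : S.IsSymmetric) {μ : Fin m → ℝ} (hμ : Function.Injective μ) {v : Fin m → E}
    (hv : ∀ i, ‖v i‖ = 1 ∧ S (v i) = μ i • v i) (y : E) (k : ℕ) :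
    inner ℝ ((S ^ k) y) y = ∑ i, μ i ^ k * (inner ℝ y (v i)) ^ 2 := by
  have ho : Orthonormal ℝ v := by
    refine ⟨fun i => (hv i).1, fun i j hij => ?_⟩
    have h := hS (v i) (v j)
    rw [(hv i).2, (hv j).2, inner_smul_left, inner_smul_right, RCLike.conj_to_real] at h
    have h2 : (μ i - μ j) * inner ℝ (v i) (v j) = 0 := by rw [sub_mul, h, sub_self]
    exact (mul_eq_zero.1 h2).resolve_left (sub_ne_zero.2 (hμ.ne hij))
  have hpow : ∀ i, (S ^ k) (v i) = μ i ^ k • v i := fun i => by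
    induction k with
    | zero => simp
    | succ k ih => rw [pow_succ', Module.End.mul_apply, ih, map_smul, (hv i).2, smul_smul, pow_succ]
  let b : OrthonormalBasis (Fin m) ℝ E := OrthonormalBasis.mk ho (by
    rw [ho.linearIndependent.span_eq_top_of_card_eq_finrank' (by rw [Fintype.card_fin, hm])])
  have hb : ∀ i, b i = v i := fun i => by simp [b]
  rw [← b.sum_inner_mul_inner]
  refine Finset.sum_congr rfl fun i _ => ?_
  rw [hb, (hS.pow k) y (v i), hpow, inner_smul_right, real_inner_comm]
  ring

/-- If all weighted moments of distinct continuous functions `μ i` with the weights `(a i) ^ 2`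
are locally constant, then so are the continuous functions `a i`. -/
theorem eventually_eq_of_moments {T ι : Type*} [TopologicalSpace T] [Fintype ι]
    {t₀ : T} {μ a : ι → T → ℝ} (hμ : ∀ i, ContinuousAt (μ i) t₀)
    (ha : ∀ i, ContinuousAt (a i) t₀) (hinj : Function.Injective fun i => μ i t₀)
    (h : ∀ k : ℕ, ∀ᶠ t in 𝓝 t₀, ∑ i, μ i t ^ k * a i t ^ 2 = ∑ i, μ i t₀ ^ k * a i t₀ ^ 2)
    (i : ι) : ∀ᶠ t in 𝓝 t₀, a i t = a i t₀ := by
  classical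
  have hP : ∀ P : Polynomial ℝ, ∀ᶠ t in 𝓝 t₀,
      ∑ i, P.eval (μ i t) * a i t ^ 2 = ∑ i, P.eval (μ i t₀) * a i t₀ ^ 2 := by
    intro P
    induction P using Polynomial.induction_on' with
    | add p q hp hq =>
      filter_upwards [hp, hq] with t h1 h2
      simp only [Polynomial.eval_add, add_mul, Finset.sum_add_distrib, h1, h2]
    | monomial k r =>
      filter_upwards [h k] with t ht
      simp only [Polynomial.eval_monomial, mul_assoc, ← Finset.mul_sum, ht]
  have h1 : ∀ᶠ t in 𝓝 t₀, ∀ j, a j t = 0 ∨ μ j t = μ j t₀ := by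
    have hne : ∀ᶠ t in 𝓝 t₀, ∀ j l, l ≠ j → μ j t ≠ μ l t₀ := by
      refine eventually_all.2 fun j => eventually_all.2 fun l => ?_
      by_cases hlj : l = j
      · exact Eventually.of_forall fun t h => absurd hlj h
      · filter_upwards [(hμ j).eventually_ne (hinj.ne (Ne.symm hlj))] with t ht _ using ht
    filter_upwards [hP (∏ l, (Polynomial.X - Polynomial.C (μ l t₀)) ^ 2), hne] with t ht hne j
    have h0 : ∑ i, Polynomial.eval (μ i t₀) (∏ l, (Polynomial.X - Polynomial.C (μ l t₀)) ^ 2)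
        * a i t₀ ^ 2 = 0 := Finset.sum_eq_zero fun i _ => by
      rw [Polynomial.eval_prod, Finset.prod_eq_zero (Finset.mem_univ i) (by simp), zero_mul]
    rw [h0, Finset.sum_eq_zero_iff_of_nonneg] at ht
    · have h2 := ht j (Finset.mem_univ j)
      rw [Polynomial.eval_prod] at h2
      rcases mul_eq_zero.1 h2 with h2 | h2
      · right
        obtain ⟨l, -, hl⟩ := Finset.prod_eq_zero_iff.1 h2
        have hl : μ j t = μ l t₀ := by simpa [sub_eq_zero] using hl
        by_cases hlj : l = j
        · rw [hl, hlj]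
        · exact absurd hl (hne j l hlj)
      · left; simpa using h2
    · intro i _
      rw [Polynomial.eval_prod]
      refine mul_nonneg (Finset.prod_nonneg fun l _ => ?_) (sq_nonneg _)
      simpa using sq_nonneg _
  have hsq : ∀ᶠ t in 𝓝 t₀, a i t ^ 2 = a i t₀ ^ 2 := by
    -- An unnormalized Lagrange polynomial: near t₀ each μ_j has its old value wherever its weight
    -- is nonzero, so only the i-th term survives.
    set Q := ∏ l ∈ Finset.univ.erase i, (Polynomial.X - Polynomial.C (μ l t₀)) with hQ
    have hQ0 : ∀ j, j ≠ i → Q.eval (μ j t₀) = 0 := fun j hj => by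
      rw [hQ, Polynomial.eval_prod,
        Finset.prod_eq_zero (Finset.mem_erase.2 ⟨hj, Finset.mem_univ j⟩) (by simp)]
    have hQi : Q.eval (μ i t₀) ≠ 0 := by
      rw [hQ, Polynomial.eval_prod]
      refine Finset.prod_ne_zero_iff.2 fun l hl => ?_
      simpa [sub_eq_zero] using hinj.ne (Finset.ne_of_mem_erase hl).symm
    have hsum : ∀ t, (∀ j, a j t = 0 ∨ μ j t = μ j t₀) →
        ∑ j, Q.eval (μ j t) * a j t ^ 2 = Q.eval (μ i t₀) * a i t ^ 2 := fun t ht => by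
      rw [Finset.sum_eq_single i]
      · rcases ht i with h | h <;> simp [h]
      · intro j _ hj
        rcases ht j with h | h
        · simp [h]
        · rw [h, hQ0 j hj, zero_mul]
      · simp
    filter_upwards [hP Q, h1] with t ht h1
    rw [hsum t h1, hsum t₀ fun j => Or.inr rfl] at ht
    exact mul_left_cancel₀ hQi ht
  by_cases h0 : a i t₀ = 0
  · filter_upwards [hsq] with t ht
    rw [h0] at ht ⊢
    simpa using ht
  -- The square fixes a_i up to sign, and continuity excludes the opposite nonzero value.
  · have hne : a i t₀ ≠ -a i t₀ := fun h => h0 (by linarith)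
    filter_upwards [hsq, (ha i).eventually_ne hne] with t ht hne
    exact (sq_eq_sq_iff_eq_or_eq_neg.1 ht).resolve_right hne

end Spectral

/-! ### From vanishing vertical derivatives to local constancy on leaves. -/

section LocallyConstant

variable {n : ℕ} {M : Type u} [TopologicalSpace M]
  [ChartedSpace (EuclideanSpace ℝ (Fin n)) M]

/-- In a chart of the leaf the function has zero derivative on a ball, hence is constant there.
Neighbourhoods are those of the leaf topology. -/
theorem LeafDecomposition.isBasicFunction_of_mvfderiv_eq_zero (F : LeafDecomposition n M)
    {U : Set M} (hU : IsOpen U) {f : M → ℝ} (hf : ContMDiffOn (𝓡 n) 𝓘(ℝ, ℝ) ∞ f U)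
    (h : ∀ p ∈ U, ∀ v ∈ F.vertical p, mvfderiv (𝓡 n) f p v = 0) : F.IsBasicFunction U f := by
  refine ⟨hf, fun L q hq => ?_⟩
  set i := F.incl L with hi
  have his := F.contMDiff_incl L
  set ψ := extChartAt (𝓡 (F.dim L)) q with hψ
  let E' := EuclideanSpace ℝ (Fin (F.dim L))
  set Ω := ψ.target ∩ ψ.symm ⁻¹' (i ⁻¹' U) with hΩ
  have hΩo : IsOpen Ω := (continuousOn_extChartAt_symm q).isOpen_inter_preimage
    (isOpen_extChartAt_target q) (hU.preimage his.continuous)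
  have hqx : ψ.symm (ψ q) = q := by simp [hψ]
  have hqΩ : ψ q ∈ Ω := ⟨mem_extChartAt_target q, by simpa [hqx] using hq⟩
  obtain ⟨r, hr, hball⟩ := Metric.isOpen_iff.1 hΩo _ hqΩ
  have hd : ∀ x ∈ Ω, HasFDerivAt (fun x : E' => f (i (ψ.symm x))) (0 : E' →L[ℝ] ℝ) x := by
    intro x hx
    have h1 : MDifferentiableAt 𝓘(ℝ, E') (𝓡 (F.dim L)) ψ.symm x :=
      ((contMDiffOn_extChartAt_symm q).contMDiffAt
        ((isOpen_extChartAt_target q).mem_nhds hx.1)).mdifferentiableAt (n := ∞) (by simp)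
    have h2 : MDifferentiableAt (𝓡 n) 𝓘(ℝ, ℝ) f (i (ψ.symm x)) :=
      (hf.contMDiffAt (hU.mem_nhds hx.2)).mdifferentiableAt (by simp)
    have h3 : MDifferentiableAt (𝓡 (F.dim L)) (𝓡 n) i (ψ.symm x) :=
      his.mdifferentiableAt (by simp)
    have h4 := HasMFDerivAt.comp x h2.hasMFDerivAt
      (HasMFDerivAt.comp x h3.hasMFDerivAt h1.hasMFDerivAt)
    refine (hasMFDerivAt_iff_hasFDerivAt.1 h4).congr_fderiv ?_
    ext w
    exact h _ hx.2 _ ((F.isTangentVec_iff L _ _).2 ⟨_, rfl⟩)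
  have hconst : ∀ x ∈ Metric.ball (ψ q) r, f (i (ψ.symm x)) = f (i q) := by
    intro x hx
    have h5 := Metric.isOpen_ball.is_const_of_fderiv_eq_zero (𝕜 := ℝ)
      (convex_ball (ψ q) r).isPreconnected
      (fun y hy => (hd y (hball hy)).differentiableAt.differentiableWithinAt)
      (fun y hy => (hd y (hball hy)).fderiv) hx (Metric.mem_ball_self hr)
    rw [h5, hqx]
  filter_upwards [extChartAt_source_mem_nhds (I := 𝓡 (F.dim L)) q,
    (continuousAt_extChartAt (I := 𝓡 (F.dim L)) q).eventually_mem (Metric.ball_mem_nhds _ hr)] with q' h6 h7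
  have := hconst _ h7
  rwa [ψ.left_inv h6] at this

end LocallyConstant

/-! ### Components of O'Neill's tensor along eigenvectors of the shape operator. -/

section Eigenvectors

variable {n : ℕ} {M : Type u} [TopologicalSpace M] [T2Space M]
  [ChartedSpace (EuclideanSpace ℝ (Fin n)) M] [IsManifold (𝓡 n) ∞ M]
  [RiemannianBundle (fun p : M => TangentSpace (𝓡 n) p)]
  [IsContMDiffRiemannianBundle (𝓡 n) ∞ (EuclideanSpace ℝ (Fin n))
      (fun p : M => TangentSpace (𝓡 n) p)] {U : Set M} {X Y : (p : M) → TangentSpace (𝓡 n) p}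

theorem isSymmetric_shape {c : ℝ} (hc : HasConstantCurvature n M c)
    (F : SingularRiemannianFoliation n M) (hU : IsOpen U) (hUreg : U ⊆ F.regularPart)
    (hX : F.IsBasicField U X) {p : M} (hp : p ∈ U) :
    LinearMap.IsSymmetric (F.shape X p) := by
  rintro ⟨v, hv⟩ ⟨w, hw⟩
  obtain ⟨V, hV, hVv, rfl⟩ := F.exists_vertical_extension hU hUreg hv
  obtain ⟨W, hW, hWv, rfl⟩ := F.exists_vertical_extension hU hUreg hw
  have key : ∀ {V : (p : M) → TangentSpace (𝓡 n) p} (hV : IsSmoothField U V)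
      (hVv : V p ∈ F.vertical p), ((foliatedLeviCivita hc F hU hUreg).shape hX.smooth.restrict
      (SmoothField.mk V hV)).val p = (F.shape X p ⟨V p, hVv⟩ : TangentSpace (𝓡 n) p) := by
    intro V hV hVv
    change -(F.vertical p).starProjection
      ((nablaSmooth hU (SmoothField.mk V hV) hX.smooth.restrict).val p) = _
    rw [nablaSmooth_apply hU _ _ hp, nabla_congr (hX.smooth.restrict_eventuallyEq hU hp)]
    rfl
  have h := (foliatedLeviCivita hc F hU hUreg).metric_shape_comm
    (restrict_mem_basic hc F hU hUreg hX).1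
    ((projSmooth_eq_self_iff (X := SmoothField.mk V hV) (hU := hU) (hUreg := hUreg)).2 hVv)
    ((projSmooth_eq_self_iff (X := SmoothField.mk W hW) (hU := hU) (hUreg := hUreg)).2 hWv)
  have h2 := congrFun (congrArg SmoothFun.val h) p
  have h3 := (congrArg (inner ℝ · (W p)) (key hV (hVv p))).symm.trans
    (h2.trans (congrArg (inner ℝ (V p)) (key hW (hWv p))))
  exact h3

theorem inner_oneill_eq (F : LeafDecomposition n M) (X Y : (p : M) → TangentSpace (𝓡 n) p) (p : M)
    (v : F.vertical p) : (inner ℝ (F.oneill X Y p) v : ℝ)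
      = inner ℝ (nabla Y p (X p)) (v : TangentSpace (𝓡 n) p) := by
  have h := Submodule.inner_starProjection_left_eq_right (F.vertical p) (nabla Y p (X p)) v.1
  rw [Submodule.starProjection_eq_self_iff.2 v.2] at h
  exact h

theorem inner_shape_eq (F : LeafDecomposition n M) (X : (p : M) → TangentSpace (𝓡 n) p) (p : M)
    (v w : F.vertical p) : (inner ℝ (F.shape X p v) w : ℝ)
      = -inner ℝ (nabla X p v) (w : TangentSpace (𝓡 n) p) := by
  have h := Submodule.inner_starProjection_left_eq_right (F.vertical p) (nabla X p v) w.1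
  rw [Submodule.starProjection_eq_self_iff.2 w.2] at h
  rw [← h, ← inner_neg_left]
  rfl

theorem continuousAt_inner_field {T : Type*} [TopologicalSpace T] {b : T → M} {t : T}
    {Z : (p : M) → TangentSpace (𝓡 n) p} (hU : IsOpen U) (hZ : IsSmoothField U Z)
    (hb : b t ∈ U) {v : (s : T) → TangentSpace (𝓡 n) (b s)}
    (hv : ContinuousAt (fun s => (⟨b s, v s⟩ : TangentBundle (𝓡 n) M)) t) :
    ContinuousAt (fun s => (inner ℝ (Z (b s)) (v s) : ℝ)) t := by
  have hbc : ContinuousAt b t := (FiberBundle.continuous_proj _ _).continuousAt.comp hv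
  have hZb : ContinuousAt (fun s => (⟨b s, Z (b s)⟩ : TangentBundle (𝓡 n) M)) t :=
    ContinuousAt.comp (f := b) (g := fun p => (⟨p, Z p⟩ : TangentBundle (𝓡 n) M))
      (hZ.contMDiffAt (hU.mem_nhds hb)).continuousAt hbc
  have : IsContinuousRiemannianBundle (EuclideanSpace ℝ (Fin n))
      (fun p : M => TangentSpace (𝓡 n) p) := by
    obtain ⟨g, hg, h⟩ := IsContMDiffRiemannianBundle.exists_contMDiff (IB := 𝓡 n) (n := ∞)
      (F := EuclideanSpace ℝ (Fin n)) (E := fun p : M => TangentSpace (𝓡 n) p)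
    exact ⟨g, hg.continuous, h⟩
  exact ContinuousAt.inner_bundle hZb hv

/-- The vectors `v` are merely continuous along `b`; expanding the direction in a smooth frame
reduces to inner products of `v` with smooth fields. -/
theorem continuousAt_inner_nabla {T : Type*} [TopologicalSpace T] {b : T → M} {t : T}
    (hU : IsOpen U) (hX : IsSmoothField U X)
    (hb : b t ∈ U) {v : (s : T) → TangentSpace (𝓡 n) (b s)}
    (hv : ContinuousAt (fun s => (⟨b s, v s⟩ : TangentBundle (𝓡 n) M)) t) :
    ContinuousAt (fun s => (inner ℝ (nabla X (b s) (v s)) (v s) : ℝ)) t := by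
  obtain ⟨N, e, hN, hpN, he⟩ := exists_isOrthonormalFrame (n := n) (b t)
  have hbc : ContinuousAt b t := (FiberBundle.continuous_proj _ _).continuousAt.comp hv
  have hs : ∀ i, IsSmoothField (N ∩ U) (e i) := fun i => (he.smooth i).mono inter_subset_left
  have h := tendsto_finsetSum Finset.univ fun i _ =>
    (continuousAt_inner_field hN (he.smooth i) hpN hv).mul
      (continuousAt_inner_field (hN.inter hU) (isSmoothField_nabla (hN.inter hU) (hs i)
        (hX.mono inter_subset_right)) ⟨hpN, hb⟩ hv)
  refine ContinuousAt.congr (f := fun s => ∑ i, (inner ℝ (e i (b s)) (v s) : ℝ)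
    * inner ℝ (nabla X (b s) (e i (b s))) (v s)) h ?_
  filter_upwards [hbc.eventually_mem (hN.mem_nhds hpN)] with s hs
  conv_rhs => rw [← he.sum_inner hs (v s), map_sum]
  rw [he.sum_inner hs, sum_inner]
  exact Finset.sum_congr rfl fun i _ => by rw [map_smul, inner_smul_left]; rfl

/-- The components of O'Neill's tensor in the directions of the eigenvectors of the shape operator
are locally constant along an open piece of a leaf. -/
theorem eventually_inner_oneill_eq {c : ℝ} (hc : HasConstantCurvature n M c)
    (F : SingularRiemannianFoliation n M) (hU : IsOpen U) (hUreg : U ⊆ F.regularPart)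
    (hX : F.IsBasicField U X) (hY : F.IsBasicField U Y) (L : F.Leaf) {W : Set (F.carrier L)}
    (hW : IsOpen W) (hWU : MapsTo (F.incl L) W U) {μ : Fin (F.dim L) → F.carrier L → ℝ}
    {V : Fin (F.dim L) → (q : F.carrier L) → F.vertical (F.incl L q)}
    (hμ : ∀ q ∈ W, Function.Injective fun i => μ i q)
    (hV : ∀ i, ContinuousOn (fun q =>
        (⟨F.incl L q, (V i q : TangentSpace (𝓡 n) (F.incl L q))⟩ : TangentBundle (𝓡 n) M)) W)
    (hVμ : ∀ i, ∀ q ∈ W, ‖V i q‖ = 1 ∧ F.shape X (F.incl L q) (V i q) = μ i q • V i q)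
    (i : Fin (F.dim L)) {q : F.carrier L} (hq : q ∈ W) :
    ∀ᶠ q' in 𝓝 q, (inner ℝ (F.oneill X Y (F.incl L q')) (V i q') : ℝ)
      = inner ℝ (F.oneill X Y (F.incl L q)) (V i q) := by
  have hVc : ∀ i, ContinuousAt (fun q =>
      (⟨F.incl L q, (V i q : TangentSpace (𝓡 n) (F.incl L q))⟩ : TangentBundle (𝓡 n) M)) q :=
    fun i => (hV i).continuousAt (hW.mem_nhds hq)
  refine eventually_eq_of_moments (μ := μ)
    (a := fun i q' => inner ℝ (F.oneill X Y (F.incl L q')) (V i q')) (fun i => ?_) (fun i => ?_)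
    (hμ q hq) (fun k => ?_) i
  -- Continuity of the eigenvalues is not assumed; it follows from μ_i = ⟨S_X V_i, V_i⟩ = −⟨∇_{V_i}
  -- X, V_i⟩.
  · refine (continuousAt_inner_nabla hU hX.smooth (hWU hq) (hVc i)).neg.congr ?_
    filter_upwards [hW.mem_nhds hq] with q' hq'
    have h := inner_shape_eq F.toLeafDecomposition X _ (V i q') (V i q')
    rw [Pi.neg_apply, ← h, (hVμ i q' hq').2]
    refine (real_inner_smul_left (V i q') (V i q') (μ i q')).trans ?_
    rw [real_inner_self_eq_norm_sq, (hVμ i q' hq').1, one_pow, mul_one]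
  · simp only [inner_oneill_eq]
    exact continuousAt_inner_field hU (isSmoothField_nabla hU hX.smooth hY.smooth) (hWU hq) (hVc i)
  -- The first claim with Z = Y; in the eigenbasis the function ⟨S_X^k A_X Y, A_X Y⟩ is the k-th
  -- moment.
  · have hb := F.isBasicFunction_of_mvfderiv_eq_zero hU
      (contMDiffOn_inner_shape_pow hc F hU hUreg hX.smooth hY.smooth hY.smooth k)
      fun p hp v hv => mvfderiv_inner_shape_pow hc F hU hUreg hX hY hY k hp hv
    have key : ∀ q ∈ W, _ := fun q hq => inner_pow_apply_self_eq_sum (F.finrank_vertical L q)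
      (isSymmetric_shape hc F hU hUreg hX (hWU hq)) (hμ q hq) (fun i => hVμ i q hq)
      (F.oneill X Y (F.incl L q)) k
    filter_upwards [hb.2 L q (hWU hq), hW.mem_nhds hq] with q' h1 h2
    rw [← key q' h2, ← key q hq, h1]

end Eigenvectors

end RiemFol

end

theorem mainTheorem6 {n : ℕ} {M : Type u} [TopologicalSpace M] [T2Space M]
    [ChartedSpace (EuclideanSpace ℝ (Fin n)) M] [IsManifold (𝓡 n) ∞ M]
    [RiemannianBundle (fun p : M => TangentSpace (𝓡 n) p)]
    [IsContMDiffRiemannianBundle (𝓡 n) ∞ (EuclideanSpace ℝ (Fin n))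
      (fun p : M => TangentSpace (𝓡 n) p)]
    (c : ℝ) (hc : RiemFol.HasConstantCurvature n M c)
    (F : RiemFol.SingularRiemannianFoliation n M)
    (U : Set M) (hU : IsOpen U) (hUreg : U ⊆ F.regularPart)
    (X : (p : M) → TangentSpace (𝓡 n) p) (hX : F.IsBasicField U X) :
    -- the functions `⟨S_X^k A_X Y, A_X Z⟩` are basic
    (∀ Y Z : (p : M) → TangentSpace (𝓡 n) p, F.IsBasicField U Y → F.IsBasicField U Z →
      ∀ k : ℕ, F.IsBasicFunction U
        (fun p => inner ℝ ((F.shape X p ^ k) (F.oneill X Y p)) (F.oneill X Z p))) ∧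
    -- unit eigenvector fields on `U`, with distinct eigenvalues at every point of `U`
    (∀ (m : ℕ) (μ : Fin m → M → ℝ) (V : Fin m → (p : M) → F.vertical p),
      (∀ p ∈ U, Module.finrank ℝ (F.vertical p) = m) →
      (∀ p ∈ U, Function.Injective fun i => μ i p) →
      (∀ i, RiemFol.IsSmoothField U fun p => (V i p : TangentSpace (𝓡 n) p)) →
      (∀ i, ∀ p ∈ U, ‖V i p‖ = 1 ∧ F.shape X p (V i p) = μ i p • V i p) →
      ∀ Y : (p : M) → TangentSpace (𝓡 n) p, F.IsBasicField U Y →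
        ∀ i, F.IsBasicFunction U (fun p => inner ℝ (F.oneill X Y p) (V i p))) ∧
    -- the same along an open piece `W` of a single leaf `L`
    (∀ (L : F.Leaf) (W : Set (F.carrier L)), IsOpen W → MapsTo (F.incl L) W U →
      ∀ (μ : Fin (F.dim L) → F.carrier L → ℝ)
        (V : Fin (F.dim L) → (q : F.carrier L) → F.vertical (F.incl L q)),
      (∀ q ∈ W, Function.Injective fun i => μ i q) →
      (∀ i, ContinuousOn (fun q =>
        (⟨F.incl L q, (V i q : TangentSpace (𝓡 n) (F.incl L q))⟩ : TangentBundle (𝓡 n) M)) W) →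
      (∀ i, ∀ q ∈ W, ‖V i q‖ = 1 ∧ F.shape X (F.incl L q) (V i q) = μ i q • V i q) →
      ∀ Y : (p : M) → TangentSpace (𝓡 n) p, F.IsBasicField U Y →
        ∀ i, ∀ q ∈ W, ∀ᶠ q' in 𝓝 q,
          (inner ℝ (F.oneill X Y (F.incl L q')) (V i q') : ℝ)
            = inner ℝ (F.oneill X Y (F.incl L q)) (V i q)) := by
  refine ⟨fun Y Z hY hZ k => F.isBasicFunction_of_mvfderiv_eq_zero hU
      (RiemFol.contMDiffOn_inner_shape_pow hc F hU hUreg hX.smooth hY.smooth hZ.smooth k)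
      fun p hp v hv => RiemFol.mvfderiv_inner_shape_pow hc F hU hUreg hX hY hZ k hp hv,
    fun m μ V hm hμ hV hVμ Y hY i => ⟨?_, fun L q hq => ?_⟩,
    fun L W hW hWU μ V hμ hV hVμ Y hY i q hq =>
      RiemFol.eventually_inner_oneill_eq hc F hU hUreg hX hY L hW hWU hμ hV hVμ i hq⟩
  · simp only [RiemFol.inner_oneill_eq]
    exact (RiemFol.isSmoothField_nabla hU hX.smooth hY.smooth).inner (hV i)
  · obtain rfl : m = F.dim L := (hm _ hq).symm.trans (F.finrank_vertical L q)
    -- The statement on `U` follows from the one on a leaf, applied to the part of the leaf inside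
    -- `U`, which is open in the leaf topology.
    have hc' := (F.contMDiff_incl L).continuous
    exact RiemFol.eventually_inner_oneill_eq hc F hU hUreg hX hY L
      (W := F.incl L ⁻¹' U) (μ := fun i q => μ i (F.incl L q)) (V := fun i q => V i (F.incl L q))
      (hU.preimage hc') (fun _ h => h) (fun q hq => hμ _ hq)
      (fun i => (hV i).continuousOn.comp hc'.continuousOn fun _ h => h)
      (fun i q hq => hVμ i _ hq) i hq
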